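/- **Setting.** Let $d_\gamma\ge 1$ and $d_\beta,d_\delta\ge 0$ be integers, $\theta=(\gamma,\beta,\delta)\in\mathbb R^{d_\gamma+d_\beta+d_\delta}$, and $\Theta=\Theta_\gamma\times\Theta_\beta\times\Theta_\delta$ with $\Theta_\gamma=[\gamma_L,\gamma_U]^s\times[0,\gamma_U]^{d_\gamma-s}$, $\Theta_\beta=[0,\beta_U]^{d_\beta}$ (sets of real vectors), $0\le s\le d_\gamma$, $-\infty\le\gamma_L<0<\gamma_U\le\infty$, $0<\beta_U\le\infty$, and $\Theta_\delta\subset\mathbb R^{d_\delta}$ compact. Let $\Phi$ be a compact metric space, $\Phi(\theta)\subset\Phi$ (possibly empty), and $\Psi=\{\psi=(\theta,\phi):\theta\in\Theta,\ \phi\in\Phi(\theta)\}$. The law of the data $(W_t)_{t\ge1}$ under $\psi$ is $\mathbb P_\psi$, and $L_n(\theta)=f_n(W_1,\dots,W_n;\theta)$ is a real criterion function. Fix $\gamma_0\in\Theta_\gamma$, and let $\Theta_{H_0}=\{\theta\in\Theta:\gamma=\gamma_0\}$ and $\Psi_0=\{\psi\in\Psi:\gamma=\gamma_0\}$. Under the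 null the true values of $\delta$ are interior and those of $\beta$ stay away from the upper end point, uniformly: the closure of $\{\delta:\psi\in\Psi_0\}$ lies in the interior of $\Theta_\delta$, and for some $\varepsilon>0$ all $\psi\in\Psi_0$ satisfy $\beta_i+\varepsilon\le\beta_U$ for all $i$. Let $\hat\theta_n$ maximize $L_n$ over $\Theta$, let $\tilde\theta_n$ maximize $L_n$ over $\Theta_{H_0}$ (almost surely, for all $n\ge1$, under every $\psi\in\Psi_0$), and let $\mathsf{LR}_n=2(L_n(\hat\theta_n)-L_n(\tilde\theta_n))$. **Drifting sequences.** A drifting sequence consists of $\psi_n=(\theta_n,\phi_n)\in\Psi_0$, with $n$ running through all positive integers or through an infinite subset of them, such that $\delta_n$ and $\phi_n$ converge in $\mathbb R^{d_\delta}$ and $\Phi$, and $\beta_n$ and $\sqrt n\,\beta_n$ converge in $[0,\infty]^{d_\beta}$. **Assumptions.** Fix $\kappa>0$ and let $\Upsilon$ be the set of positive definite matrices with all eigenvalues in $[\kappa,\kappa^{-1}]$. Let $\hat\Sigma_n$ and $\check\Sigma_{\beta,n}$ be symmetric matrices and $\check\beta_n\in\mathbb R^{d_\beta}$, all functions of the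 sample. Let $H$ and $H_\beta$ be the selection matrices with $H\theta=(\gamma,\beta)$ and $H_\beta\theta=\beta$. For every drifting sequence there are $\Omega_0,\Sigma_0\in\Upsilon$ such that, under $\mathbb P_{\psi_n}$: 1. $\hat\theta_n-\theta_n=o_p(1)$ and $\tilde\theta_n-\theta_n=o_p(1)$; 2. almost surely $L_n$ has continuous left/right partial derivatives of order two at all points of $\Theta$ with $\delta$ interior to $\Theta_\delta$; and for all deterministic $\epsilon_n\to0$, $\sup_{\theta\in\Theta:\|\theta-\theta_n\|\le\epsilon_n}\big\|n^{-1}\frac{\partial^2L_n(\theta)}{\partial\theta\partial\theta'}-n^{-1}\frac{\partial^2L_n(\theta_n)}{\partial\theta\partial\theta'}\big\|=o_p(1)$; 3. $n^{-1}\frac{\partial^2L_n(\theta_n)}{\partial\theta\partial\theta'}\to_p-\Omega_0$; 4. $n^{-1/2}\frac{\partial L_n(\theta_n)}{\partial\theta}\to_dN(0,\Sigma_0)$; 5. $\hat\Sigma_n\to_p\Sigma_0$; 6. $\sqrt n(\check\beta_n-\beta_n)\to_dN(0,\Sigma_\beta)$ and $\check\Sigma_{\beta,n}\to_p\Sigma_\beta$,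 where $\Sigma_\beta=H_\beta\Omega_0^{-1}\Sigma_0\Omega_0^{-1}H_\beta'$. **Critical value.** For matrices $\Omega,\Sigma$ and $x,y\in[0,\infty]^{d_\beta}$ let $Z\sim N(0,\Omega^{-1}\Sigma\Omega^{-1})$, $Q(\lambda)=(\lambda-HZ)'(H\Omega^{-1}H')^{-1}(\lambda-HZ)$, and $$\mathcal L(x,y)=\inf_{\lambda\in\{0\}^{d_\gamma}\times\Lambda_\beta(x)}Q(\lambda)-\inf_{\lambda\in\Lambda_\gamma\times\Lambda_\beta(y)}Q(\lambda),$$ where $\Lambda_\beta(b)=\prod_i[-b_i,\infty)$ ($=\mathbb R$ in coordinates with $b_i=\infty$) and $\Lambda_\gamma=\lim_n\sqrt n(\Theta_\gamma-\gamma_0)$ is the product over $i$ of $\mathbb R$, $[0,\infty)$ or $(-\infty,0]$ according as $\gamma_{0,i}$ is interior to its range, at its lower or at its upper end point. The $p$-quantile of a law is the smallest $c$ at which its distribution function is at least $p$. Let $\alpha\in(0,1)$ and $\eta\in(0,\alpha)$, and suppose that $\alpha-\eta<1/2$ or that at least one coordinate of $\gamma_0$ is interior to its range. Let $\check\Omega_{\beta,n}=\mathrm{diag}(\check\Sigma_{\beta,n})^{-1/2}\check\Sigma_{\beta,n}\mathrm{diag}(\check\Sigma_{\beta,n})^{-1/2}$,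 let $\check q_{1-\eta,n}$ be the $(1-\eta)$-quantile of $\max_i|\check Z_i|$ with $\check Z\sim N(0,\check\Omega_{\beta,n})$, and let $$b_{L,n,i}=\max\{0,\sqrt n\check\beta_{n,i}-\check q_{1-\eta,n}\check\Sigma_{\beta,n,ii}^{1/2}\},\qquad b_{U,n,i}=\max\{0,\sqrt n\check\beta_{n,i}+\check q_{1-\eta,n}\check\Sigma_{\beta,n,ii}^{1/2}\}.$$ Let $\mathsf{CV}_{\alpha,n}$ be the $(1-\alpha+\eta)$-quantile of $\mathcal L(b_{L,n},b_{U,n})$, the data held fixed, with $\hat\Omega_n=-n^{-1}\frac{\partial^2L_n(\hat\theta_n)}{\partial\theta\partial\theta'}$ and $\hat\Sigma_n$ in place of $\Omega$ and $\Sigma$. (If a matrix used as a covariance matrix here is not positive semidefinite, which has probability tending to zero along drifting sequences, the normal law is replaced by the point mass at $0$, and an inverse of a singular matrix by $0$.) **Theorem.** Under these assumptions, $$\limsup_{n\to\infty}\ \sup_{\psi\in\Psi_0}\mathbb P_\psi\big(\mathsf{LR}_n\ge\mathsf{CV}_{\alpha,n}\big)\le\alpha .$$ -/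

import Mathlib

open MeasureTheory ProbabilityTheory Filter Topology
open scoped ENNReal Matrix

noncomputable section

namespace LRSize

/-! ### Parameter vectors `θ = (γ, β, δ)` -/

/-- Coordinates of `θ = (γ, β, δ)`. -/
abbrev Idx (dγ dβ dδ : ℕ) : Type := Fin dγ ⊕ (Fin dβ ⊕ Fin dδ)

/-- The space `ℝ^{dγ + dβ + dδ}` of parameter vectors, with its Euclidean norm. -/
abbrev Param (dγ dβ dδ : ℕ) : Type := EuclideanSpace ℝ (Idx dγ dβ dδ)

variable {dγ dβ dδ : ℕ}

def gam (θ : Param dγ dβ dδ) (i : Fin dγ) : ℝ := θ (Sum.inl i)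

def bet (θ : Param dγ dβ dδ) (i : Fin dβ) : ℝ := θ (Sum.inr (Sum.inl i))

def del (θ : Param dγ dβ dδ) : EuclideanSpace ℝ (Fin dδ) :=
  WithLp.toLp 2 (fun i => θ (Sum.inr (Sum.inr i)))

/-- The position of the coordinates of `(γ, β)` among those of `θ`: the selection matrix `H` with
`H θ = (γ, β)` has its ones there. -/
def selIdx : Fin dγ ⊕ Fin dβ → Idx dγ dβ dδ
  | Sum.inl i => Sum.inl i
  | Sum.inr i => Sum.inr (Sum.inl i)

/-- `H A H'`, where `H θ = (γ, β)`. -/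
def blockH (A : Matrix (Idx dγ dβ dδ) (Idx dγ dβ dδ) ℝ) :
    Matrix (Fin dγ ⊕ Fin dβ) (Fin dγ ⊕ Fin dβ) ℝ :=
  A.submatrix selIdx selIdx

/-- `H_β A H_β'`, where `H_β θ = β`. -/
def blockBeta (A : Matrix (Idx dγ dβ dδ) (Idx dγ dβ dδ) ℝ) : Matrix (Fin dβ) (Fin dβ) ℝ :=
  A.submatrix (fun i => Sum.inr (Sum.inl i)) (fun i => Sum.inr (Sum.inl i))

/-- The positive definite matrices with all eigenvalues in `[κ, κ⁻¹]`. -/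
def Upsilon {m : Type*} [Fintype m] [DecidableEq m] (κ : ℝ) : Set (Matrix m m ℝ) :=
  {A | ∃ hA : A.PosDef, ∀ i, κ ≤ hA.isHermitian.eigenvalues i ∧ hA.isHermitian.eigenvalues i ≤ κ⁻¹}

/-! ### Left/right partial derivatives -/

/-- The left/right partial derivative of `g` in the `i`-th coordinate, relative to `S`: two-sided
where one can move both ways inside `S`, one-sided where one can move only one way. -/
def lrPartial {ι : Type*} [Fintype ι] [DecidableEq ι] (S : Set (EuclideanSpace ℝ ι))
    (g : EuclideanSpace ℝ ι → ℝ) (i : ι) (θ : EuclideanSpace ℝ ι) : ℝ :=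
  derivWithin (fun t : ℝ => g (θ + t • EuclideanSpace.single i (1 : ℝ)))
    {t : ℝ | θ + t • EuclideanSpace.single i (1 : ℝ) ∈ S} 0

/-- `g` has a left/right partial derivative in the `i`-th coordinate at `θ`, relative to `S`. -/
def HasLRPartialAt {ι : Type*} [Fintype ι] [DecidableEq ι] (S : Set (EuclideanSpace ℝ ι))
    (g : EuclideanSpace ℝ ι → ℝ) (i : ι) (θ : EuclideanSpace ℝ ι) : Prop :=
  DifferentiableWithinAt ℝ (fun t : ℝ => g (θ + t • EuclideanSpace.single i (1 : ℝ)))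
    {t : ℝ | θ + t • EuclideanSpace.single i (1 : ℝ) ∈ S} 0

/-- The vector of left/right first partial derivatives. -/
def lrGrad {ι : Type*} [Fintype ι] [DecidableEq ι] (S : Set (EuclideanSpace ℝ ι))
    (g : EuclideanSpace ℝ ι → ℝ) (θ : EuclideanSpace ℝ ι) : EuclideanSpace ℝ ι :=
  WithLp.toLp 2 (fun i => lrPartial S g i θ)

/-- The matrix of left/right second partial derivatives. -/
def lrHess {ι : Type*} [Fintype ι] [DecidableEq ι] (S : Set (EuclideanSpace ℝ ι))
    (g : EuclideanSpace ℝ ι → ℝ) (θ : EuclideanSpace ℝ ι) : Matrix ι ι ℝ :=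
  Matrix.of (fun i j => lrPartial S (lrPartial S g j) i θ)

/-- `g` has continuous left/right partial derivatives of order two at the points of `T ⊆ S`. -/
def HasContLRPartials2 {ι : Type*} [Fintype ι] [DecidableEq ι] (S T : Set (EuclideanSpace ℝ ι))
    (g : EuclideanSpace ℝ ι → ℝ) : Prop :=
  (∀ θ ∈ T, ∀ j, HasLRPartialAt S g j θ) ∧
  (∀ θ ∈ T, ∀ i j, HasLRPartialAt S (lrPartial S g j) i θ) ∧
  (∀ i j, ContinuousOn (fun θ => lrHess S g θ i j) T)

/-! ### The statistical model -/

/-- The parameter space, the laws of the data and the criterion function.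
`P ψ` is the law of the whole data sequence `(W_t)`, the sample of size `n` being its first `n`
coordinates; `f n x θ` is `L_n(θ)` at the sample `x`. -/
structure Model (dγ dβ dδ : ℕ) (𝒲 Φ : Type*) [MeasurableSpace 𝒲] where
  s : ℕ
  s_le : s ≤ dγ
  γL : EReal
  γU : EReal
  βU : EReal
  γL_neg : γL < 0
  γU_pos : 0 < γU
  βU_pos : 0 < βU
  Θδ : Set (EuclideanSpace ℝ (Fin dδ))
  isCompact_Θδ : IsCompact Θδ
  γ₀ : Fin dγ → ℝ
  /-- `φ ∈ Φset θ`: the pair `(θ, φ)` is admitted as a true parameter. -/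
  Φset : Param dγ dβ dδ → Set Φ
  P : Param dγ dβ dδ × Φ → ProbabilityMeasure (ℕ → 𝒲)
  f : (n : ℕ) → (Fin n → 𝒲) → Param dγ dβ dδ → ℝ
  measurable_f : ∀ n, Measurable (fun p : (Fin n → 𝒲) × Param dγ dβ dδ => f n p.1 p.2)

namespace Model

variable {𝒲 Φ : Type*} [MeasurableSpace 𝒲] (M : Model dγ dβ dδ 𝒲 Φ)

/-- Lower end point of the range of the `i`-th coordinate of `γ`. -/
def γlow (i : Fin dγ) : EReal := if (i : ℕ) < M.s then M.γL else 0

/-- `Θ_γ = [γL, γU]^s × [0, γU]^(dγ - s)`. -/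
def Θγ : Set (Fin dγ → ℝ) := {g | ∀ i, M.γlow i ≤ (g i : EReal) ∧ (g i : EReal) ≤ M.γU}

/-- `Θ_β = [0, βU]^dβ`. -/
def Θβ : Set (Fin dβ → ℝ) := {b | ∀ i, 0 ≤ b i ∧ (b i : EReal) ≤ M.βU}

/-- `Θ = Θ_γ × Θ_β × Θ_δ`. -/
def Θ : Set (Param dγ dβ dδ) := {θ | gam θ ∈ M.Θγ ∧ bet θ ∈ M.Θβ ∧ del θ ∈ M.Θδ}

/-- The part of `Θ` where `δ` is an interior point of `Θ_δ`. -/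
def Θint : Set (Param dγ dβ dδ) := {θ | θ ∈ M.Θ ∧ del θ ∈ interior M.Θδ}

/-- The restricted parameter set `{θ ∈ Θ : γ = γ₀}`. -/
def ΘH0 : Set (Param dγ dβ dδ) := {θ | θ ∈ M.Θ ∧ gam θ = M.γ₀}

/-- `Ψ = {(θ, φ) : θ ∈ Θ, φ ∈ Φ(θ)}`. -/
def Ψ : Set (Param dγ dβ dδ × Φ) := {ψ | ψ.1 ∈ M.Θ ∧ ψ.2 ∈ M.Φset ψ.1}

/-- The true parameters that satisfy the null hypothesis. -/
def ΨH0 : Set (Param dγ dβ dδ × Φ) := {ψ | ψ ∈ M.Ψ ∧ gam ψ.1 = M.γ₀}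

/-- Under the null hypothesis the true `δ` is interior to `Θ_δ` and the true `β` is away from the
upper end point of its range (no condition when `βU = ∞`), uniformly over the parameter space. -/
def TrueInterior : Prop :=
  closure ((fun ψ : Param dγ dβ dδ × Φ => del ψ.1) '' M.ΨH0) ⊆ interior M.Θδ ∧
  ∃ ε : ℝ, 0 < ε ∧ ∀ ψ ∈ M.ΨH0, ∀ i, ((bet ψ.1 i + ε : ℝ) : EReal) ≤ M.βU

/-- The `i`-th coordinate of `γ₀` is an interior point of its range. -/
def γ₀Interior (i : Fin dγ) : Prop :=
  M.γlow i < (M.γ₀ i : EReal) ∧ (M.γ₀ i : EReal) < M.γU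

/-- The sample of size `n`. -/
def sample (n : ℕ) (w : ℕ → 𝒲) : Fin n → 𝒲 := fun t => w t

/-! ### The limit of the likelihood ratio statistic and its quantiles -/

/-- `Λ_γ = lim √n (Θ_γ - γ₀)`: a factor is `ℝ` for an interior coordinate of `γ₀`, a half-line at an
end point. -/
def Λγ : Set (Fin dγ → ℝ) :=
  {l | ∀ i, ((M.γ₀ i : EReal) = M.γlow i → 0 ≤ l i) ∧ ((M.γ₀ i : EReal) = M.γU → l i ≤ 0)}

end Model

/-- `Λ_β(b) = [-b₁, ∞] × ⋯ × [-b_dβ, ∞]` for `b ∈ [0, ∞]^dβ`. -/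
def Λβ (b : Fin dβ → ℝ≥0∞) : Set (Fin dβ → ℝ) :=
  {l | ∀ i, -((b i : ℝ≥0∞) : EReal) ≤ (l i : EReal)}

/-- `Q(λ) = (λ - H z)' (H Ω⁻¹ H')⁻¹ (λ - H z)`. -/
def Q (Ω : Matrix (Idx dγ dβ dδ) (Idx dγ dβ dδ) ℝ) (z : Param dγ dβ dδ)
    (l : Fin dγ ⊕ Fin dβ → ℝ) : ℝ :=
  (fun a => l a - z (selIdx a)) ⬝ᵥ ((blockH Ω⁻¹)⁻¹ *ᵥ (fun a => l a - z (selIdx a)))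

namespace Model

variable {𝒲 Φ : Type*} [MeasurableSpace 𝒲] (M : Model dγ dβ dδ 𝒲 Φ)

/-- `𝓛(x, y) = inf_{{0} × Λ_β(x)} Q - inf_{Λ_γ × Λ_β(y)} Q`, as a function of the value `z` of the
Gaussian vector. -/
def Linf (Ω : Matrix (Idx dγ dβ dδ) (Idx dγ dβ dδ) ℝ) (x y : Fin dβ → ℝ≥0∞)
    (z : Param dγ dβ dδ) : ℝ :=
  sInf (Q Ω z '' {l | (∀ i, l (Sum.inl i) = 0) ∧ (fun i => l (Sum.inr i)) ∈ Λβ x}) -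
  sInf (Q Ω z '' {l | (fun i => l (Sum.inl i)) ∈ M.Λγ ∧ (fun i => l (Sum.inr i)) ∈ Λβ y})

end Model

/-- The `p`-quantile of the random variable `X` under the law `μ`. -/
def quantile {α : Type*} [MeasurableSpace α] (μ : Measure α) (X : α → ℝ) (p : ℝ) : ℝ :=
  sInf {c : ℝ | ENNReal.ofReal p ≤ μ {a | X a ≤ c}}

namespace Model

variable {𝒲 Φ : Type*} [MeasurableSpace 𝒲] (M : Model dγ dβ dδ 𝒲 Φ)

/-- The `p`-quantile of `𝓛(x, y)` for the Gaussian vector `Z ∼ N(0, Ω⁻¹ Σ Ω⁻¹)`. -/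
def cv (Ω Sig : Matrix (Idx dγ dβ dδ) (Idx dγ dβ dδ) ℝ) (p : ℝ) (x y : Fin dβ → ℝ≥0∞) : ℝ :=
  quantile (multivariateGaussian 0 (Ω⁻¹ * Sig * Ω⁻¹)) (M.Linf Ω x y) p

/-! ### Estimators, the test statistic and the critical value -/

/-- The statistics that enter the test: `θhat` and `θtil` are the unrestricted and the restricted
estimator of `θ`; `Sighat` estimates `Σ₀`; `βchk` and `Sigβchk` are the estimator of `β` and of its
asymptotic covariance matrix. -/
structure Estimators where
  θhat : (n : ℕ) → (Fin n → 𝒲) → Param dγ dβ dδ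
  θtil : (n : ℕ) → (Fin n → 𝒲) → Param dγ dβ dδ
  Sighat : (n : ℕ) → (Fin n → 𝒲) → Matrix (Idx dγ dβ dδ) (Idx dγ dβ dδ) ℝ
  βchk : (n : ℕ) → (Fin n → 𝒲) → EuclideanSpace ℝ (Fin dβ)
  Sigβchk : (n : ℕ) → (Fin n → 𝒲) → Matrix (Fin dβ) (Fin dβ) ℝ
  measurable_θhat : ∀ n, Measurable (θhat n)
  measurable_θtil : ∀ n, Measurable (θtil n)
  measurable_Sighat : ∀ n i j, Measurable (fun x => Sighat n x i j)
  measurable_βchk : ∀ n, Measurable (βchk n)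
  measurable_Sigβchk : ∀ n i j, Measurable (fun x => Sigβchk n x i j)
  isSymm_Sighat : ∀ n x, (Sighat n x).IsSymm
  isSymm_Sigβchk : ∀ n x, (Sigβchk n x).IsSymm
  /-- `θhat` maximizes `L_n` over `Θ`. -/
  argmax_θhat : ∀ ψ ∈ M.ΨH0, ∀ n, 1 ≤ n → ∀ᵐ w ∂(M.P ψ : Measure (ℕ → 𝒲)),
    θhat n (sample n w) ∈ M.Θ ∧
    ∀ θ ∈ M.Θ, M.f n (sample n w) θ ≤ M.f n (sample n w) (θhat n (sample n w))
  /-- `θtil` maximizes `L_n` over `{θ ∈ Θ : γ = γ₀}`. -/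
  argmax_θtil : ∀ ψ ∈ M.ΨH0, ∀ n, 1 ≤ n → ∀ᵐ w ∂(M.P ψ : Measure (ℕ → 𝒲)),
    θtil n (sample n w) ∈ M.ΘH0 ∧
    ∀ θ ∈ M.ΘH0, M.f n (sample n w) θ ≤ M.f n (sample n w) (θtil n (sample n w))

variable {M}

namespace Estimators

variable (T : M.Estimators)

/-- `LR_n = 2 (L_n(θhat) - L_n(θtil))`. -/
def LR (n : ℕ) (x : Fin n → 𝒲) : ℝ := 2 * (M.f n x (T.θhat n x) - M.f n x (T.θtil n x))

/-- `Ω̂_n = -n⁻¹ ∂²L_n(θhat)/∂θ∂θ'`. -/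
def Omhat (n : ℕ) (x : Fin n → 𝒲) : Matrix (Idx dγ dβ dδ) (Idx dγ dβ dδ) ℝ :=
  -((n : ℝ)⁻¹ • lrHess M.Θ (M.f n x) (T.θhat n x))

/-- `diag(Σ̌)^(-1/2) Σ̌ diag(Σ̌)^(-1/2)` for `Σ̌ = Sigβchk`. -/
def Omβchk (n : ℕ) (x : Fin n → 𝒲) : Matrix (Fin dβ) (Fin dβ) ℝ :=
  Matrix.diagonal (fun i => (√(T.Sigβchk n x i i))⁻¹) * T.Sigβchk n x *
    Matrix.diagonal (fun i => (√(T.Sigβchk n x i i))⁻¹)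

/-- The `(1 - η)`-quantile of `max_i |Z_i|` for `Z ∼ N(0, Omβchk)`. -/
def qchk (η : ℝ) (n : ℕ) (x : Fin n → 𝒲) : ℝ :=
  quantile (multivariateGaussian 0 (T.Omβchk n x)) (fun z => ⨆ i : Fin dβ, |z i|) (1 - η)

/-- `b_L = max{0, √n β̌ - q̌ diagv(Σ̌)^(1/2)}` (`ENNReal.ofReal` is the positive part). -/
def bL (η : ℝ) (n : ℕ) (x : Fin n → 𝒲) (i : Fin dβ) : ℝ≥0∞ :=
  ENNReal.ofReal (√n * T.βchk n x i - T.qchk η n x * √(T.Sigβchk n x i i))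

/-- `b_U = max{0, √n β̌ + q̌ diagv(Σ̌)^(1/2)}`. -/
def bU (η : ℝ) (n : ℕ) (x : Fin n → 𝒲) (i : Fin dβ) : ℝ≥0∞ :=
  ENNReal.ofReal (√n * T.βchk n x i + T.qchk η n x * √(T.Sigβchk n x i i))

/-- The critical value: the `(1 - α + η)`-quantile of `𝓛(b_L, b_U)` with `Ω₀` and `Σ₀` replaced by
their estimators. -/
def CV (α η : ℝ) (n : ℕ) (x : Fin n → 𝒲) : ℝ :=
  M.cv (T.Omhat n x) (T.Sighat n x) (1 - α + η) (T.bL η n x) (T.bU η n x)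

end Estimators

/-! ### Drifting sequences and the assumptions -/

/-- `ψ k` is the true parameter at sample size `n k`, where `n k` runs through all positive integers
or through a subsequence of them; the null hypothesis holds along the sequence, `ψ k` converges
(coordinates of `β` in `[0, ∞]`), and `√n β → b ∈ [0, ∞]^dβ`. -/
structure IsDrifting [TopologicalSpace Φ] (M : Model dγ dβ dδ 𝒲 Φ) (n : ℕ → ℕ)
    (ψ : ℕ → Param dγ dβ dδ × Φ) : Prop where
  strictMono : StrictMono n
  pos : ∀ k, 1 ≤ n k
  mem : ∀ k, ψ k ∈ M.ΨH0
  tendsto_β : ∃ β₀ : Fin dβ → ℝ≥0∞, ∀ i,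
    Tendsto (fun k => ENNReal.ofReal (bet (ψ k).1 i)) atTop (𝓝 (β₀ i))
  tendsto_δ : ∃ δ₀, Tendsto (fun k => del (ψ k).1) atTop (𝓝 δ₀)
  tendsto_φ : ∃ φ₀, Tendsto (fun k => (ψ k).2) atTop (𝓝 φ₀)
  tendsto_b : ∃ b : Fin dβ → ℝ≥0∞, ∀ i,
    Tendsto (fun k => ENNReal.ofReal (√(n k) * bet (ψ k).1 i)) atTop (𝓝 (b i))

/-- `X k = o_p(1)`, where the `k`-th probability is computed under `ψ k`. -/
def IsLittleOp (M : Model dγ dβ dδ 𝒲 Φ) (ψ : ℕ → Param dγ dβ dδ × Φ)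
    (X : ℕ → (ℕ → 𝒲) → ℝ) : Prop :=
  ∀ ε : ℝ, 0 < ε →
    Tendsto (fun k => (M.P (ψ k) : Measure (ℕ → 𝒲)) {w | ε ≤ |X k w|}) atTop (𝓝 0)

/-- The high-level assumptions along one drifting sequence, with limit matrices `Ω₀` and `Σ₀`. -/
structure Assumptions (T : M.Estimators) (κ : ℝ) (n : ℕ → ℕ) (ψ : ℕ → Param dγ dβ dδ × Φ)
    (Ω₀ Sig₀ : Matrix (Idx dγ dβ dδ) (Idx dγ dβ dδ) ℝ) : Prop where
  /-- Consistency of the two estimators. -/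
  consistent_hat : M.IsLittleOp ψ (fun k w => ‖T.θhat (n k) (sample (n k) w) - (ψ k).1‖)
  consistent_til : M.IsLittleOp ψ (fun k w => ‖T.θtil (n k) (sample (n k) w) - (ψ k).1‖)
  /-- Almost surely, `L_n` has continuous left/right partial derivatives of order two. -/
  smooth : ∀ k, ∀ᵐ w ∂(M.P (ψ k) : Measure (ℕ → 𝒲)),
    HasContLRPartials2 M.Θ M.Θint (M.f (n k) (sample (n k) w))
  /-- The supremum of the entries of `n⁻¹ (∂²L_n(θ) - ∂²L_n(θ_n))` over `‖θ - θ_n‖ ≤ ε_n` is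
  `o_p(1)`, for all deterministic `ε_n → 0`. -/
  equicontinuous : ∀ e : ℕ → ℝ, Tendsto e atTop (𝓝 0) → ∀ ε : ℝ, 0 < ε →
    Tendsto (fun k => (M.P (ψ k) : Measure (ℕ → 𝒲))
      {w | ∃ θ ∈ M.Θ, ‖θ - (ψ k).1‖ ≤ e k ∧ ∃ i j,
        ε ≤ |((n k : ℕ) : ℝ)⁻¹ * lrHess M.Θ (M.f (n k) (sample (n k) w)) θ i j -
          ((n k : ℕ) : ℝ)⁻¹ * lrHess M.Θ (M.f (n k) (sample (n k) w)) (ψ k).1 i j|})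
      atTop (𝓝 0)
  /-- Convergence of the Hessian. -/
  Ω₀_mem : Ω₀ ∈ Upsilon κ
  hessian : ∀ i j, M.IsLittleOp ψ (fun k w =>
    ((n k : ℕ) : ℝ)⁻¹ * lrHess M.Θ (M.f (n k) (sample (n k) w)) (ψ k).1 i j - (-Ω₀) i j)
  /-- Asymptotic normality of the score. -/
  Sig₀_mem : Sig₀ ∈ Upsilon κ
  score : TendstoInDistribution
    (fun k w => (√(n k))⁻¹ • lrGrad M.Θ (M.f (n k) (sample (n k) w)) (ψ k).1) atTop id
    (fun k => (M.P (ψ k) : Measure (ℕ → 𝒲))) (multivariateGaussian 0 Sig₀)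
  /-- Consistency of the estimator of `Σ₀`. -/
  covariance : ∀ i j, M.IsLittleOp ψ (fun k w =>
    T.Sighat (n k) (sample (n k) w) i j - Sig₀ i j)
  /-- Asymptotic normality of the estimator of `β`. -/
  normal_β : TendstoInDistribution
    (fun k w => √(n k) •
      (T.βchk (n k) (sample (n k) w) - WithLp.toLp 2 (bet (ψ k).1))) atTop id
    (fun k => (M.P (ψ k) : Measure (ℕ → 𝒲)))
    (multivariateGaussian 0 (blockBeta (Ω₀⁻¹ * Sig₀ * Ω₀⁻¹)))
  /-- Consistency of the estimator of its asymptotic covariance matrix. -/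
  covariance_β : ∀ i j, M.IsLittleOp ψ (fun k w =>
    T.Sigβchk (n k) (sample (n k) w) i j - blockBeta (Ω₀⁻¹ * Sig₀ * Ω₀⁻¹) i j)

end Model

end LRSize

end

/-! If the bound fails, there are null parameters ψ_k at sample sizes n_k → ∞ whose rejection
probabilities exceed some a > α. Since [0,∞], Θ_δ and Φ are compact, a subsequence is drifting, so
it is enough to bound the rejection probability along one drifting sequence
(`Assumptions.eventually_measure_reject_lt`).

There the argument is of Bonferroni type. A second-order expansion at θ_n gives LR ≤ 𝓛(√nβ_n, √nβ_n)
+ o_p(1), with 𝓛 evaluated at Ω₀⁻¹ times the normalized score (`lr_le_Linf`). Only an upper bound is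
needed: the unrestricted maximum is relaxed to the whole cone, and the restricted one is bounded
below by its value at an explicit feasible point with δ profiled out. Off an event of limiting
probability at most about η, the confidence band covers β with a margin: b_L ≤ √nβ_n and √nβ_n + ζ ≤
b_U. As 𝓛(x,y) is nonincreasing in x and nondecreasing in y, the critical value is then at least an
estimated quantile of 𝓛(√nβ_n, √nβ_n + ζ). By lower semicontinuity of quantiles this is
asymptotically no smaller than the quantile c of 𝓛(b, b + ζ), up to any positive slack
(`Assumptions.eventually_le_CV`). Finally P(𝓛(b, b + ζ) ≥ c) ≤ α - η (`measure_cv_le_Linf_le`).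

The last inequality requires that c carry no mass, which rests on two geometric facts. Along rays
from the vertex of {0} × Λ_β(x), 𝓛 grows at least linearly (`mul_infQ_sub_le`); a level set at a
positive level therefore meets each ray at most once and is null. And c > 0: if x_i < y_i or y_i = ∞
for every i, then 𝓛 ≤ 0 confines the γ-part of Z to a half-space, or to a hyperplane when a
coordinate of γ₀ is interior (`exists_linear_restriction`), an event of probability at most 1/2,
respectively 0. This strictness is the reason for the margin ζ. It is gained by shrinking the band
slightly, at an arbitrarily small cost in probability.

Convergence in probability is expressed as ordinary convergence along `probFilter`, so that
deterministic continuity statements apply to the estimators directly. -/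

namespace LRSize

/-! ### Coordinate boxes and the mean value inequality -/

section Calculus

set_option linter.unusedSectionVars false

variable {ι : Type*} [Fintype ι] [DecidableEq ι]

/-- The closed coordinate box with opposite vertices `a` and `b`. -/
def coordBox (a b : EuclideanSpace ℝ ι) : Set (EuclideanSpace ℝ ι) :=
  {x | ∀ i, x i ∈ Set.uIcc (a i) (b i)}

lemma left_mem_coordBox (a b : EuclideanSpace ℝ ι) : a ∈ coordBox a b :=
  fun _ => Set.left_mem_uIcc

lemma right_mem_coordBox (a b : EuclideanSpace ℝ ι) : b ∈ coordBox a b :=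
  fun _ => Set.right_mem_uIcc

lemma abs_sub_le_of_mem_coordBox {a b x : EuclideanSpace ℝ ι} (hx : x ∈ coordBox a b) (i : ι) :
    |x i - a i| ≤ |b i - a i| :=
  Set.abs_sub_left_of_mem_uIcc (hx i)

lemma norm_sub_le_of_mem_coordBox {a b x : EuclideanSpace ℝ ι} (hx : x ∈ coordBox a b) :
    ‖x - a‖ ≤ ‖b - a‖ := by
  rw [EuclideanSpace.norm_eq, EuclideanSpace.norm_eq]
  refine Real.sqrt_le_sqrt (Finset.sum_le_sum fun i _ => ?_)
  have := abs_sub_le_of_mem_coordBox hx i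
  simp only [PiLp.sub_apply, Real.norm_eq_abs]
  gcongr

lemma add_smul_single_apply (x : EuclideanSpace ℝ ι) (t : ℝ) (i j : ι) :
    (x + t • EuclideanSpace.single i (1 : ℝ)) j = if j = i then x j + t else x j := by
  by_cases h : j = i <;> simp [h]

lemma add_smul_single_mem_coordBox {a b x : EuclideanSpace ℝ ι} (hx : x ∈ coordBox a b) (i : ι)
    (t : ℝ) : x + t • EuclideanSpace.single i (1 : ℝ) ∈ coordBox a b ↔
      x i + t ∈ Set.uIcc (a i) (b i) := by
  constructor
  · intro h
    simpa [add_smul_single_apply] using h i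
  · intro h j
    rw [add_smul_single_apply]
    split_ifs with hj
    · subst hj; exact h
    · exact hx j

/-- `φ` has the partial derivatives `φ' i` within the box. -/
def HasPartialsOn (a b : EuclideanSpace ℝ ι) (φ : EuclideanSpace ℝ ι → ℝ)
    (φ' : ι → EuclideanSpace ℝ ι → ℝ) : Prop :=
  ∀ x ∈ coordBox a b, ∀ i, HasDerivWithinAt
    (fun t : ℝ => φ (x + t • EuclideanSpace.single i (1 : ℝ))) (φ' i x)
    {t : ℝ | x + t • EuclideanSpace.single i (1 : ℝ) ∈ coordBox a b} 0

/-- The mean value inequality on a coordinate line, whose intersection with the box is an interval.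
Partial derivatives are recorded at `t = 0` only, so the derivative at `u` comes from taking `x + u
e_i` as the new base point. -/
lemma HasPartialsOn.abs_sub_le_single {a b : EuclideanSpace ℝ ι} {φ : EuclideanSpace ℝ ι → ℝ}
    {φ' : ι → EuclideanSpace ℝ ι → ℝ} (h : HasPartialsOn a b φ φ') {C : ℝ} {i : ι}
    (hC : ∀ x ∈ coordBox a b, |φ' i x| ≤ C) {x : EuclideanSpace ℝ ι} (hx : x ∈ coordBox a b)
    {t : ℝ} (ht : x + t • EuclideanSpace.single i (1 : ℝ) ∈ coordBox a b) :
    |φ (x + t • EuclideanSpace.single i (1 : ℝ)) - φ x| ≤ C * |t| := by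
  set s : Set ℝ := {t : ℝ | x + t • EuclideanSpace.single i (1 : ℝ) ∈ coordBox a b} with hs
  have hs' : s = (fun t => x i + t) ⁻¹' Set.uIcc (a i) (b i) := by
    ext u; exact add_smul_single_mem_coordBox hx i u
  have hconv : Convex ℝ s := by
    rw [hs']; exact (convex_uIcc _ _).translate_preimage_right (x i)
  have h0 : (0 : ℝ) ∈ s := by simpa [hs] using hx
  have key := hconv.norm_image_sub_le_of_norm_hasDerivWithin_le
    (f := fun t : ℝ => φ (x + t • EuclideanSpace.single i (1 : ℝ)))
    (f' := fun t => φ' i (x + t • EuclideanSpace.single i (1 : ℝ))) (C := C) ?_ ?_ h0 ht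
  · simpa using key
  · intro u hu
    have h1 := h _ hu i
    have h2 : HasDerivWithinAt (fun v : ℝ => v - u) 1 s u :=
      ((hasDerivAt_id u).sub_const u).hasDerivWithinAt
    have h3 := HasDerivWithinAt.comp (h := fun v : ℝ => v - u) (x := u) (s := s)
      (s' := {t : ℝ | x + u • EuclideanSpace.single i (1 : ℝ) + t • EuclideanSpace.single i (1 : ℝ)
        ∈ coordBox a b}) (h₂ := fun t : ℝ => φ (x + u • EuclideanSpace.single i (1 : ℝ) +
          t • EuclideanSpace.single i (1 : ℝ)))
      (h₂' := φ' i (x + u • EuclideanSpace.single i (1 : ℝ))) (h' := 1)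
      (by simpa using h1) h2 ?_
    · have e : ((fun t : ℝ => φ (x + u • EuclideanSpace.single i (1 : ℝ) +
          t • EuclideanSpace.single i (1 : ℝ))) ∘ fun v : ℝ => v - u) =
          fun t : ℝ => φ (x + t • EuclideanSpace.single i (1 : ℝ)) := by
        funext v
        simp only [Function.comp]
        congr 1
        rw [add_assoc, ← add_smul]
        congr 2
        ring
      rw [e, mul_one] at h3
      exact h3
    · intro v hv
      simp only [Set.mem_ofPred_eq]
      rw [add_assoc, ← add_smul, add_sub_cancel]
      exact hv
  · intro u hu
    exact hC _ hu

/-- Coordinates are changed from `x` to `y` one at a time. All intermediate points stay in the box,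
so partial derivatives suffice and no joint differentiability is needed. -/
lemma HasPartialsOn.abs_sub_le {a b : EuclideanSpace ℝ ι} {φ : EuclideanSpace ℝ ι → ℝ}
    {φ' : ι → EuclideanSpace ℝ ι → ℝ} (h : HasPartialsOn a b φ φ') {C : ι → ℝ}
    (hC : ∀ i, ∀ x ∈ coordBox a b, |φ' i x| ≤ C i) {x y : EuclideanSpace ℝ ι}
    (hx : x ∈ coordBox a b) (hy : y ∈ coordBox a b) :
    |φ y - φ x| ≤ ∑ i, C i * |y i - x i| := by
  let p : Finset ι → EuclideanSpace ℝ ι := fun s => WithLp.toLp 2 fun i => if i ∈ s then y i else x i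
  have hp : ∀ s, p s ∈ coordBox a b := by
    intro s i
    by_cases hi : i ∈ s
    · simpa [p, hi] using hy i
    · simpa [p, hi] using hx i
  have main : ∀ s : Finset ι, |φ (p s) - φ x| ≤ ∑ i ∈ s, C i * |y i - x i| := by
    intro s
    induction s using Finset.induction_on with
    | empty =>
      have : p ∅ = x := by ext i; simp [p]
      simp [this]
    | insert i s his ih =>
      have e : p (insert i s) = p s + (y i - x i) • EuclideanSpace.single i (1 : ℝ) := by
        ext j
        rw [add_smul_single_apply]
        by_cases hj : j = i
        · subst hj; simp [p, his]
        · simp [p, hj]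
      have h1 := h.abs_sub_le_single (hC i) (hp s) (e ▸ hp (insert i s))
      rw [← e] at h1
      rw [Finset.sum_insert his]
      calc |φ (p (insert i s)) - φ x| = |(φ (p (insert i s)) - φ (p s)) + (φ (p s) - φ x)| := by ring_nf
        _ ≤ _ := (abs_add_le _ _).trans (add_le_add h1 ih)
  have : p Finset.univ = y := by ext i; simp [p]
  simpa [this] using main Finset.univ

lemma HasLRPartialAt.hasDerivWithinAt {S : Set (EuclideanSpace ℝ ι)} {g : EuclideanSpace ℝ ι → ℝ}
    {i : ι} {θ : EuclideanSpace ℝ ι} (h : HasLRPartialAt S g i θ) {B : Set (EuclideanSpace ℝ ι)}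
    (hB : B ⊆ S) : HasDerivWithinAt
      (fun t : ℝ => g (θ + t • EuclideanSpace.single i (1 : ℝ))) (lrPartial S g i θ)
      {t : ℝ | θ + t • EuclideanSpace.single i (1 : ℝ) ∈ B} 0 :=
  (DifferentiableWithinAt.hasDerivWithinAt h).mono fun _ ht => hB ht

lemma hasDerivAt_add_smul_single_apply (x : EuclideanSpace ℝ ι) (i j : ι) :
    HasDerivAt (fun t : ℝ => (x + t • EuclideanSpace.single i (1 : ℝ)) j)
      (if j = i then 1 else 0) 0 := by
  simp only [add_smul_single_apply]
  split_ifs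
  · exact (hasDerivAt_id (0 : ℝ)).const_add (x j)
  · exact hasDerivAt_const _ _

/-- Second-order expansion on a box along which the second partial derivatives are close to the
constant symmetric matrix `-A`. -/
theorem abs_taylor_two_le {S : Set (EuclideanSpace ℝ ι)} {g : EuclideanSpace ℝ ι → ℝ}
    {a b : EuclideanSpace ℝ ι} (hS : coordBox a b ⊆ S)
    (h1 : ∀ x ∈ coordBox a b, ∀ j, HasLRPartialAt S g j x)
    (h2 : ∀ x ∈ coordBox a b, ∀ i j, HasLRPartialAt S (lrPartial S g j) i x)
    {A : Matrix ι ι ℝ} (hA : A.IsSymm) {c : ℝ}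
    (hc : ∀ x ∈ coordBox a b, ∀ i j, |lrHess S g x i j + A i j| ≤ c) :
    |g b - g a - (∑ i, lrGrad S g a i * (b i - a i)) +
      (1 / 2) * ∑ i, ∑ j, A i j * (b i - a i) * (b j - a j)| ≤ c * (∑ i, |b i - a i|) ^ 2 := by
  -- `E0` is the error of the expansion and `E1 j` that of the linear approximation of the `j`-th
  -- partial. The partials of `E0` are the `E1 j`, those of `E1 j` are bounded by `c`, and both
  -- errors vanish at `a`: two mean value inequalities finish.
  let E1 : ι → EuclideanSpace ℝ ι → ℝ := fun j x =>
    lrPartial S g j x - lrPartial S g j a + ∑ i, A i j * (x i - a i)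
  let E0 : EuclideanSpace ℝ ι → ℝ := fun x => g x - g a - (∑ i, lrGrad S g a i * (x i - a i)) +
      (1 / 2) * ∑ i, ∑ j, A i j * (x i - a i) * (x j - a j)
  have hE1 : ∀ j, HasPartialsOn a b (E1 j) (fun i x => lrHess S g x i j + A i j) := by
    intro j x hx i
    have := (((h2 x hx i j).hasDerivWithinAt hS).sub_const (lrPartial S g j a)).add
      (HasDerivAt.fun_sum (u := Finset.univ) (fun k _ =>
        (((hasDerivAt_add_smul_single_apply x i k).sub_const (a k)).const_mul (A k j)))).hasDerivWithinAt
    refine HasDerivWithinAt.congr_deriv this ?_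
    simp [lrHess]
  have hE0 : HasPartialsOn a b E0 E1 := by
    intro x hx j
    have d := fun k => (hasDerivAt_add_smul_single_apply x j k).sub_const (a k)
    have q : HasDerivAt (fun t : ℝ => (1 / 2 : ℝ) * ∑ i, ∑ k, A i k *
        ((x + t • EuclideanSpace.single j (1 : ℝ)) i - a i) *
        ((x + t • EuclideanSpace.single j (1 : ℝ)) k - a k))
        (∑ i, A i j * (x i - a i)) 0 := by
      have := (HasDerivAt.fun_sum (u := Finset.univ) (fun i _ =>
        HasDerivAt.fun_sum (u := Finset.univ) (fun k _ =>
          ((d i).const_mul (A i k)).mul (d k)))).const_mul (1 / 2 : ℝ)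
      refine HasDerivAt.congr_deriv this ?_
      simp only [zero_smul, add_zero, mul_ite, mul_one, mul_zero, ite_mul, zero_mul,
        Finset.sum_add_distrib, Finset.sum_ite_irrel, Finset.sum_const_zero, Finset.sum_ite_eq',
        Finset.mem_univ, if_true]
      have : ∀ i, A j i = A i j := fun i => hA.apply i j
      simp only [this]
      ring
    have := ((((h1 x hx j).hasDerivWithinAt hS).sub_const (g a)).sub
      (HasDerivAt.fun_sum (u := Finset.univ) (fun k _ =>
        (d k).const_mul (lrGrad S g a k))).hasDerivWithinAt).add q.hasDerivWithinAt
    refine HasDerivWithinAt.congr_deriv this ?_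
    simp [E1, lrGrad]
  have ha := left_mem_coordBox a b
  have bE1 : ∀ j, ∀ x ∈ coordBox a b, |E1 j x| ≤ c * ∑ i, |b i - a i| := by
    intro j x hx
    have h := (hE1 j).abs_sub_le (C := fun _ => c) (fun i y hy => hc y hy i j) ha hx
    have e : E1 j a = 0 := by simp [E1]
    rw [e, sub_zero, ← Finset.mul_sum] at h
    refine h.trans (mul_le_mul_of_nonneg_left
      (Finset.sum_le_sum fun i _ => abs_sub_le_of_mem_coordBox hx i) ?_)
    exact (abs_nonneg _).trans (hc a ha j j)
  have h := hE0.abs_sub_le bE1 ha (right_mem_coordBox a b)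
  have e : E0 a = 0 := by simp [E0]
  rw [e, sub_zero, ← Finset.mul_sum] at h
  calc _ ≤ _ := h
    _ = _ := by ring

/-- Symmetry of second partial derivatives that are continuous on a box with a vertex at `a`. -/
theorem lrHess_symm_of_forall_box {S : Set (EuclideanSpace ℝ ι)} {g : EuclideanSpace ℝ ι → ℝ}
    {a : EuclideanSpace ℝ ι} {i j : ι}
    (H : ∀ c > 0, ∃ s t : ℝ, s ≠ 0 ∧ t ≠ 0 ∧
      (∀ x ∈ coordBox a (a + s • EuclideanSpace.single i (1 : ℝ) +
        t • EuclideanSpace.single j (1 : ℝ)), x ∈ S ∧ (∀ j, HasLRPartialAt S g j x) ∧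
        (∀ i j, HasLRPartialAt S (lrPartial S g j) i x) ∧
        ∀ i j, |lrHess S g x i j - lrHess S g a i j| ≤ c)) :
    lrHess S g a i j = lrHess S g a j i := by
  by_cases hij : i = j
  · rw [hij]
  -- The second difference of `g` over the rectangle is close to `s t` times the mixed derivative:
  -- apply the mean value inequality along `i` to the increment of `g` in direction `j`, then along
  -- `j` to the `i`-th partial.
  have key : ∀ (i j : ι), i ≠ j → ∀ (s t c : ℝ),
      (∀ x ∈ coordBox a (a + s • EuclideanSpace.single i (1 : ℝ) +
        t • EuclideanSpace.single j (1 : ℝ)), x ∈ S ∧ (∀ j, HasLRPartialAt S g j x) ∧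
        (∀ i j, HasLRPartialAt S (lrPartial S g j) i x) ∧
        ∀ i j, |lrHess S g x i j - lrHess S g a i j| ≤ c) →
      |g (a + s • EuclideanSpace.single i (1 : ℝ) + t • EuclideanSpace.single j (1 : ℝ)) -
        g (a + s • EuclideanSpace.single i (1 : ℝ)) -
        g (a + t • EuclideanSpace.single j (1 : ℝ)) + g a - s * t * lrHess S g a j i| ≤
        c * |t| * |s| := by
    intro i j hij s t c hx
    set ei := EuclideanSpace.single i (1 : ℝ) with hei
    set ej := EuclideanSpace.single j (1 : ℝ) with hej
    have hbox : ∀ x ∈ coordBox a (a + s • ei), x ∈ coordBox a (a + s • ei + t • ej) ∧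
        x + t • ej ∈ coordBox a (a + s • ei + t • ej) := by
      intro x hx
      have hxj : x j = a j := by
        have := hx j
        simpa [hei, Ne.symm hij] using this
      have h1 : x ∈ coordBox a (a + s • ei + t • ej) := by
        intro k
        by_cases hk : k = j
        · subst hk; rw [hxj]; exact Set.left_mem_uIcc
        · have := hx k
          simp only [hei, hej, add_smul_single_apply, hk, if_false] at this ⊢
          exact this
      refine ⟨h1, (add_smul_single_mem_coordBox h1 j t).2 ?_⟩
      rw [hxj]
      simp [hei, hej, Ne.symm hij]
    let φ : EuclideanSpace ℝ ι → ℝ := fun x =>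
      g (x + t • ej) - g x - (t * lrHess S g a j i) * (x i - a i)
    let ψ : EuclideanSpace ℝ ι → ℝ := fun x => lrPartial S g i x - lrHess S g a j i * (x j - a j)
    have hψ : HasPartialsOn a (a + s • ei + t • ej) ψ
        (fun k x => lrHess S g x k i - lrHess S g a j i * (if j = k then 1 else 0)) := by
      intro x hx' k
      exact (((hx x hx').2.2.1 k i).hasDerivWithinAt fun y hy => (hx y hy).1).sub
        (((hasDerivAt_add_smul_single_apply x k j).sub_const (a j)).const_mul _).hasDerivWithinAt
    have hφ : HasPartialsOn a (a + s • ei) φ (fun k x => lrPartial S g k (x + t • ej) -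
        lrPartial S g k x - (t * lrHess S g a j i) * (if i = k then 1 else 0)) := by
      intro x hx' k
      obtain ⟨m1, m2⟩ := hbox x hx'
      have d1 := ((hx _ m2).2.1 k).hasDerivWithinAt
        (B := {y | y - t • ej ∈ coordBox a (a + s • ei)}) (by
          intro y hy
          have := (hx _ (hbox _ hy).2).1
          simpa using this)
      have d2 := ((hx _ m1).2.1 k).hasDerivWithinAt
        (B := coordBox a (a + s • ei)) (fun y hy => (hx _ (hbox _ hy).1).1)
      have e : ∀ r : ℝ, x + t • ej + r • EuclideanSpace.single k (1 : ℝ) =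
        x + r • EuclideanSpace.single k (1 : ℝ) + t • ej := fun r => add_right_comm _ _ _
      simp only [e, Set.mem_ofPred_eq, add_sub_cancel_right] at d1
      exact (d1.sub d2).sub
        (((hasDerivAt_add_smul_single_apply x k i).sub_const (a i)).const_mul _).hasDerivWithinAt
    have bφ : ∀ x ∈ coordBox a (a + s • ei), |lrPartial S g i (x + t • ej) -
        lrPartial S g i x - (t * lrHess S g a j i) * (if i = i then 1 else 0)| ≤ c * |t| := by
      intro x hx'
      obtain ⟨m1, m2⟩ := hbox x hx'
      have := hψ.abs_sub_le_single (i := j) (C := c) (fun y hy => by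
        simpa using (hx y hy).2.2.2 j i) m1 m2
      convert this using 2
      simp [ψ, hej]
      ring
    have := hφ.abs_sub_le_single (i := i) bφ (left_mem_coordBox _ _) (right_mem_coordBox _ _)
    convert this using 2
    simp only [φ, add_smul_single_apply, hei, if_true, sub_self]
    ring
  -- The second difference is symmetric in the two directions, so `key` compares it with both mixed
  -- derivatives.
  have hle : ∀ c > 0, |lrHess S g a i j - lrHess S g a j i| ≤ 2 * c := by
    intro c hc
    obtain ⟨s, t, hs, ht, hx⟩ := H c hc
    have h1 := key i j hij s t c hx
    have h2 := key j i (Ne.symm hij) t s c (by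
      rw [add_right_comm]; exact hx)
    rw [add_right_comm a] at h2
    have hst : 0 < |s| * |t| := by positivity
    refine le_of_mul_le_mul_right ?_ hst
    calc |lrHess S g a i j - lrHess S g a j i| * (|s| * |t|)
        = |s * t * lrHess S g a i j - s * t * lrHess S g a j i| := by
          rw [← abs_mul, ← abs_mul]; congr 1; ring
      _ ≤ c * |t| * |s| + c * |s| * |t| := by
          rw [abs_le] at h1 h2 ⊢
          constructor <;> linarith [h1.1, h1.2, h2.1, h2.2]
      _ = 2 * c * (|s| * |t|) := by ring
  by_contra hne
  have hpos : 0 < |lrHess S g a i j - lrHess S g a j i| := abs_pos.2 (sub_ne_zero.2 hne)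
  have := hle (|lrHess S g a i j - lrHess S g a j i| / 4) (by positivity)
  linarith

end Calculus

/-! ### The parameter space near interior values of `δ` -/

namespace Model

variable {dγ dβ dδ : ℕ} {𝒲 Φ : Type*} [MeasurableSpace 𝒲] (M : Model dγ dβ dδ 𝒲 Φ)

/-- The range of a coordinate of `(γ, β)`, and `ℝ` for a coordinate of `δ`. -/
def coordRange : Idx dγ dβ dδ → Set ℝ
  | Sum.inl i => {v | M.γlow i ≤ (v : EReal) ∧ (v : EReal) ≤ M.γU}
  | Sum.inr (Sum.inl _) => {v | 0 ≤ v ∧ (v : EReal) ≤ M.βU}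
  | Sum.inr (Sum.inr _) => Set.univ

lemma mem_Θ_iff {θ : Param dγ dβ dδ} :
    θ ∈ M.Θ ↔ (∀ i, θ i ∈ M.coordRange i) ∧ del θ ∈ M.Θδ := by
  constructor
  · rintro ⟨h1, h2, h3⟩
    refine ⟨?_, h3⟩
    rintro (i | i | i)
    · exact h1 i
    · exact h2 i
    · trivial
  · rintro ⟨h1, h3⟩
    exact ⟨fun i => h1 (Sum.inl i), fun i => h1 (Sum.inr (Sum.inl i)), h3⟩

lemma γlow_le_zero (i : Fin dγ) : M.γlow i ≤ 0 := by
  unfold γlow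
  split_ifs
  exacts [M.γL_neg.le, le_rfl]

lemma ordConnected_coordRange (i : Idx dγ dβ dδ) : (M.coordRange i).OrdConnected := by
  rcases i with i | i | i
  · exact ⟨fun x hx y hy z hz => ⟨hx.1.trans (EReal.coe_le_coe_iff.2 hz.1),
      (EReal.coe_le_coe_iff.2 hz.2).trans hy.2⟩⟩
  · exact ⟨fun x hx y hy z hz => ⟨hx.1.trans hz.1, (EReal.coe_le_coe_iff.2 hz.2).trans hy.2⟩⟩
  · exact Set.ordConnected_univ

/-- Guarantees that a nondegenerate rectangle can be placed in the parameter space even at its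
corners. -/
lemma nontrivial_coordRange (i : Idx dγ dβ dδ) : (M.coordRange i).Nontrivial := by
  rcases i with i | i | i
  · obtain ⟨r, h0, h1⟩ := EReal.lt_iff_exists_real_btwn.1 M.γU_pos
    refine ⟨0, ⟨M.γlow_le_zero i, M.γU_pos.le⟩, r, ⟨(M.γlow_le_zero i).trans h0.le, h1.le⟩, ?_⟩
    exact (EReal.coe_pos.1 h0).ne
  · obtain ⟨r, h0, h1⟩ := EReal.lt_iff_exists_real_btwn.1 M.βU_pos
    exact ⟨0, ⟨le_rfl, M.βU_pos.le⟩, r, ⟨(EReal.coe_pos.1 h0).le, h1.le⟩, (EReal.coe_pos.1 h0).ne⟩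
  · exact Set.nontrivial_univ

lemma norm_del_sub_le (θ θ' : Param dγ dβ dδ) : ‖del θ - del θ'‖ ≤ ‖θ - θ'‖ := by
  rw [EuclideanSpace.norm_eq, EuclideanSpace.norm_eq]
  refine Real.sqrt_le_sqrt ?_
  rw [Fintype.sum_sum_type, Fintype.sum_sum_type]
  have h1 : 0 ≤ ∑ i : Fin dγ, ‖(θ - θ') (Sum.inl i)‖ ^ 2 := by positivity
  have h2 : 0 ≤ ∑ i : Fin dβ, ‖(θ - θ') (Sum.inr (Sum.inl i))‖ ^ 2 := by positivity
  simp only [del, PiLp.sub_apply] at h1 h2 ⊢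
  linarith

/-- The ranges of γ and β are intervals, but Θ_δ is an arbitrary compact set, so a box between two
points of Θ may leave Θ in the δ-directions. The ball hypothesis rules this out. -/
lemma coordBox_subset_Θint {θ₀ θ : Param dγ dβ dδ} (h₀ : ∀ i, θ₀ i ∈ M.coordRange i)
    (h : ∀ i, θ i ∈ M.coordRange i)
    (hr : Metric.closedBall (del θ₀) ‖θ - θ₀‖ ⊆ interior M.Θδ) : coordBox θ₀ θ ⊆ M.Θint := by
  intro x hx
  have hδ : del x ∈ interior M.Θδ := by
    apply hr
    rw [Metric.mem_closedBall, dist_eq_norm]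
    exact (norm_del_sub_le _ _).trans (norm_sub_le_of_mem_coordBox hx)
  exact ⟨M.mem_Θ_iff.2 ⟨fun i => (M.ordConnected_coordRange i).uIcc_subset (h₀ i) (h i) (hx i),
    interior_subset hδ⟩, hδ⟩

/-- Symmetry follows from continuity of the second partials on `Θint`, boundary points included, via
small rectangles with a vertex at `θ`. It is what later makes the estimated Ω positive definite. -/
theorem isSymm_lrHess {g : Param dγ dβ dδ → ℝ} (hg : HasContLRPartials2 M.Θ M.Θint g)
    {θ : Param dγ dβ dδ} (hθ : θ ∈ M.Θint) : (lrHess M.Θ g θ).IsSymm := by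
  refine Matrix.IsSymm.ext fun i j => ?_
  by_cases hij : i = j
  · rw [hij]
  refine lrHess_symm_of_forall_box fun c hc => ?_
  have hR := (M.mem_Θ_iff.1 hθ.1).1
  obtain ⟨ε, hε, hcont⟩ : ∃ ε > 0, ∀ x ∈ M.Θint, dist x θ < ε →
      ∀ i j, |lrHess M.Θ g x i j - lrHess M.Θ g θ i j| ≤ c := by
    have : ∀ᶠ x in 𝓝[M.Θint] θ, ∀ i j, |lrHess M.Θ g x i j - lrHess M.Θ g θ i j| ≤ c := by
      refine eventually_all.2 fun i => eventually_all.2 fun j => ?_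
      have := (Metric.tendsto_nhds.1 (hg.2.2 i j θ hθ)) c hc
      filter_upwards [this] with x hx
      exact hx.le
    obtain ⟨ε, hε, h⟩ := Metric.mem_nhdsWithin_iff.1 this
    exact ⟨ε, hε, fun x hx hd => h ⟨hd, hx⟩⟩
  obtain ⟨r, hr, hball⟩ := Metric.isOpen_iff.1 isOpen_interior _ hθ.2
  obtain ⟨v, hv, hvne⟩ := (M.nontrivial_coordRange j).exists_ne (θ j)
  obtain ⟨w, hw, hwne⟩ := (M.nontrivial_coordRange i).exists_ne (θ i)
  set L := |v - θ j| + |w - θ i| with hL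
  have hLpos : 0 < L := by
    have : 0 < |v - θ j| := abs_pos.2 (sub_ne_zero.2 hvne)
    positivity
  -- The bound `u ≤ 1` keeps the vertices in the coordinate ranges by convexity; the other bound
  -- keeps the rectangle within `ε` of `θ`, where the Hessian varies by at most `c`, and within `r`,
  -- where δ is interior.
  set u := min 1 (min ε r / (2 * L)) with hu
  have hu0 : 0 < u := by positivity
  have huL : u * L < min ε r := by
    have : u ≤ min ε r / (2 * L) := min_le_right _ _
    have h2 : 0 < min ε r := by positivity
    calc u * L ≤ min ε r / (2 * L) * L := by gcongr
      _ = min ε r / 2 := by field_simp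
      _ < _ := by linarith
  have hmem : ∀ (k : Idx dγ dβ dδ) (z : ℝ), z ∈ M.coordRange k →
      θ k + u * (z - θ k) ∈ M.coordRange k := by
    intro k z hz
    have hconv : Convex ℝ (M.coordRange k) := (M.ordConnected_coordRange k).convex
    have := hconv (hR k) hz (sub_nonneg.2 (min_le_left 1 _)) hu0.le (by ring)
    convert this using 1
    simp only [smul_eq_mul]
    ring
  refine ⟨u * (v - θ j), u * (w - θ i), mul_ne_zero hu0.ne' (sub_ne_zero.2 hvne),
    mul_ne_zero hu0.ne' (sub_ne_zero.2 hwne), fun x hx => ?_⟩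
  set p := θ + (u * (v - θ j)) • EuclideanSpace.single j (1 : ℝ) +
    (u * (w - θ i)) • EuclideanSpace.single i (1 : ℝ) with hp
  have hpn : ‖p - θ‖ < min ε r := by
    have : p - θ = (u * (v - θ j)) • EuclideanSpace.single j (1 : ℝ) +
      (u * (w - θ i)) • EuclideanSpace.single i (1 : ℝ) := by rw [hp]; abel
    rw [this]
    refine (norm_add_le _ _).trans_lt ?_
    rw [norm_smul, norm_smul]
    simp only [PiLp.norm_single, norm_one, mul_one, norm_mul, Real.norm_eq_abs,
      abs_of_pos hu0]
    rw [← mul_add]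
    exact huL
  have hpR : ∀ k, p k ∈ M.coordRange k := by
    intro k
    rw [hp, add_smul_single_apply, add_smul_single_apply]
    by_cases h1 : k = i
    · subst h1; simpa [hij] using hmem k w hw
    · by_cases h2 : k = j
      · subst h2; simpa [h1] using hmem k v hv
      · simpa [h1, h2] using hR k
  have hxint := M.coordBox_subset_Θint hR hpR (by
    refine (Metric.closedBall_subset_ball (hpn.trans_le (min_le_right _ _))).trans hball) hx
  refine ⟨hxint.1, hg.1 x hxint, hg.2.1 x hxint, hcont x hxint ?_⟩
  rw [dist_eq_norm]
  exact (norm_sub_le_of_mem_coordBox hx).trans_lt (hpn.trans_le (min_le_left _ _))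

end Model

/-! ### Quadratic forms -/

section QuadForm

set_option linter.unusedSectionVars false

variable {ι : Type*} [Fintype ι]

/-- The quadratic form `v ↦ v' S v`. -/
def qf (S : Matrix ι ι ℝ) (v : ι → ℝ) : ℝ := v ⬝ᵥ (S *ᵥ v)

lemma qf_neg (S : Matrix ι ι ℝ) (v : ι → ℝ) : qf S (-v) = qf S v := by
  simp [qf, Matrix.mulVec_neg]

lemma qf_smul (S : Matrix ι ι ℝ) (t : ℝ) (v : ι → ℝ) : qf S (t • v) = t ^ 2 * qf S v := by
  simp only [qf, Matrix.mulVec_smul, smul_dotProduct, dotProduct_smul, smul_eq_mul]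
  ring

lemma dotProduct_mulVec_comm {S : Matrix ι ι ℝ} (hS : S.IsSymm) (v w : ι → ℝ) :
    v ⬝ᵥ (S *ᵥ w) = w ⬝ᵥ (S *ᵥ v) := by
  rw [Matrix.dotProduct_mulVec, ← Matrix.mulVec_transpose, hS.eq, dotProduct_comm]

lemma qf_add {S : Matrix ι ι ℝ} (hS : S.IsSymm) (v w : ι → ℝ) :
    qf S (v + w) = qf S v + 2 * (w ⬝ᵥ (S *ᵥ v)) + qf S w := by
  simp only [qf, Matrix.mulVec_add, add_dotProduct, dotProduct_add]
  rw [dotProduct_mulVec_comm hS v w]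
  ring

lemma continuous_qf : Continuous fun p : Matrix ι ι ℝ × (ι → ℝ) => qf p.1 p.2 := by
  unfold qf
  fun_prop

lemma tendsto_qf {α : Type*} {f : Filter α} {S' : α → Matrix ι ι ℝ} {v' : α → ι → ℝ}
    {S : Matrix ι ι ℝ} {v : ι → ℝ} (hS : Tendsto S' f (𝓝 S)) (hv : Tendsto v' f (𝓝 v)) :
    Tendsto (fun a => qf (S' a) (v' a)) f (𝓝 (qf S v)) := by
  have h : Tendsto (fun a => (S' a, v' a)) f (𝓝 (S, v)) := hS.prodMk_nhds hv
  exact (continuous_qf.tendsto (S, v)).comp h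

lemma _root_.Matrix.PosDef.isSymm {S : Matrix ι ι ℝ} (hS : S.PosDef) : S.IsSymm := by
  have := hS.isHermitian.eq
  rwa [Matrix.conjTranspose_eq_transpose_of_trivial] at this

lemma qf_pos {S : Matrix ι ι ℝ} (hS : S.PosDef) {v : ι → ℝ} (hv : v ≠ 0) : 0 < qf S v := by
  simpa [qf] using hS.dotProduct_mulVec_pos hv

lemma qf_nonneg {S : Matrix ι ι ℝ} (hS : S.PosDef) (v : ι → ℝ) : 0 ≤ qf S v := by
  simpa [qf] using hS.posSemidef.dotProduct_mulVec_nonneg v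

lemma posDef_of_qf_pos {S : Matrix ι ι ℝ} (hS : S.IsSymm) (h : ∀ v : ι → ℝ, v ≠ 0 → 0 < qf S v) :
    S.PosDef := by
  refine Matrix.PosDef.of_dotProduct_mulVec_pos ?_ fun {v} hv => by simpa [qf] using h v hv
  rw [Matrix.IsHermitian, Matrix.conjTranspose_eq_transpose_of_trivial, hS.eq]

lemma exists_coercive {S : Matrix ι ι ℝ} (hS : S.PosDef) :
    ∃ m > 0, ∀ v : ι → ℝ, m * ‖v‖ ^ 2 ≤ qf S v := by
  rcases isEmpty_or_nonempty ι with hι | hι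
  · exact ⟨1, one_pos, fun v => by simp [Subsingleton.elim v 0, qf]⟩
  have hc : IsCompact (Metric.sphere (0 : ι → ℝ) 1) := isCompact_sphere _ _
  have hne : (Metric.sphere (0 : ι → ℝ) 1).Nonempty := NormedSpace.sphere_nonempty.2 zero_le_one
  obtain ⟨v₀, hv₀, hmin⟩ := hc.exists_isMinOn hne
    (f := qf S) (continuous_qf.comp (Continuous.prodMk_right S)).continuousOn
  have hv₀' : v₀ ≠ 0 := by
    rintro rfl; simp at hv₀
  refine ⟨qf S v₀, qf_pos hS hv₀', fun v => ?_⟩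
  by_cases hv : v = 0
  · simp [hv, qf]
  have hn : 0 < ‖v‖ := norm_pos_iff.2 hv
  have h1 : qf S v₀ ≤ qf S (‖v‖⁻¹ • v) := hmin (by simp [norm_smul, hn.ne'])
  rw [qf_smul] at h1
  calc qf S v₀ * ‖v‖ ^ 2 ≤ (‖v‖⁻¹ ^ 2 * qf S v) * ‖v‖ ^ 2 := by gcongr
    _ = qf S v := by field_simp

lemma abs_qf_le (S : Matrix ι ι ℝ) (v : ι → ℝ) :
    |qf S v| ≤ (∑ i, ∑ j, |S i j|) * ‖v‖ ^ 2 := by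
  have e : qf S v = ∑ i, ∑ j, v i * (S i j * v j) := by
    simp [qf, dotProduct, Matrix.mulVec, Finset.mul_sum]
  rw [e, Finset.sum_mul]
  refine (Finset.abs_sum_le_sum_abs _ _).trans (Finset.sum_le_sum fun i _ => ?_)
  rw [Finset.sum_mul]
  refine (Finset.abs_sum_le_sum_abs _ _).trans (Finset.sum_le_sum fun j _ => ?_)
  rw [abs_mul, abs_mul]
  have h1 : |v i| ≤ ‖v‖ := norm_le_pi_norm v i
  have h2 : |v j| ≤ ‖v‖ := norm_le_pi_norm v j
  calc |v i| * (|S i j| * |v j|) ≤ ‖v‖ * (|S i j| * ‖v‖) := by gcongr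
    _ = _ := by ring

lemma qf_sub_matrix (S S' : Matrix ι ι ℝ) (v : ι → ℝ) : qf (S' - S) v = qf S' v - qf S v := by
  simp [qf, Matrix.sub_mulVec, dotProduct_sub]

/-- Coercivity is uniform near a positive definite matrix. -/
lemma eventually_coercive {S : Matrix ι ι ℝ} (hS : S.PosDef) :
    ∃ m > 0, ∀ᶠ S' in 𝓝 S, ∀ v : ι → ℝ, m * ‖v‖ ^ 2 ≤ qf S' v := by
  obtain ⟨m, hm, h⟩ := exists_coercive hS
  refine ⟨m / 2, by positivity, ?_⟩
  have hcont : Continuous fun S' : Matrix ι ι ℝ => ∑ i, ∑ j, |(S' - S) i j| := by fun_prop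
  have h0 : ∑ i, ∑ j, |(S - S) i j| < m / 2 := by simpa using hm
  filter_upwards [hcont.continuousAt.eventually_lt_const h0] with S' hS' v
  have h1 := abs_qf_le (S' - S) v
  rw [qf_sub_matrix] at h1
  have h2 := (abs_le.1 h1).1
  have h3 : (∑ i, ∑ j, |(S' - S) i j|) * ‖v‖ ^ 2 ≤ m / 2 * ‖v‖ ^ 2 := by gcongr
  linarith [h v]

/-- Coercivity is an open condition, but `PosDef` also asks for symmetry, which nearby matrices may
lack; hence the premise. -/
lemma eventually_posDef {S : Matrix ι ι ℝ} (hS : S.PosDef) :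
    ∀ᶠ S' in 𝓝 S, S'.IsSymm → S'.PosDef := by
  obtain ⟨m, hm, h⟩ := eventually_coercive hS
  filter_upwards [h] with S' h' hsymm
  refine posDef_of_qf_pos hsymm fun v hv => ?_
  have : 0 < ‖v‖ := norm_pos_iff.2 hv
  exact (by positivity : 0 < m * ‖v‖ ^ 2).trans_le (h' v)

lemma tendsto_matrix_inv [DecidableEq ι] {S : Matrix ι ι ℝ} (hS : S.PosDef) :
    Tendsto (fun A : Matrix ι ι ℝ => A⁻¹) (𝓝 S) (𝓝 S⁻¹) := by
  refine (continuousAt_matrix_inv S ?_).tendsto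
  have hdet : S.det ≠ 0 := ((Matrix.isUnit_iff_isUnit_det S).1 hS.isUnit).ne_zero
  have : (Ring.inverse : ℝ → ℝ) = fun x => x⁻¹ := Ring.inverse_eq_inv'
  rw [this]
  exact continuousAt_inv₀ hdet

end QuadForm

/-! ### Infima of quadratic forms over `K × Λ_β(x)` -/

section Inf

variable {dγ dβ dδ : ℕ}

/-- The set `K × Λ_β(x)`. -/
def coneSet (K : Set (Fin dγ → ℝ)) (x : Fin dβ → ℝ≥0∞) : Set (Fin dγ ⊕ Fin dβ → ℝ) :=
  {l | (fun i => l (Sum.inl i)) ∈ K ∧ (fun i => l (Sum.inr i)) ∈ Λβ x}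

/-- `inf (l - u)' S (l - u)` over `l ∈ K × Λ_β(x)`. -/
noncomputable def infQ (S : Matrix (Fin dγ ⊕ Fin dβ) (Fin dγ ⊕ Fin dβ) ℝ) (K : Set (Fin dγ → ℝ))
    (x : Fin dβ → ℝ≥0∞) (u : Fin dγ ⊕ Fin dβ → ℝ) : ℝ :=
  sInf ((fun l => qf S (l - u)) '' coneSet K x)

variable {S : Matrix (Fin dγ ⊕ Fin dβ) (Fin dγ ⊕ Fin dβ) ℝ} {K K' : Set (Fin dγ → ℝ)}
  {x y : Fin dβ → ℝ≥0∞} {u : Fin dγ ⊕ Fin dβ → ℝ}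

lemma neg_coe_le_coe_iff {b : ℝ≥0∞} {l : ℝ} :
    -((b : ℝ≥0∞) : EReal) ≤ (l : EReal) ↔ b = ⊤ ∨ -b.toReal ≤ l := by
  induction b using ENNReal.recTopCoe with
  | top => simp
  | coe b =>
    simp only [ENNReal.coe_ne_top, false_or, ENNReal.coe_toReal]
    have e : (((b : ℝ≥0∞)) : EReal) = ((b : ℝ) : EReal) := rfl
    rw [e, ← EReal.coe_neg, EReal.coe_le_coe_iff]

lemma zero_mem_coneSet (hK : 0 ∈ K) : 0 ∈ coneSet K x := by
  refine ⟨hK, fun i => ?_⟩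
  rw [neg_coe_le_coe_iff]
  right
  simp

lemma coneSet_mono (hK : K ⊆ K') (hxy : x ≤ y) : coneSet K x ⊆ coneSet K' y := by
  rintro l ⟨h1, h2⟩
  refine ⟨hK h1, fun i => le_trans ?_ (h2 i)⟩
  rw [EReal.neg_le_neg_iff]
  exact_mod_cast hxy i

lemma bddBelow_image_qf (hS : ∀ v, 0 ≤ qf S v) (C : Set (Fin dγ ⊕ Fin dβ → ℝ)) :
    BddBelow ((fun l => qf S (l - u)) '' C) := by
  refine ⟨0, ?_⟩
  rintro _ ⟨l, _, rfl⟩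
  exact hS _

lemma infQ_le (hS : ∀ v, 0 ≤ qf S v) {l : Fin dγ ⊕ Fin dβ → ℝ} (hl : l ∈ coneSet K x) :
    infQ S K x u ≤ qf S (l - u) :=
  csInf_le (bddBelow_image_qf hS _) ⟨l, hl, rfl⟩

lemma exists_lt_of_infQ_lt (hK : 0 ∈ K) {c : ℝ} (h : infQ S K x u < c) :
    ∃ l ∈ coneSet K x, qf S (l - u) < c := by
  obtain ⟨_, ⟨l, hl, rfl⟩, h⟩ := exists_lt_of_csInf_lt
    (Set.Nonempty.image _ ⟨0, zero_mem_coneSet hK⟩) h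
  exact ⟨l, hl, h⟩

lemma le_infQ (hK : 0 ∈ K) {c : ℝ} (h : ∀ l ∈ coneSet K x, c ≤ qf S (l - u)) :
    c ≤ infQ S K x u := by
  refine le_csInf ⟨_, 0, zero_mem_coneSet hK, rfl⟩ ?_
  rintro _ ⟨l, hl, rfl⟩
  exact h l hl

lemma infQ_anti (hS : ∀ v, 0 ≤ qf S v) (h0 : 0 ∈ K) (hK : K ⊆ K') (hxy : x ≤ y) :
    infQ S K' y u ≤ infQ S K x u :=
  le_infQ h0 fun _ hl => infQ_le hS (coneSet_mono hK hxy hl)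

lemma isClosed_setOf_neg_le : IsClosed {p : ℝ≥0∞ × ℝ | -((p.1 : ℝ≥0∞) : EReal) ≤ (p.2 : EReal)} :=
  isClosed_le (continuous_neg.comp (continuous_coe_ennreal_ereal.comp continuous_fst))
    (continuous_coe_real_ereal.comp continuous_snd)

lemma isClosed_setOf_mem_coneSet (hK : IsClosed K) :
    IsClosed {p : (Fin dβ → ℝ≥0∞) × (Fin dγ ⊕ Fin dβ → ℝ) | p.2 ∈ coneSet K p.1} := by
  have e : {p : (Fin dβ → ℝ≥0∞) × (Fin dγ ⊕ Fin dβ → ℝ) | p.2 ∈ coneSet K p.1} =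
      {p | (fun i => p.2 (Sum.inl i)) ∈ K} ∩
        ⋂ i : Fin dβ, {p | -((p.1 i : ℝ≥0∞) : EReal) ≤ (p.2 (Sum.inr i) : EReal)} := by
    ext p
    simp [coneSet, Λβ]
  rw [e]
  refine (hK.preimage (by fun_prop)).inter (isClosed_iInter fun i => ?_)
  exact isClosed_setOf_neg_le.preimage
    (f := fun p : (Fin dβ → ℝ≥0∞) × (Fin dγ ⊕ Fin dβ → ℝ) => (p.1 i, p.2 (Sum.inr i))) (by fun_prop)

lemma exists_isMinOn_coneSet (hS : S.PosDef) (hK : IsClosed K) (h0 : 0 ∈ K) :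
    ∃ p ∈ coneSet K x, ∀ l ∈ coneSet K x, qf S (p - u) ≤ qf S (l - u) := by
  obtain ⟨m, hm, hcoer⟩ := exists_coercive hS
  have hcl : IsClosed (coneSet K x) :=
    (isClosed_setOf_mem_coneSet hK).preimage (Continuous.prodMk_right x)
  have hcont : Continuous fun l => qf S (l - u) :=
    continuous_qf.comp (by fun_prop : Continuous fun l : Fin dγ ⊕ Fin dβ → ℝ => (S, l - u))
  have htend : Tendsto (fun l : Fin dγ ⊕ Fin dβ → ℝ => qf S (l - u)) (cocompact _) atTop := by
    refine tendsto_atTop_mono (fun l => hcoer (l - u)) ?_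
    refine Tendsto.const_mul_atTop hm ((tendsto_pow_atTop two_ne_zero).comp ?_)
    exact tendsto_norm_cocompact_atTop.comp
      ((Homeomorph.subRight u).isClosedEmbedding.tendsto_cocompact)
  obtain ⟨p, hp, hmin⟩ := hcont.continuousOn.exists_isMinOn' hcl (zero_mem_coneSet h0)
    ((htend.eventually_ge_atTop _).filter_mono inf_le_left)
  exact ⟨p, hp, fun l hl => hmin hl⟩

/-- A point of `K × Λ_β(x)` extends to a continuous selection of the sets `K × Λ_β(b)`. -/
lemma exists_continuous_mem_coneSet {l : Fin dγ ⊕ Fin dβ → ℝ} (hl : l ∈ coneSet K x) :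
    ∃ l' : (Fin dβ → ℝ≥0∞) → Fin dγ ⊕ Fin dβ → ℝ,
      (∀ b, l' b ∈ coneSet K b) ∧ l' x = l ∧ Continuous l' := by
  -- Each coordinate of `l` is pushed up to `-b i` if it violates the constraint. Truncating `b i`
  -- at `|l i|` leaves `l` unchanged at `b = x` and keeps `toReal` continuous where `b i = ∞`.
  let l' : (Fin dβ → ℝ≥0∞) → Fin dγ ⊕ Fin dβ → ℝ := fun b => Sum.elim (fun i => l (Sum.inl i))
    fun i => max (l (Sum.inr i)) (-(min (b i) (ENNReal.ofReal |l (Sum.inr i)|)).toReal)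
  have hl'mem : ∀ b, l' b ∈ coneSet K b := by
    refine fun b => ⟨hl.1, fun i => ?_⟩
    rw [neg_coe_le_coe_iff]
    by_cases hb : b i = ⊤
    · exact Or.inl hb
    · right
      refine le_trans ?_ (le_max_right _ _)
      rw [neg_le_neg_iff]
      exact ENNReal.toReal_mono hb (min_le_left _ _)
  have hl'x : l' x = l := by
    funext i
    rcases i with i | i
    · rfl
    · refine max_eq_left ?_
      rcases neg_coe_le_coe_iff.1 (hl.2 i) with h | h
      · rw [h, min_eq_right le_top, ENNReal.toReal_ofReal (abs_nonneg _)]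
        exact neg_abs_le _
      · by_cases h' : x i ≤ ENNReal.ofReal |l (Sum.inr i)|
        · rwa [min_eq_left h']
        · rw [min_eq_right (not_le.1 h').le, ENNReal.toReal_ofReal (abs_nonneg _)]
          exact neg_abs_le _
  have hl'cont : Continuous l' := by
    refine continuous_pi fun i => ?_
    rcases i with i | i
    · exact continuous_const
    · refine continuous_const.max (Continuous.neg ?_)
      refine ENNReal.continuousOn_toReal.comp_continuous
        ((continuous_apply i).min continuous_const) fun b => ?_
      exact (min_lt_of_right_lt ENNReal.ofReal_lt_top).ne
  exact ⟨l', hl'mem, hl'x, hl'cont⟩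

/-- The infimum depends continuously on the matrix, the half-lines and the centre. -/
theorem tendsto_infQ {α : Type*} {f : Filter α}
    {S' : α → Matrix (Fin dγ ⊕ Fin dβ) (Fin dγ ⊕ Fin dβ) ℝ} {x' : α → Fin dβ → ℝ≥0∞}
    {u' : α → Fin dγ ⊕ Fin dβ → ℝ} (hS : S.PosDef) (hK : IsClosed K) (h0 : 0 ∈ K)
    (hS' : Tendsto S' f (𝓝 S)) (hx' : Tendsto x' f (𝓝 x)) (hu' : Tendsto u' f (𝓝 u)) :
    Tendsto (fun a => infQ (S' a) K (x' a) (u' a)) f (𝓝 (infQ S K x u)) := by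
  obtain ⟨m, hm, hcoer⟩ := eventually_coercive hS
  have hpos : ∀ᶠ a in f, ∀ v, m * ‖v‖ ^ 2 ≤ qf (S' a) v := hS'.eventually hcoer
  refine tendsto_order.2 ⟨fun c hc => ?_, fun c hc => ?_⟩
  -- Lower bound: near-minimizers are bounded by uniform coercivity, so along an ultrafilter they
  -- converge. The graph of the constraint sets is closed, so the limit is admissible and has too
  -- small a value.
  · obtain ⟨c', hcc', hc'⟩ := exists_between hc
    refine mem_iff_ultrafilter.2 fun g hg => ?_
    by_contra hcon
    have hcon' := Ultrafilter.compl_mem_iff_notMem.2 hcon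
    have hex : ∀ a, ∃ l, infQ (S' a) K (x' a) (u' a) ≤ c →
        l ∈ coneSet K (x' a) ∧ qf (S' a) (l - u' a) < c' := by
      intro a
      by_cases ha : infQ (S' a) K (x' a) (u' a) ≤ c
      · obtain ⟨l, hl, h⟩ := exists_lt_of_infQ_lt h0 (ha.trans_lt hcc')
        exact ⟨l, fun _ => ⟨hl, h⟩⟩
      · exact ⟨0, fun h => absurd h ha⟩
    choose l hl using hex
    have hev : ∀ᶠ a in (g : Filter α), l a ∈ coneSet K (x' a) ∧ qf (S' a) (l a - u' a) < c' := by
      filter_upwards [hcon'] with a ha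
      exact hl a (not_lt.1 ha)
    have hub : ∀ᶠ a in (g : Filter α), ‖u' a‖ < ‖u‖ + 1 :=
      ((hu'.mono_left hg).norm).eventually_lt_const (by linarith)
    have hbd : ∀ᶠ a in (g : Filter α), l a ∈ Metric.closedBall (0 : Fin dγ ⊕ Fin dβ → ℝ)
        (√(c' / m) + (‖u‖ + 1)) := by
      filter_upwards [hev, hub, hpos.filter_mono hg] with a h1 h2 h3
      have h4 : ‖l a - u' a‖ ≤ √(c' / m) := by
        refine Real.le_sqrt_of_sq_le ?_
        rw [le_div_iff₀ hm]
        linarith [h3 (l a - u' a), h1.2]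
      rw [mem_closedBall_zero_iff]
      calc ‖l a‖ = ‖(l a - u' a) + u' a‖ := by rw [sub_add_cancel]
        _ ≤ _ := (norm_add_le _ _).trans (add_le_add h4 h2.le)
    obtain ⟨p, _, hp⟩ := (isCompact_closedBall (0 : Fin dγ ⊕ Fin dβ → ℝ)
      (√(c' / m) + (‖u‖ + 1))).ultrafilter_le_nhds (g.map l) (le_principal_iff.2 hbd)
    have hlp : Tendsto l g (𝓝 p) := hp
    have hmem : p ∈ coneSet K x :=
      (isClosed_setOf_mem_coneSet hK).mem_of_tendsto ((hx'.mono_left hg).prodMk_nhds hlp)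
        (hev.mono fun a ha => ha.1)
    have hle : qf S (p - u) ≤ c' := by
      refine le_of_tendsto (tendsto_qf (hS'.mono_left hg) (hlp.sub (hu'.mono_left hg))) ?_
      exact hev.mono fun a ha => ha.2.le
    exact absurd (infQ_le (u := u) (fun v => qf_nonneg hS v) hmem) (not_le.2 (hle.trans_lt hc'))
  -- Upper bound: a near-minimizer of the limit problem is carried to the nearby problems by a
  -- continuous selection.
  · obtain ⟨l, hl, hlc⟩ := exists_lt_of_infQ_lt h0 hc
    obtain ⟨l', hl'mem, hl'x, hl'cont⟩ := exists_continuous_mem_coneSet hl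
    have hlim : Tendsto (fun a => qf (S' a) (l' (x' a) - u' a)) f (𝓝 (qf S (l - u))) := by
      have h1 : Tendsto (fun a => l' (x' a)) f (𝓝 l) := by
        have := (hl'cont.tendsto x).comp hx'
        rwa [hl'x] at this
      exact tendsto_qf hS' (h1.sub hu')
    filter_upwards [hlim.eventually_lt_const hlc, hpos] with a h1 h2
    exact (infQ_le (fun v => (by positivity : 0 ≤ m * ‖v‖ ^ 2).trans (h2 v)) (hl'mem _)).trans_lt h1

end Inf

variable {dγ dβ dδ : ℕ}

/-! ### Growth of the difference of infima along rays -/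

section Ray

variable {S : Matrix (Fin dγ ⊕ Fin dβ) (Fin dγ ⊕ Fin dβ) ℝ} {K : Set (Fin dγ → ℝ)}
  {x y : Fin dβ → ℝ≥0∞} {u : Fin dγ ⊕ Fin dβ → ℝ}

/-- The origin of `ℝ^dγ`, as the set of vectors with vanishing coordinates. -/
def zeroCone (dγ : ℕ) : Set (Fin dγ → ℝ) := {g | ∀ i, g i = 0}

lemma zero_mem_zeroCone : (0 : Fin dγ → ℝ) ∈ zeroCone dγ := fun _ => rfl

lemma isClosed_zeroCone : IsClosed (zeroCone dγ) := by
  have : zeroCone dγ = {0} := by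
    ext g; simp [zeroCone, funext_iff]
  rw [this]
  exact isClosed_singleton

lemma zeroCone_subset (h0 : 0 ∈ K) : zeroCone dγ ⊆ K := by
  intro g hg
  have : g = 0 := funext hg
  rwa [this]

/-- The apex of the cone `{0} × Λ_β(x)`. -/
def apex (x : Fin dβ → ℝ≥0∞) : Fin dγ ⊕ Fin dβ → ℝ :=
  Sum.elim (fun _ => 0) fun i => -(x i).toReal

/-- The set is a cone with vertex `apex x`. Coordinates with `x i = ∞` are unconstrained, so the
value `toReal ⊤ = 0` is harmless there. -/
lemma apex_add_smul_mem {l : Fin dγ ⊕ Fin dβ → ℝ} (hl : l ∈ coneSet (zeroCone dγ) x) {t : ℝ}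
    (ht : 0 ≤ t) : apex x + t • (l - apex x) ∈ coneSet (zeroCone dγ) x := by
  refine ⟨fun i => ?_, fun i => ?_⟩
  · have := hl.1 i
    simp only [] at this
    simp [apex, this]
  · rw [neg_coe_le_coe_iff]
    rcases neg_coe_le_coe_iff.1 (hl.2 i) with h | h
    · exact Or.inl h
    · right
      have : 0 ≤ t * (l (Sum.inr i) + (x i).toReal) := mul_nonneg ht (by linarith)
      simp only [apex, Pi.add_apply, Pi.smul_apply, Pi.sub_apply, Sum.elim_inr, smul_eq_mul]
      linarith

/-- The direction `p - apex x` has no γ-part and is nonnegative where `x i` is finite; where `x i =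
∞`, also `y i = ∞`. Hence it is a recession direction of the larger set. -/
lemma add_smul_sub_apex_mem {c p : Fin dγ ⊕ Fin dβ → ℝ} (hc : c ∈ coneSet K y)
    (hp : p ∈ coneSet (zeroCone dγ) x) (hxy : x ≤ y) {s : ℝ} (hs : 0 ≤ s) :
    c + s • (p - apex x) ∈ coneSet K y := by
  refine ⟨?_, fun i => ?_⟩
  · convert hc.1 using 2 with i
    have := hp.1 i
    simp only [] at this
    simp [apex, this]
  · rw [neg_coe_le_coe_iff]
    rcases neg_coe_le_coe_iff.1 (hc.2 i) with h | h
    · exact Or.inl h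
    · by_cases hy : y i = ⊤
      · exact Or.inl hy
      right
      rcases neg_coe_le_coe_iff.1 (hp.2 i) with h' | h'
      · exact absurd (top_le_iff.1 (h' ▸ hxy i)) hy
      have : 0 ≤ s * (p (Sum.inr i) + (x i).toReal) := mul_nonneg hs (by linarith)
      simp only [apex, Pi.add_apply, Pi.smul_apply, Pi.sub_apply, Sum.elim_inr, smul_eq_mul]
      linarith

/-- Let `A` and `B` be the infima at `u` over the smaller and the larger set. Dilation about the
vertex by `t` raises `A` to at least `t² A`. For near-minimizers `p`, `c` of the two problems, the
test point `c + (t - 1)(p - apex x)` has residual `(c - u) + (t - 1)(p - u)`. Since twice the cross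
term is at most the sum of the two squares, the new second infimum is at most `t B + t (t - 1) A`.
The difference is `t (A - B)`. -/
theorem mul_infQ_sub_le (hS : S.PosDef) (h0 : 0 ∈ K) (hxy : x ≤ y) {t : ℝ} (ht : 1 ≤ t) :
    t * (infQ S (zeroCone dγ) x u - infQ S K y u) ≤
      infQ S (zeroCone dγ) x (apex x + t • (u - apex x)) -
        infQ S K y (apex x + t • (u - apex x)) := by
  set a : Fin dγ ⊕ Fin dβ → ℝ := apex x with ha
  have ht0 : 0 < t := by linarith
  have hq := fun v => qf_nonneg hS v
  have h1 : t ^ 2 * infQ S (zeroCone dγ) x u ≤ infQ S (zeroCone dγ) x (a + t • (u - a)) := by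
    refine le_infQ zero_mem_zeroCone fun l hl => ?_
    have hl' := apex_add_smul_mem hl (inv_nonneg.2 ht0.le)
    have e : l - (a + t • (u - a)) = t • ((a + t⁻¹ • (l - a)) - u) := by
      funext i
      simp only [Pi.sub_apply, Pi.add_apply, Pi.smul_apply, smul_eq_mul]
      field_simp
      ring
    rw [e, qf_smul]
    exact mul_le_mul_of_nonneg_left (infQ_le hq hl') (by positivity)
  refine le_of_forall_pos_le_add fun ε hε => ?_
  -- The near-minimizers `p` and `c` together cost `t η + t (t - 1) η = t² η = ε`.
  set η := ε / t ^ 2 with hη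
  have hηpos : 0 < η := by positivity
  obtain ⟨p, hp, hpq⟩ := exists_lt_of_infQ_lt zero_mem_zeroCone
    (lt_add_of_pos_right (infQ S (zeroCone dγ) x u) hηpos)
  obtain ⟨c, hc, hcq⟩ := exists_lt_of_infQ_lt h0 (lt_add_of_pos_right (infQ S K y u) hηpos)
  have hs : 0 ≤ t - 1 := by linarith
  have h2 := infQ_le (u := a + t • (u - a)) hq (add_smul_sub_apex_mem hc hp hxy hs)
  have e : c + (t - 1) • (p - apex x) - (a + t • (u - a)) = (c - u) + (t - 1) • (p - u) := by
    funext i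
    simp only [Pi.sub_apply, Pi.add_apply, Pi.smul_apply, smul_eq_mul, ← ha]
    ring
  rw [e, qf_add hS.isSymm, qf_smul, smul_dotProduct, smul_eq_mul] at h2
  have h3 := hq ((c - u) + -(p - u))
  rw [qf_add hS.isSymm, qf_neg, neg_dotProduct] at h3
  set B := (p - u) ⬝ᵥ (S *ᵥ (c - u))
  set qp := qf S (p - u)
  set qc := qf S (c - u)
  have h4 : (t - 1) * (2 * B) ≤ (t - 1) * (qc + qp) := mul_le_mul_of_nonneg_left (by linarith) hs
  have h5 : t * qc ≤ t * (infQ S K y u + η) := mul_le_mul_of_nonneg_left hcq.le ht0.le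
  have h6 : ((t - 1) * t) * qp ≤ ((t - 1) * t) * (infQ S (zeroCone dγ) x u + η) :=
    mul_le_mul_of_nonneg_left hpq.le (by positivity)
  have h7 : t ^ 2 * η = ε := by rw [hη]; field_simp
  nlinarith

/-- If enlarging `{0} × Λ_β(x)` to `K × Λ_β(y)` does not lower the infimum, the `γ`-part of the
centre satisfies a linear restriction. -/
theorem exists_linear_restriction (hS : S.PosDef) (i₀ : Fin dγ) :
    ∃ v : Fin dγ → ℝ, v ≠ 0 ∧ ∀ (K : Set (Fin dγ → ℝ)) (x y : Fin dβ → ℝ≥0∞)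
      (u : Fin dγ ⊕ Fin dβ → ℝ), 0 ∈ K → x ≤ y → (∀ i, y i = ⊤ ∨ x i < y i) →
      infQ S (zeroCone dγ) x u ≤ infQ S K y u →
      ((∀ r : ℝ, 0 ≤ r → r • Pi.single i₀ (1 : ℝ) ∈ K) → v ⬝ᵥ (fun i => u (Sum.inl i)) ≤ 0) ∧
      ((∀ r : ℝ, 0 ≤ r → r • -Pi.single i₀ (1 : ℝ) ∈ K) →
        0 ≤ v ⬝ᵥ (fun i => u (Sum.inl i))) := by
  set T := S⁻¹ with hT
  have hTpd : T.PosDef := hS.inv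
  set T' := T.submatrix (Sum.inl : Fin dγ → Fin dγ ⊕ Fin dβ) Sum.inl with hT'
  have hT'pd : T'.PosDef := hTpd.submatrix Sum.inl_injective
  have hdetT' : IsUnit T'.det := (Matrix.isUnit_iff_isUnit_det _).1 hT'pd.isUnit
  have hdetS : IsUnit S.det := (Matrix.isUnit_iff_isUnit_det _).1 hS.isUnit
  -- With `T'` the γ-block of `S⁻¹`, this `v` reads off the `i₀`-th multiplier from the γ-part of
  -- the centre. It depends on `S` and `i₀` only, not on `u`.
  set v : Fin dγ → ℝ := T'⁻¹ *ᵥ Pi.single i₀ 1 with hv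
  have hTv : T' *ᵥ v = Pi.single i₀ 1 := by
    rw [hv, Matrix.mulVec_mulVec, Matrix.mul_nonsing_inv _ hdetT', Matrix.one_mulVec]
  refine ⟨v, ?_, fun K x y u h0 hxy hlt hle => ?_⟩
  · intro h
    rw [h, Matrix.mulVec_zero] at hTv
    have := congrFun hTv i₀
    simp at this
  have hq := fun v => qf_nonneg hS v
  obtain ⟨p, hp, hmin⟩ := exists_isMinOn_coneSet (x := x) (u := u) hS isClosed_zeroCone
    zero_mem_zeroCone
  have hp0 : ∀ i, p (Sum.inl i) = 0 := hp.1
  have hpmin : ∀ l ∈ coneSet K y, qf S (p - u) ≤ qf S (l - u) := fun l hl =>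
    (le_infQ zero_mem_zeroCone hmin).trans (hle.trans (infQ_le hq hl))
  -- The minimizer `p` over the smaller set also minimizes over the larger one. Minus half the
  -- gradient there is `w`, so `d ⬝ᵥ w ≤ 0` for every feasible direction `d`.
  set w := S *ᵥ (u - p) with hw
  have hvar : ∀ d : Fin dγ ⊕ Fin dβ → ℝ, (∃ ρ > 0, ∀ r : ℝ, 0 ≤ r → r ≤ ρ →
      p + r • d ∈ coneSet K y) → d ⬝ᵥ w ≤ 0 := by
    rintro d ⟨ρ, hρ, hd⟩
    by_contra hcon
    push Not at hcon
    have hr : ∀ r : ℝ, 0 < r → r ≤ ρ → 2 * (d ⬝ᵥ w) ≤ r * qf S d := by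
      intro r hr hrρ
      have h1 := hpmin _ (hd r hr.le hrρ)
      have e : p + r • d - u = -(u - p) + r • d := by
        funext i; simp only [Pi.sub_apply, Pi.add_apply, Pi.neg_apply]; ring
      have e2 : p - u = -(u - p) := (neg_sub _ _).symm
      rw [e, e2, qf_add hS.isSymm, qf_smul, Matrix.mulVec_neg, dotProduct_neg, ← hw,
        smul_dotProduct, smul_eq_mul] at h1
      have h2 : r * (2 * (d ⬝ᵥ w)) ≤ r * (r * qf S d) := by linarith
      exact le_of_mul_le_mul_left h2 hr
    have hlim : Tendsto (fun r : ℝ => r * qf S d) (𝓝[>] 0) (𝓝 (0 * qf S d)) :=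
      (tendsto_id.mul_const _).mono_left nhdsWithin_le_nhds
    have := ge_of_tendsto hlim (b := 2 * (d ⬝ᵥ w)) (by
      filter_upwards [self_mem_nhdsWithin, nhdsWithin_le_nhds (Iic_mem_nhds hρ)] with r h1 h2
      exact hr r h1 h2)
    linarith
  -- Since `x j < y j` or `y j = ∞`, the point `p` lies strictly inside the β-constraints of the
  -- larger set and can move both ways; hence `w` has no β-part.
  have hβ : ∀ j : Fin dβ, ∀ σ : ℝ, (σ = 1 ∨ σ = -1) →
      (σ • Pi.single (Sum.inr j) (1 : ℝ) : Fin dγ ⊕ Fin dβ → ℝ) ⬝ᵥ w ≤ 0 := by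
    intro j σ hσ
    apply hvar
    obtain ⟨ρ, hρ, hρ'⟩ : ∃ ρ > 0, y j = ⊤ ∨ ∀ r : ℝ, 0 ≤ r → r ≤ ρ →
        -(y j).toReal ≤ p (Sum.inr j) - r := by
      rcases hlt j with h | h
      · exact ⟨1, one_pos, Or.inl h⟩
      · by_cases hy : y j = ⊤
        · exact ⟨1, one_pos, Or.inl hy⟩
        · have hx : x j ≠ ⊤ := h.ne_top
          refine ⟨(y j).toReal - (x j).toReal, sub_pos.2 ((ENNReal.toReal_lt_toReal hx hy).2 h),
            Or.inr fun r _ hr => ?_⟩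
          rcases neg_coe_le_coe_iff.1 (hp.2 j) with h' | h'
          · exact absurd h' hx
          · linarith
    have hpy := coneSet_mono (zeroCone_subset h0) hxy hp
    refine ⟨ρ, hρ, fun r hr0 hr => ⟨?_, fun i => ?_⟩⟩
    · convert hpy.1 using 2 with i
      simp
    · rw [neg_coe_le_coe_iff]
      by_cases hij : i = j
      · subst hij
        rcases hρ' with h | h
        · exact Or.inl h
        · right
          have := h r hr0 hr
          rcases hσ with rfl | rfl
          · simp; linarith
          · simp; linarith
      · have := neg_coe_le_coe_iff.1 (hpy.2 i)
        simpa [hij] using this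
  have hwβ : ∀ j, w (Sum.inr j) = 0 := by
    intro j
    have h1 := hβ j 1 (Or.inl rfl)
    have h2 := hβ j (-1) (Or.inr rfl)
    simp at h1 h2
    linarith
  have hup : u - p = T *ᵥ w := by
    rw [hw, Matrix.mulVec_mulVec, hT, Matrix.nonsing_inv_mul _ hdetS, Matrix.one_mulVec]
  -- Here `p` has no γ-part and `w` no β-part, so only the γ-block of `S⁻¹` enters.
  have huγ : (fun i => u (Sum.inl i)) = T' *ᵥ fun i => w (Sum.inl i) := by
    funext i
    have := congrFun hup (Sum.inl i)
    simp only [Pi.sub_apply, hp0, sub_zero] at this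
    rw [this]
    simp [Matrix.mulVec, dotProduct, hwβ, hT']
  have hvu : v ⬝ᵥ (fun i => u (Sum.inl i)) = w (Sum.inl i₀) := by
    rw [huγ, dotProduct_mulVec_comm hT'pd.isSymm, hTv]
    simp
  rw [hvu]
  have hγ : ∀ σ : ℝ, (∀ r : ℝ, 0 ≤ r → r • (σ • Pi.single i₀ (1 : ℝ)) ∈ K) →
      σ * w (Sum.inl i₀) ≤ 0 := by
    intro σ hσ
    have := hvar (σ • Pi.single (Sum.inl i₀) 1) ⟨1, one_pos, fun r hr0 _ => ⟨?_, ?_⟩⟩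
    · simpa using this
    · convert hσ r hr0 using 1
      funext i
      simp only [Pi.add_apply, hp0, Pi.smul_apply, zero_add]
      congr 2
      simp [Pi.single_apply]
    · have hpy := coneSet_mono (zeroCone_subset h0) hxy hp
      convert hpy.2 using 2 with i
      simp
  constructor
  · intro h
    have := hγ 1 (by simpa using h)
    linarith
  · intro h
    have := hγ (-1) (by simpa using h)
    linarith

end Ray

/-! ### The function `𝓛` -/

section LinfLemmas

/-- The matrix `(H Ω⁻¹ H')⁻¹`. -/
noncomputable def profMat (Ω : Matrix (Idx dγ dβ dδ) (Idx dγ dβ dδ) ℝ) :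
    Matrix (Fin dγ ⊕ Fin dβ) (Fin dγ ⊕ Fin dβ) ℝ := (blockH Ω⁻¹)⁻¹

/-- The vector `H z`. -/
def selVec (z : Param dγ dβ dδ) : Fin dγ ⊕ Fin dβ → ℝ := fun a => z (selIdx a)

lemma selIdx_injective : Function.Injective (selIdx : Fin dγ ⊕ Fin dβ → Idx dγ dβ dδ) := by
  rintro (i | i) (j | j) h <;> simp_all [selIdx]

lemma continuous_selVec : Continuous (selVec : Param dγ dβ dδ → _) := by
  unfold selVec
  fun_prop

lemma posDef_profMat {Ω : Matrix (Idx dγ dβ dδ) (Idx dγ dβ dδ) ℝ} (hΩ : Ω.PosDef) :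
    (profMat Ω).PosDef :=
  (hΩ.inv.submatrix selIdx_injective).inv

lemma tendsto_profMat {Ω : Matrix (Idx dγ dβ dδ) (Idx dγ dβ dδ) ℝ} (hΩ : Ω.PosDef) :
    Tendsto profMat (𝓝 Ω) (𝓝 (profMat Ω)) := by
  refine (tendsto_matrix_inv (hΩ.inv.submatrix selIdx_injective)).comp ?_
  exact ((continuous_id.matrix_submatrix selIdx selIdx).tendsto _).comp (tendsto_matrix_inv hΩ)

namespace Model

variable {𝒲 Φ : Type*} [MeasurableSpace 𝒲] (M : Model dγ dβ dδ 𝒲 Φ)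

lemma Linf_eq (Ω : Matrix (Idx dγ dβ dδ) (Idx dγ dβ dδ) ℝ) (x y : Fin dβ → ℝ≥0∞)
    (z : Param dγ dβ dδ) : M.Linf Ω x y z =
      infQ (profMat Ω) (zeroCone dγ) x (selVec z) - infQ (profMat Ω) M.Λγ y (selVec z) := rfl

lemma zero_mem_Λγ : (0 : Fin dγ → ℝ) ∈ M.Λγ := fun _ => ⟨fun _ => le_rfl, fun _ => le_rfl⟩

lemma isClosed_Λγ : IsClosed M.Λγ := by
  have e : M.Λγ = ⋂ i, ({l | (M.γ₀ i : EReal) = M.γlow i → 0 ≤ l i} ∩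
      {l | (M.γ₀ i : EReal) = M.γU → l i ≤ 0}) := by
    ext l; simp [Λγ, Set.mem_iInter]
  rw [e]
  refine isClosed_iInter fun i => IsClosed.inter ?_ ?_
  · by_cases h : (M.γ₀ i : EReal) = M.γlow i
    · simpa [h] using isClosed_le continuous_const (continuous_apply i)
    · simp [h]
  · by_cases h : (M.γ₀ i : EReal) = M.γU
    · simpa [h] using isClosed_le (continuous_apply i) continuous_const
    · simp [h]

variable {Ω : Matrix (Idx dγ dβ dδ) (Idx dγ dβ dδ) ℝ}

theorem tendsto_Linf {α : Type*} {f : Filter α} (hΩ : Ω.PosDef)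
    {Ω' : α → Matrix (Idx dγ dβ dδ) (Idx dγ dβ dδ) ℝ} {x' y' : α → Fin dβ → ℝ≥0∞}
    {z' : α → Param dγ dβ dδ} {x y : Fin dβ → ℝ≥0∞} {z : Param dγ dβ dδ}
    (hΩ' : Tendsto Ω' f (𝓝 Ω)) (hx : Tendsto x' f (𝓝 x)) (hy : Tendsto y' f (𝓝 y))
    (hz : Tendsto z' f (𝓝 z)) :
    Tendsto (fun a => M.Linf (Ω' a) (x' a) (y' a) (z' a)) f (𝓝 (M.Linf Ω x y z)) := by
  have h1 := (tendsto_profMat hΩ).comp hΩ'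
  have h2 := (continuous_selVec.tendsto z).comp hz
  exact (tendsto_infQ (posDef_profMat hΩ) isClosed_zeroCone zero_mem_zeroCone h1 hx h2).sub
    (tendsto_infQ (posDef_profMat hΩ) M.isClosed_Λγ M.zero_mem_Λγ h1 hy h2)

lemma continuous_Linf (hΩ : Ω.PosDef) (x y : Fin dβ → ℝ≥0∞) : Continuous (M.Linf Ω x y) :=
  continuous_iff_continuousAt.2 fun _ => M.tendsto_Linf hΩ tendsto_const_nhds tendsto_const_nhds
    tendsto_const_nhds tendsto_id

/-- This monotonicity makes it conservative to replace `√n β` by the lower end of a covering band in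
the first argument and by the upper end in the second. -/
lemma Linf_mono (hΩ : Ω.PosDef) {x x' y y' : Fin dβ → ℝ≥0∞} (hx : x' ≤ x) (hy : y ≤ y')
    (z : Param dγ dβ dδ) : M.Linf Ω x y z ≤ M.Linf Ω x' y' z := by
  have hq := fun v => qf_nonneg (posDef_profMat hΩ) v
  rw [Linf_eq, Linf_eq]
  exact sub_le_sub (infQ_anti hq zero_mem_zeroCone subset_rfl hx)
    (infQ_anti hq M.zero_mem_Λγ subset_rfl hy)

/-- The apex of `{0} × Λ_β(x)`, with zeros in the coordinates of `δ`. -/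
def apexParam (x : Fin dβ → ℝ≥0∞) : Param dγ dβ dδ :=
  WithLp.toLp 2 (Sum.elim (fun _ => 0) (Sum.elim (fun i => -(x i).toReal) fun _ => 0))

lemma mul_Linf_le (hΩ : Ω.PosDef) {x y : Fin dβ → ℝ≥0∞} (hxy : x ≤ y) (z : Param dγ dβ dδ)
    {t : ℝ} (ht : 1 ≤ t) :
    t * M.Linf Ω x y z ≤ M.Linf Ω x y (apexParam x + t • (z - apexParam x)) := by
  have e : selVec (apexParam x + t • (z - apexParam x)) =
      apex x + t • (selVec z - apex x) := by
    funext i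
    rcases i with i | i <;> simp [selVec, selIdx, apexParam, apex]
  rw [Linf_eq, Linf_eq, e]
  exact mul_infQ_sub_le (posDef_profMat hΩ) M.zero_mem_Λγ hxy ht

lemma single_mem_Λγ {i₀ : Fin dγ} (h : (M.γ₀ i₀ : EReal) ≠ M.γU) {r : ℝ} (hr : 0 ≤ r) :
    r • Pi.single i₀ (1 : ℝ) ∈ M.Λγ := by
  intro i
  by_cases hi : i = i₀
  · subst hi; simp [h, hr]
  · simp [hi]

lemma neg_single_mem_Λγ {i₀ : Fin dγ} (h : (M.γ₀ i₀ : EReal) ≠ M.γlow i₀) {r : ℝ} (hr : 0 ≤ r) :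
    r • -Pi.single i₀ (1 : ℝ) ∈ M.Λγ := by
  intro i
  by_cases hi : i = i₀
  · subst hi; simp [h, hr]
  · simp [hi]

end Model

/-! ### Profiling out `δ` -/

lemma profMat_mul_blockH {Ω : Matrix (Idx dγ dβ dδ) (Idx dγ dβ dδ) ℝ} (hΩ : Ω.PosDef) :
    blockH Ω⁻¹ * profMat Ω = 1 :=
  Matrix.mul_nonsing_inv _ ((Matrix.isUnit_iff_isUnit_det _).1
    (hΩ.inv.submatrix selIdx_injective).isUnit)

/-- The selection matrix `H`. -/
def selMat (dγ dβ dδ : ℕ) : Matrix (Fin dγ ⊕ Fin dβ) (Idx dγ dβ dδ) ℝ :=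
  (1 : Matrix (Idx dγ dβ dδ) (Idx dγ dβ dδ) ℝ).submatrix selIdx id

lemma selMat_mulVec (v : Idx dγ dβ dδ → ℝ) : selMat dγ dβ dδ *ᵥ v = fun a => v (selIdx a) := by
  funext a
  simp [selMat, Matrix.mulVec, dotProduct, Matrix.one_apply]

lemma blockH_eq (A : Matrix (Idx dγ dβ dδ) (Idx dγ dβ dδ) ℝ) :
    blockH A = selMat dγ dβ dδ * A * (selMat dγ dβ dδ)ᵀ := by
  ext a b
  simp [blockH, selMat, Matrix.mul_apply, Matrix.one_apply]

/-- The lift of `r` to `ℝ^(dγ + dβ + dδ)` at which `h' Ω h` is least. -/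
noncomputable def profLift (Ω : Matrix (Idx dγ dβ dδ) (Idx dγ dβ dδ) ℝ)
    (r : Fin dγ ⊕ Fin dβ → ℝ) : Idx dγ dβ dδ → ℝ :=
  Ω⁻¹ *ᵥ ((selMat dγ dβ dδ)ᵀ *ᵥ (profMat Ω *ᵥ r))

lemma profLift_selIdx {Ω : Matrix (Idx dγ dβ dδ) (Idx dγ dβ dδ) ℝ} (hΩ : Ω.PosDef)
    (r : Fin dγ ⊕ Fin dβ → ℝ) : (fun a => profLift Ω r (selIdx a)) = r := by
  rw [← selMat_mulVec, profLift, Matrix.mulVec_mulVec, Matrix.mulVec_mulVec, Matrix.mulVec_mulVec,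
    ← blockH_eq, profMat_mul_blockH hΩ, Matrix.one_mulVec]

/-- The factor Ω cancels the Ω⁻¹ in the lift. In particular, the lift is Ω-orthogonal to all vectors
that vanish in the coordinates of γ and β. -/
lemma dotProduct_mulVec_profLift {Ω : Matrix (Idx dγ dβ dδ) (Idx dγ dβ dδ) ℝ} (hΩ : Ω.PosDef)
    (k : Idx dγ dβ dδ → ℝ) (r : Fin dγ ⊕ Fin dβ → ℝ) :
    k ⬝ᵥ (Ω *ᵥ profLift Ω r) = (fun a => k (selIdx a)) ⬝ᵥ (profMat Ω *ᵥ r) := by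
  have hdet : IsUnit Ω.det := (Matrix.isUnit_iff_isUnit_det _).1 hΩ.isUnit
  rw [profLift, Matrix.mulVec_mulVec, Matrix.mul_nonsing_inv _ hdet, Matrix.one_mulVec,
    Matrix.dotProduct_mulVec, Matrix.vecMul_transpose, selMat_mulVec]

lemma qf_profLift {Ω : Matrix (Idx dγ dβ dδ) (Idx dγ dβ dδ) ℝ} (hΩ : Ω.PosDef)
    (r : Fin dγ ⊕ Fin dβ → ℝ) : qf Ω (profLift Ω r) = qf (profMat Ω) r := by
  rw [qf, dotProduct_mulVec_profLift hΩ, profLift_selIdx hΩ, qf]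

/-- Pythagoras in the inner product Ω: `h` is the lift of its (γ, β)-part plus a remainder
orthogonal to that lift. -/
lemma qf_profMat_le {Ω : Matrix (Idx dγ dβ dδ) (Idx dγ dβ dδ) ℝ} (hΩ : Ω.PosDef)
    (h : Idx dγ dβ dδ → ℝ) : qf (profMat Ω) (fun a => h (selIdx a)) ≤ qf Ω h := by
  set r : Fin dγ ⊕ Fin dβ → ℝ := fun a => h (selIdx a) with hr
  have e : h = profLift Ω r + (h - profLift Ω r) := by abel
  have e2 : (fun a => (h - profLift Ω r) (selIdx a)) = (0 : Fin dγ ⊕ Fin dβ → ℝ) := by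
    funext a
    have := congrFun (profLift_selIdx hΩ r) a
    change h (selIdx a) - profLift Ω r (selIdx a) = 0
    rw [this]
    exact sub_self _
  rw [e, qf_add hΩ.isSymm, dotProduct_mulVec_profLift hΩ, e2, qf_profLift hΩ, zero_dotProduct]
  linarith [qf_nonneg hΩ (h - profLift Ω r)]

end LinfLemmas

/-! ### Gaussian measures -/

section Gaussian

open scoped MatrixOrder

variable {ι : Type*} [Fintype ι]

lemma measure_pi_mono {X : ι → Type*} [∀ i, MeasurableSpace (X i)] {μ ν : ∀ i, Measure (X i)}
    [∀ i, SigmaFinite (μ i)] (h : ∀ i, μ i ≤ ν i) : Measure.pi μ ≤ Measure.pi ν := by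
  refine Measure.le_iff.2 fun s hs => ?_
  have h1 : (Measure.pi μ).toOuterMeasure ≤ OuterMeasure.pi fun i => (ν i).toOuterMeasure := by
    rw [OuterMeasure.le_pi]
    intro t _
    calc Measure.pi μ (Set.univ.pi t) = ∏ i, μ i (t i) := Measure.pi_pi _ _
      _ ≤ ∏ i, ν i (t i) := Finset.prod_le_prod' fun i _ => h i (t i)
  calc Measure.pi μ s ≤ OuterMeasure.pi (fun i => (ν i).toOuterMeasure) s := h1 s
    _ = Measure.pi ν s := by rw [Measure.pi, toMeasure_apply _ _ hs]

/-- The density is at most 1 because 2π > 1. Domination by Lebesgue measure then passes directly to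
product measures. -/
lemma gaussianReal_le_volume : gaussianReal 0 1 ≤ volume := by
  rw [gaussianReal_of_var_ne_zero 0 one_ne_zero]
  conv_rhs => rw [← withDensity_one (μ := (volume : Measure ℝ))]
  refine withDensity_mono (ae_of_all _ fun x => ?_)
  rw [gaussianPDF, Pi.one_apply, ENNReal.ofReal_le_one, gaussianPDFReal]
  have h1 : (√(2 * Real.pi * (1 : NNReal)))⁻¹ ≤ 1 := by
    refine inv_le_one_of_one_le₀ (Real.one_le_sqrt.2 ?_)
    have := Real.pi_gt_three
    simp; linarith
  have h2 : Real.exp (-(x - 0) ^ 2 / (2 * (1 : NNReal))) ≤ 1 := by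
    refine Real.exp_le_one_iff.2 ?_
    exact div_nonpos_of_nonpos_of_nonneg (neg_nonpos.2 (sq_nonneg _)) (by positivity)
  exact mul_le_one₀ h1 (Real.exp_pos _).le h2

lemma stdGaussian_absolutelyContinuous :
    stdGaussian (EuclideanSpace ℝ ι) ≪ volume := by
  rw [← map_pi_eq_stdGaussian]
  have h1 : Measure.pi (fun _ : ι => gaussianReal 0 1) ≪ (volume : Measure (ι → ℝ)) :=
    (measure_pi_mono fun _ => gaussianReal_le_volume).absolutelyContinuous
  have h2 := h1.map (f := WithLp.toLp 2) (by fun_prop)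
  rwa [(PiLp.volume_preserving_toLp ι).map_eq] at h2

variable [DecidableEq ι]

/-- A coupling: Gaussian laws with different covariance matrices are represented on the one standard
Gaussian space. -/
lemma multivariateGaussian_zero_apply (A : Matrix ι ι ℝ) {s : Set (EuclideanSpace ℝ ι)}
    (hs : MeasurableSet s) : multivariateGaussian 0 A s =
      stdGaussian (EuclideanSpace ℝ ι)
        {x | Matrix.toEuclideanCLM (𝕜 := ℝ) (CFC.sqrt A) x ∈ s} := by
  rw [multivariateGaussian, Measure.map_apply (by fun_prop) hs]
  simp only [zero_add]
  rfl

lemma multivariateGaussian_absolutelyContinuous {A : Matrix ι ι ℝ} (hA : A.PosDef) :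
    multivariateGaussian 0 A ≪ volume := by
  have hsq : CFC.sqrt A * CFC.sqrt A = A := CFC.sqrt_mul_sqrt_self A hA.posSemidef.nonneg
  have hunit : IsUnit (CFC.sqrt A) := by
    rw [Matrix.isUnit_iff_isUnit_det]
    have h := (Matrix.isUnit_iff_isUnit_det _).1 hA.isUnit
    rw [← hsq, Matrix.det_mul] at h
    exact isUnit_of_mul_isUnit_left h
  set L := Matrix.toEuclideanCLM (𝕜 := ℝ) (CFC.sqrt A) with hL
  have hLu : IsUnit L := hunit.map (Matrix.toEuclideanCLM (𝕜 := ℝ) (n := ι))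
  have hdet : LinearMap.det (L : EuclideanSpace ℝ ι →ₗ[ℝ] EuclideanSpace ℝ ι) ≠ 0 :=
    (LinearMap.isUnit_det _
      (hLu.map (ContinuousLinearMap.toLinearMapRingHom (R₁ := ℝ) (M₁ := EuclideanSpace ℝ ι)))).ne_zero
  refine Measure.AbsolutelyContinuous.mk fun s hs h0 => ?_
  rw [multivariateGaussian_zero_apply A hs]
  refine stdGaussian_absolutelyContinuous ?_
  have := Measure.addHaar_preimage_linearMap (volume : Measure (EuclideanSpace ℝ ι)) hdet s
  rw [h0, mul_zero] at this
  exact this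

/-- The squared entries of the root are bounded by the diagonal of the matrix, so ultrafilter limits
exist. Such a limit is positive semidefinite with square `A`, and the positive square root is
unique. -/
lemma tendsto_sqrt {α : Type*} {f : Filter α} {A' : α → Matrix ι ι ℝ} {A : Matrix ι ι ℝ}
    (hA' : Tendsto A' f (𝓝 A)) (hpsd : ∀ᶠ a in f, (A' a).PosSemidef) :
    Tendsto (fun a => CFC.sqrt (A' a)) f (𝓝 (CFC.sqrt A)) := by
  rw [tendsto_iff_ultrafilter]
  intro g hg
  have hpsd' := hpsd.filter_mono hg
  have hA'g := hA'.mono_left hg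
  have hsymm : ∀ a, (CFC.sqrt (A' a)).PosSemidef := fun a =>
    Matrix.nonneg_iff_posSemidef.1 (CFC.sqrt_nonneg _)
  have hmul : ∀ᶠ a in (g : Filter α), CFC.sqrt (A' a) * CFC.sqrt (A' a) = A' a := by
    filter_upwards [hpsd'] with a ha
    exact CFC.sqrt_mul_sqrt_self _ ha.nonneg
  have hdiag : ∀ᶠ a in (g : Filter α), ∀ i, A' a i i < (∑ i, |A i i|) + 1 := by
    refine eventually_all.2 fun i => ?_
    have h1 : Tendsto (fun a => A' a i i) g (𝓝 (A i i)) :=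
      ((continuous_id.matrix_elem i i).tendsto A).comp hA'g
    refine h1.eventually_lt_const ?_
    have : |A i i| ≤ ∑ i, |A i i| := Finset.single_le_sum (f := fun i => |A i i|)
      (fun i _ => abs_nonneg _) (Finset.mem_univ i)
    linarith [le_abs_self (A i i)]
  set R := √((∑ i, |A i i|) + 1) with hR
  have hbd : ∀ᶠ a in (g : Filter α), CFC.sqrt (A' a) ∈ (Set.Icc (-R) R).matrix := by
    filter_upwards [hmul, hdiag] with a h1 h2 i j
    refine Set.mem_Icc.2 (abs_le.1 ?_)
    refine Real.le_sqrt_of_sq_le ?_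
    have h3 : ∑ k, CFC.sqrt (A' a) i k ^ 2 = A' a i i := by
      conv_rhs => rw [← h1, Matrix.mul_apply]
      refine Finset.sum_congr rfl fun k _ => ?_
      have := (hsymm a).isHermitian.apply i k
      simp only [star_trivial] at this
      rw [sq, this]
    have h4 : CFC.sqrt (A' a) i j ^ 2 ≤ ∑ k, CFC.sqrt (A' a) i k ^ 2 :=
      Finset.single_le_sum (f := fun k => CFC.sqrt (A' a) i k ^ 2)
        (fun k _ => sq_nonneg _) (Finset.mem_univ j)
    rw [sq_abs]
    linarith [h2 i]
  obtain ⟨B, _, hB⟩ := (IsCompact.matrix (m := ι) (n := ι) isCompact_Icc).ultrafilter_le_nhds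
    (g.map fun a => CFC.sqrt (A' a)) (le_principal_iff.2 hbd)
  have hBt : Tendsto (fun a => CFC.sqrt (A' a)) g (𝓝 B) := hB
  have hBB : B * B = A := by
    refine tendsto_nhds_unique (hBt.mul hBt) (hA'g.congr' ?_)
    exact hmul.mono fun a h => h.symm
  have hBp : B.PosSemidef := by
    refine Matrix.PosSemidef.of_dotProduct_mulVec_nonneg ?_ fun v => ?_
    · refine tendsto_nhds_unique ((continuous_id.matrix_conjTranspose.tendsto B).comp hBt)
        (hBt.congr fun a => ?_)
      exact (hsymm a).isHermitian.eq.symm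
    · refine ge_of_tendsto' (tendsto_qf hBt (tendsto_const_nhds (x := v))) fun a => ?_
      simpa [qf] using (hsymm a).dotProduct_mulVec_nonneg v
  rw [CFC.sqrt_unique hBB hBp.nonneg]
  exact hBt

lemma multivariateGaussian_map {A : Matrix ι ι ℝ} (hA : A.PosSemidef) (B : Matrix ι ι ℝ) :
    (multivariateGaussian 0 A).map (Matrix.toEuclideanCLM (𝕜 := ℝ) B) =
      multivariateGaussian 0 (B * A * Bᵀ) := by
  have hBAB : (B * A * Bᵀ).PosSemidef := by
    simpa using hA.mul_mul_conjTranspose_same B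
  have : IsProbabilityMeasure ((multivariateGaussian 0 A).map
    (Matrix.toEuclideanCLM (𝕜 := ℝ) B)) := Measure.isProbabilityMeasure_map (by fun_prop)
  refine Measure.ext_of_charFun ?_
  funext t
  rw [charFun_multivariateGaussian hBAB, charFun_apply, integral_map (by fun_prop) (by fun_prop)]
  have e : ∀ x : EuclideanSpace ℝ ι, inner ℝ (Matrix.toEuclideanCLM (𝕜 := ℝ) B x) t =
      inner ℝ x (Matrix.toEuclideanCLM (𝕜 := ℝ) Bᵀ t) := by
    intro x
    have := ContinuousLinearMap.adjoint_inner_right (Matrix.toEuclideanCLM (𝕜 := ℝ) B) x t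
    rw [← this, ← ContinuousLinearMap.star_eq_adjoint, ← map_star]
    simp [Matrix.star_eq_conjTranspose]
  simp only [e]
  rw [← charFun_apply, charFun_multivariateGaussian hA]
  congr 1
  simp only [inner_zero_right, Complex.ofReal_zero, zero_mul, zero_sub]
  congr 3
  simp only [Matrix.ofLp_toEuclideanCLM]
  rw [← Matrix.mulVec_mulVec, ← Matrix.mulVec_mulVec, Matrix.dotProduct_mulVec (t.ofLp) B,
    ← Matrix.mulVec_transpose]

lemma multivariateGaussian_neg {A : Matrix ι ι ℝ} (hA : A.PosSemidef) :
    (multivariateGaussian 0 A).map (fun x => -x) = multivariateGaussian 0 A := by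
  have := multivariateGaussian_map hA (-1)
  simp only [Matrix.transpose_neg, Matrix.transpose_one, neg_mul, one_mul, mul_neg, mul_one,
    neg_neg] at this
  rw [← this]
  congr 1
  funext x
  simp

lemma multivariateGaussian_hyperplane {A : Matrix ι ι ℝ} (hA : A.PosDef) {v : ι → ℝ} (hv : v ≠ 0)
    (c : ℝ) : multivariateGaussian 0 A {z | v ⬝ᵥ z.ofLp = c} = 0 := by
  refine multivariateGaussian_absolutelyContinuous hA ?_
  have hvv : v ⬝ᵥ v ≠ 0 := fun h => hv (dotProduct_self_eq_zero.1 h)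
  let L : EuclideanSpace ℝ ι →ₗ[ℝ] ℝ :=
    { toFun := fun z => v ⬝ᵥ z.ofLp
      map_add' := fun x y => by simp [dotProduct_add]
      map_smul' := fun r x => by simp [dotProduct_smul] }
  have hker : volume (LinearMap.ker L : Set (EuclideanSpace ℝ ι)) = 0 := by
    refine Measure.addHaar_submodule volume _ fun h => hvv ?_
    have : WithLp.toLp 2 v ∈ LinearMap.ker L := h ▸ Submodule.mem_top
    exact this
  have e : {z : EuclideanSpace ℝ ι | v ⬝ᵥ z.ofLp = c} =
      (fun z => z + -((c / (v ⬝ᵥ v)) • WithLp.toLp 2 v)) ⁻¹' (LinearMap.ker L) := by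
    ext z
    simp only [Set.mem_ofPred_eq, Set.mem_preimage, SetLike.mem_coe, LinearMap.mem_ker, ← sub_eq_add_neg, map_sub,
      map_smul, smul_eq_mul]
    change _ ↔ v ⬝ᵥ z.ofLp - c / (v ⬝ᵥ v) * (v ⬝ᵥ v) = 0
    rw [div_mul_cancel₀ _ hvv, sub_eq_zero]
  rw [e, measure_preimage_add_right]
  exact hker

/-- Symmetry exchanges the two closed half-spaces, and their common boundary is null. -/
lemma multivariateGaussian_halfspace {A : Matrix ι ι ℝ} (hA : A.PosDef) {v : ι → ℝ} (hv : v ≠ 0) :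
    multivariateGaussian 0 A {z | v ⬝ᵥ z.ofLp ≤ 0} ≤ ENNReal.ofReal (1 / 2) := by
  set μ := multivariateGaussian 0 A
  have hm : Measurable fun z : EuclideanSpace ℝ ι => v ⬝ᵥ z.ofLp := by
    unfold dotProduct; fun_prop
  have h1 : μ {z | v ⬝ᵥ z.ofLp ≤ 0} = μ {z | 0 ≤ v ⬝ᵥ z.ofLp} := by
    have h : μ {z | v ⬝ᵥ z.ofLp ≤ 0} = μ.map (fun x => -x) {z | v ⬝ᵥ z.ofLp ≤ 0} := by
      rw [multivariateGaussian_neg hA.posSemidef]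
    rw [h, Measure.map_apply (by fun_prop) (measurableSet_le hm measurable_const)]
    congr 1
    ext z
    simp
  have h2 : μ {z | 0 ≤ v ⬝ᵥ z.ofLp} = μ {z | v ⬝ᵥ z.ofLp ≤ 0}ᶜ := by
    refine measure_congr ?_
    have h0 : ∀ᵐ z ∂μ, v ⬝ᵥ z.ofLp ≠ 0 := by
      rw [ae_iff]; simpa using multivariateGaussian_hyperplane hA hv 0
    filter_upwards [h0] with z hz
    refine propext ?_
    change 0 ≤ v ⬝ᵥ z.ofLp ↔ ¬ (v ⬝ᵥ z.ofLp ≤ 0)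
    rw [not_le]
    exact ⟨fun h => lt_of_le_of_ne h (Ne.symm hz), le_of_lt⟩
  have h3 := prob_add_prob_compl (μ := μ) (measurableSet_le hm measurable_const :
    MeasurableSet {z | v ⬝ᵥ z.ofLp ≤ 0})
  rw [← h2, ← h1] at h3
  rw [one_div, ENNReal.ofReal_inv_of_pos two_pos, ENNReal.ofReal_ofNat]
  rw [← two_mul] at h3
  exact (ENNReal.eq_inv_of_mul_eq_one_left (by rw [mul_comm]; exact h3)).le

end Gaussian

/-! ### Quantiles -/

section Quantile

set_option linter.unusedSectionVars false

variable {α : Type*} [MeasurableSpace α] {μ : Measure α} [IsProbabilityMeasure μ] {X : α → ℝ}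
  {p : ℝ}

lemma ofReal_le_measure_iff (hX : Measurable X) (c : ℝ) :
    ENNReal.ofReal p ≤ μ {a | X a ≤ c} ↔ p ≤ cdf (μ.map X) c := by
  have : IsProbabilityMeasure (μ.map X) := Measure.isProbabilityMeasure_map hX.aemeasurable
  rw [cdf_eq_real, measureReal_def, Measure.map_apply hX measurableSet_Iic,
    ENNReal.ofReal_le_iff_le_toReal (measure_ne_top _ _)]
  rfl

lemma quantile_eq (hX : Measurable X) : quantile μ X p = sInf {c | p ≤ cdf (μ.map X) c} := by
  simp only [quantile, ofReal_le_measure_iff hX]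

lemma nonempty_quantile_set (hp : p < 1) : {c | p ≤ cdf (μ.map X) c}.Nonempty := by
  obtain ⟨c, hc⟩ := ((tendsto_cdf_atTop (μ.map X)).eventually_const_le hp).exists
  exact ⟨c, hc⟩

lemma bddBelow_quantile_set (hp : 0 < p) : BddBelow {c | p ≤ cdf (μ.map X) c} := by
  obtain ⟨b, hb⟩ := ((tendsto_cdf_atBot (μ.map X)).eventually_lt_const hp).exists
  refine ⟨b, fun c hc => ?_⟩
  by_contra h
  exact absurd (hc.trans (monotone_cdf _ (not_le.1 h).le)) (not_le.2 hb)

lemma le_quantile (hX : Measurable X) (hp : p < 1) {c : ℝ}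
    (h : μ {a | X a ≤ c} < ENNReal.ofReal p) : c ≤ quantile μ X p := by
  rw [← not_le, ofReal_le_measure_iff hX] at h
  rw [quantile_eq hX]
  refine le_csInf (nonempty_quantile_set hp) fun d hd => ?_
  by_contra hcd
  exact h (le_trans hd (monotone_cdf _ (not_le.1 hcd).le))

lemma measure_lt_of_lt_quantile (hX : Measurable X) (hp : 0 < p) {c : ℝ}
    (h : c < quantile μ X p) : μ {a | X a ≤ c} < ENNReal.ofReal p := by
  rw [← not_le, ofReal_le_measure_iff hX]
  rw [quantile_eq hX] at h
  exact fun hc => notMem_of_lt_csInf h (bddBelow_quantile_set hp) hc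

lemma le_measure_quantile (hX : Measurable X) (hp1 : p < 1) :
    ENNReal.ofReal p ≤ μ {a | X a ≤ quantile μ X p} := by
  rw [ofReal_le_measure_iff hX]
  have hlim : Tendsto (cdf (μ.map X)) (𝓝[>] (quantile μ X p)) (𝓝 (cdf (μ.map X) (quantile μ X p))) :=
    ((cdf (μ.map X)).right_continuous _).mono Set.Ioi_subset_Ici_self
  refine ge_of_tendsto hlim ?_
  filter_upwards [self_mem_nhdsWithin] with d hd
  rw [Set.mem_Ioi, quantile_eq hX] at hd
  obtain ⟨c, hc, hcd⟩ := exists_lt_of_csInf_lt (nonempty_quantile_set hp1) hd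
  exact le_trans hc (monotone_cdf _ hcd.le)

/-- By right continuity of the distribution function, the strict inequality at 0 persists slightly
to the right of 0. -/
lemma quantile_pos (hX : Measurable X) (hp : p < 1)
    (h : μ {a | X a ≤ 0} < ENNReal.ofReal p) : 0 < quantile μ X p := by
  have hlim : Tendsto (cdf (μ.map X)) (𝓝[>] 0) (𝓝 (cdf (μ.map X) 0)) :=
    ((cdf (μ.map X)).right_continuous _).mono Set.Ioi_subset_Ici_self
  rw [← not_le, ofReal_le_measure_iff hX, not_le] at h
  obtain ⟨d, hd, hd0⟩ := ((hlim.eventually_lt_const h).and self_mem_nhdsWithin).exists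
  refine lt_of_lt_of_le hd0 (le_quantile hX hp ?_)
  rw [← not_le, ofReal_le_measure_iff hX, not_le]
  exact hd

lemma measure_quantile_lt_le (hX : Measurable X) (hp0 : 0 < p) (hp1 : p < 1) :
    μ {a | quantile μ X p < X a} ≤ ENNReal.ofReal (1 - p) := by
  have h1 := le_measure_quantile (μ := μ) hX hp1
  have e : {a | quantile μ X p < X a} = {a | X a ≤ quantile μ X p}ᶜ := by
    ext a; simp
  rw [e, prob_compl_eq_one_sub (measurableSet_le hX measurable_const),
    ENNReal.ofReal_sub _ hp0.le, ENNReal.ofReal_one]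
  exact tsub_le_tsub_left h1 1

end Quantile

/-! ### Semicontinuity of Gaussian quantiles -/

section GaussianQuantile

variable {ι : Type*} [Fintype ι] [DecidableEq ι]

open scoped MatrixOrder in
/-- Lower semicontinuity of Gaussian quantiles in the covariance matrix and the statistic. -/
theorem eventually_le_quantile {α : Type*} {f : Filter α} [f.IsCountablyGenerated]
    {A' : α → Matrix ι ι ℝ} {A : Matrix ι ι ℝ} {X' : α → EuclideanSpace ℝ ι → ℝ}
    {X : EuclideanSpace ℝ ι → ℝ} {p : ℝ} (hp0 : 0 < p) (hp1 : p < 1)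
    (hA' : Tendsto A' f (𝓝 A)) (hpsd : ∀ᶠ a in f, (A' a).PosSemidef)
    (hX' : ∀ (z' : α → EuclideanSpace ℝ ι) (z : EuclideanSpace ℝ ι), Tendsto z' f (𝓝 z) →
      Tendsto (fun a => X' a (z' a)) f (𝓝 (X z)))
    (hmeas : ∀ᶠ a in f, Measurable (X' a)) (hX : Measurable X) {c : ℝ}
    (hc : c < quantile (multivariateGaussian 0 A) X p) :
    ∀ᶠ a in f, c ≤ quantile (multivariateGaussian 0 (A' a)) (X' a) p := by
  obtain ⟨c', hcc', hc'⟩ := exists_between hc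
  have hlt := measure_lt_of_lt_quantile hX hp0 hc'
  set γ := stdGaussian (EuclideanSpace ℝ ι) with hγ
  set Y : EuclideanSpace ℝ ι → ℝ := fun x =>
    X (Matrix.toEuclideanCLM (𝕜 := ℝ) (CFC.sqrt A) x) with hY
  set Y' : α → EuclideanSpace ℝ ι → ℝ := fun a x =>
    X' a (Matrix.toEuclideanCLM (𝕜 := ℝ) (CFC.sqrt (A' a)) x) with hY'
  have hYlim : ∀ x, Tendsto (fun a => Y' a x) f (𝓝 (Y x)) := by
    intro x
    refine hX' _ _ ?_
    have h1 : Continuous fun B : Matrix ι ι ℝ => Matrix.toEuclideanCLM (𝕜 := ℝ) B x := by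
      have : (fun B : Matrix ι ι ℝ => Matrix.toEuclideanCLM (𝕜 := ℝ) B x) =
          fun B => WithLp.toLp 2 (B *ᵥ x.ofLp) := by
        funext B
        ext i
        simp [Matrix.ofLp_toEuclideanCLM]
      rw [this]
      fun_prop
    exact (h1.tendsto _).comp (tendsto_sqrt hA' hpsd)
  have hYm : Measurable Y := hX.comp (by fun_prop)
  have hY'm : ∀ᶠ a in f, Measurable (Y' a) := by
    filter_upwards [hmeas] with a ha
    exact ha.comp (by fun_prop)
  -- A continuous ramp, 1 below `c` and 0 above `c'`. It gives P(X' ≤ c) ≤ E φ(Y') → E φ(Y) ≤ P(X ≤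
  -- c') < p by dominated convergence, which is where a countably generated filter is needed.
  let φ : ℝ → ℝ≥0∞ := fun v => ENNReal.ofReal (min 1 (max 0 ((c' - v) / (c' - c))))
  have hφc : Continuous φ := by
    refine ENNReal.continuous_ofReal.comp ?_
    fun_prop
  have hφ1 : ∀ v, φ v ≤ 1 := fun v => ENNReal.ofReal_le_one.2 (min_le_left _ _)
  have hφle : ∀ v, v ≤ c → φ v = 1 := by
    intro v hv
    have : 1 ≤ (c' - v) / (c' - c) := by
      rw [le_div_iff₀ (by linarith)]; linarith
    simp only [φ]
    rw [min_eq_left (this.trans (le_max_right _ _)), ENNReal.ofReal_one]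
  have hφge : ∀ v, c' < v → φ v = 0 := by
    intro v hv
    have : (c' - v) / (c' - c) ≤ 0 :=
      div_nonpos_of_nonpos_of_nonneg (by linarith) (by linarith)
    simp only [φ]
    rw [max_eq_left this, min_eq_right zero_le_one, ENNReal.ofReal_zero]
  have hint : Tendsto (fun a => ∫⁻ x, φ (Y' a x) ∂γ) f (𝓝 (∫⁻ x, φ (Y x) ∂γ)) := by
    refine tendsto_lintegral_filter_of_dominated_convergence (fun _ => 1) ?_ ?_ ?_ ?_
    · filter_upwards [hY'm] with a ha
      exact hφc.measurable.comp ha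
    · exact Eventually.of_forall fun a => ae_of_all _ fun x => hφ1 _
    · simp
    · exact ae_of_all _ fun x => (hφc.tendsto _).comp (hYlim x)
  have hub : ∫⁻ x, φ (Y x) ∂γ < ENNReal.ofReal p := by
    refine lt_of_le_of_lt ?_ hlt
    rw [multivariateGaussian_zero_apply A (measurableSet_le hX measurable_const)]
    change _ ≤ γ {x | Y x ≤ c'}
    rw [← lintegral_indicator_one (measurableSet_le hYm measurable_const :
      MeasurableSet {x | Y x ≤ c'})]
    refine lintegral_mono fun x => ?_
    by_cases hx : Y x ≤ c'
    · rw [Set.indicator_of_mem (show x ∈ {x | Y x ≤ c'} from hx)]; exact hφ1 _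
    · rw [hφge _ (not_le.1 hx)]; exact zero_le
  filter_upwards [hint.eventually_lt_const hub, hY'm, hmeas] with a h1 h2 h3
  refine le_quantile h3 hp1 (lt_of_le_of_lt ?_ h1)
  rw [multivariateGaussian_zero_apply _ (measurableSet_le h3 measurable_const)]
  change γ {x | Y' a x ≤ c} ≤ _
  rw [← lintegral_indicator_one (measurableSet_le h2 measurable_const :
      MeasurableSet {x | Y' a x ≤ c})]
  refine lintegral_mono fun x => ?_
  by_cases hx : Y' a x ≤ c
  · rw [hφle _ hx]
    exact Set.indicator_le_self' (fun _ _ => zero_le) _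
  · rw [Set.indicator_of_notMem (show x ∉ {x | Y' a x ≤ c} from hx)]; exact zero_le

end GaussianQuantile

/-! ### The law of `𝓛` -/

/-- A set that meets every ray from `a` at most once is null. -/
lemma addHaar_eq_zero_of_disjoint_dilations {E : Type*} [NormedAddCommGroup E] [NormedSpace ℝ E]
    [FiniteDimensional ℝ E] [MeasurableSpace E] [BorelSpace E] (μ : Measure E)
    [μ.IsAddHaarMeasure] {s : Set E} (hs : MeasurableSet s) (a : E)
    (h : ∀ z ∈ s, ∀ t : ℝ, 1 < t → a + t • (z - a) ∉ s) : μ s = 0 := by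
  by_contra hne
  let As : Set.Ioi (0 : ℝ) → Set E := fun t => AffineMap.homothety a (t : ℝ) '' s
  have hAs : ∀ t : Set.Ioi (0 : ℝ), As t = AffineMap.homothety a (t : ℝ)⁻¹ ⁻¹' s := by
    intro t
    have ht : (t : ℝ) ≠ 0 := ne_of_gt t.2
    ext x
    constructor
    · rintro ⟨z, hz, rfl⟩
      simpa [AffineMap.homothety_apply, ht, smul_smul] using hz
    · intro hx
      refine ⟨_, hx, ?_⟩
      simp [AffineMap.homothety_apply, ht, smul_smul]
  have hm : ∀ t, MeasurableSet (As t) := by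
    intro t
    rw [hAs]
    exact hs.preimage (AffineMap.homothety_continuous _ _).measurable
  have key : ∀ t t' : Set.Ioi (0 : ℝ), t < t' → Disjoint (As t) (As t') := by
    intro t t' htt'
    rw [Set.disjoint_left]
    rintro _ ⟨z, hz, rfl⟩ ⟨z', hz', e⟩
    have ht0 : (0 : ℝ) < t := t.2
    have ht0' : (0 : ℝ) < t' := t'.2
    refine h z' hz' ((t' : ℝ) / t) ((one_lt_div ht0).2 htt') ?_
    have e' : (t' : ℝ) • (z' - a) = (t : ℝ) • (z - a) := by
      simpa [AffineMap.homothety_apply] using e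
    have : a + ((t' : ℝ) / t) • (z' - a) = z := by
      rw [div_eq_inv_mul, mul_smul, e', smul_smul, inv_mul_cancel₀ ht0.ne', one_smul]
      abel
    rwa [this]
  -- The dilates of `s` are pairwise disjoint, uncountably many, and all of positive measure if `s`
  -- is; only countably many such sets can exist.
  have hd : Pairwise (Function.onFun Disjoint As) := by
    intro t t' hne
    rcases lt_or_gt_of_ne hne with h1 | h1
    · exact key t t' h1
    · exact (key t' t h1).symm
  have hc := Measure.countable_meas_pos_of_disjoint_iUnion (μ := μ) hm hd
  have huniv : {t : Set.Ioi (0 : ℝ) | 0 < μ (As t)} = Set.univ := by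
    refine Set.eq_univ_of_forall fun t => ?_
    have ht0 : (0 : ℝ) < t := t.2
    change 0 < μ (AffineMap.homothety a (t : ℝ) '' s)
    rw [Measure.addHaar_image_homothety]
    refine ENNReal.mul_pos ?_ hne
    simp [ht0.ne']
  rw [huniv, Set.countable_univ_iff, Set.countable_coe_iff] at hc
  have := Cardinal.le_aleph0_iff_set_countable.2 hc
  rw [Cardinal.mk_Ioi_real] at this
  exact absurd this (not_le.2 Cardinal.aleph0_lt_continuum)

namespace Model

variable {dγ dβ dδ : ℕ} {𝒲 Φ : Type*} [MeasurableSpace 𝒲] (M : Model dγ dβ dδ 𝒲 Φ)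
  {Ω A : Matrix (Idx dγ dβ dδ) (Idx dγ dβ dδ) ℝ} {x y : Fin dβ → ℝ≥0∞}

/-- Dilation about the apex by `t > 1` multiplies a positive value of 𝓛 by at least `t`, so each ray
meets the level `c > 0` at most once. -/
lemma measure_Linf_eq (hΩ : Ω.PosDef) (hA : A.PosDef) (hxy : x ≤ y) {c : ℝ} (hc : 0 < c) :
    multivariateGaussian 0 A {z | M.Linf Ω x y z = c} = 0 := by
  refine multivariateGaussian_absolutelyContinuous hA ?_
  refine addHaar_eq_zero_of_disjoint_dilations _
    (measurableSet_eq_fun (M.continuous_Linf hΩ x y).measurable measurable_const)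
    (apexParam x) fun z hz t ht hz' => ?_
  have h1 := M.mul_Linf_le hΩ hxy z ht.le
  rw [Set.mem_ofPred_eq] at hz hz'
  rw [hz, hz'] at h1
  nlinarith

/-- The quantiles of `𝓛(x, y)` used by the test are positive when `x < y`. -/
lemma measure_Linf_le_zero_lt (hdγ : 1 ≤ dγ) (hΩ : Ω.PosDef) (hA : A.PosDef)
    (hxy : x ≤ y) (hlt : ∀ i, y i = ⊤ ∨ x i < y i) {p : ℝ} (hp : 0 < p)
    (h : 1 / 2 < p ∨ ∃ i, M.γ₀Interior i) :
    multivariateGaussian 0 A {z | M.Linf Ω x y z ≤ 0} < ENNReal.ofReal p := by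
  -- Each direction in which the `i₀`-th coordinate of γ₀ may move gives one linear inequality on
  -- `z`. An interior coordinate gives both, hence a null hyperplane; an end point still gives a
  -- half-space.
  have hform : ∀ i₀ : Fin dγ, ∃ v : Idx dγ dβ dδ → ℝ, v ≠ 0 ∧ ∀ z : Param dγ dβ dδ,
      M.Linf Ω x y z ≤ 0 → ((M.γ₀ i₀ : EReal) ≠ M.γU → v ⬝ᵥ z.ofLp ≤ 0) ∧
        ((M.γ₀ i₀ : EReal) ≠ M.γlow i₀ → 0 ≤ v ⬝ᵥ z.ofLp) := by
    intro i₀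
    obtain ⟨v, hv, H⟩ := exists_linear_restriction (posDef_profMat hΩ) i₀
    refine ⟨Sum.elim v 0, fun h0 => hv ?_, fun z hz => ?_⟩
    · funext i
      exact congrFun h0 (Sum.inl i)
    · have e : (Sum.elim v 0 : Idx dγ dβ dδ → ℝ) ⬝ᵥ z.ofLp =
          v ⬝ᵥ fun i => selVec z (Sum.inl i) := by
        simp [dotProduct, Fintype.sum_sum_type, selVec, selIdx]
      have := H M.Λγ x y (selVec z) M.zero_mem_Λγ hxy hlt (sub_nonpos.1 hz)
      rw [e]
      exact ⟨fun hU => this.1 fun r hr => M.single_mem_Λγ hU hr,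
        fun hL => this.2 fun r hr => M.neg_single_mem_Λγ hL hr⟩
  rcases h with h | ⟨i, hi⟩
  · refine lt_of_le_of_lt ?_ ((ENNReal.ofReal_lt_ofReal_iff hp).2 h)
    obtain ⟨v, hv, H⟩ := hform ⟨0, hdγ⟩
    by_cases hU : (M.γ₀ ⟨0, hdγ⟩ : EReal) = M.γU
    · have hL : (M.γ₀ ⟨0, hdγ⟩ : EReal) ≠ M.γlow ⟨0, hdγ⟩ := by
        rw [hU]
        exact ((M.γlow_le_zero _).trans_lt M.γU_pos).ne'
      refine (measure_mono fun z hz => ?_).trans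
        (multivariateGaussian_halfspace hA (v := -v) (neg_ne_zero.2 hv))
      have := (H z hz).2 hL
      simpa using this
    · exact (measure_mono fun z hz => (H z hz).1 hU).trans (multivariateGaussian_halfspace hA hv)
  · obtain ⟨v, hv, H⟩ := hform i
    refine lt_of_le_of_lt ?_ (ENNReal.ofReal_pos.2 hp)
    rw [← multivariateGaussian_hyperplane hA hv 0]
    exact measure_mono fun z hz => le_antisymm ((H z hz).1 hi.2.ne) ((H z hz).2 hi.1.ne')

end Model

/-! ### The quadratic approximation of the likelihood ratio -/

section Norms

variable {ι : Type*} [Fintype ι]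

lemma sum_abs_le (v : ι → ℝ) : ∑ i, |v i| ≤ Fintype.card ι * ‖v‖ := by
  calc ∑ i, |v i| ≤ ∑ _i : ι, ‖v‖ := Finset.sum_le_sum fun i _ => norm_le_pi_norm v i
    _ = _ := by simp

lemma abs_dotProduct_le (v w : ι → ℝ) : |v ⬝ᵥ w| ≤ Fintype.card ι * ‖v‖ * ‖w‖ := by
  calc |v ⬝ᵥ w| ≤ ∑ i, |v i * w i| := Finset.abs_sum_le_sum_abs _ _
    _ ≤ ∑ i, |v i| * ‖w‖ := by
      refine Finset.sum_le_sum fun i _ => ?_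
      rw [abs_mul]
      exact mul_le_mul_of_nonneg_left (norm_le_pi_norm w i) (abs_nonneg _)
    _ = (∑ i, |v i|) * ‖w‖ := by rw [Finset.sum_mul]
    _ ≤ _ := mul_le_mul_of_nonneg_right (sum_abs_le v) (norm_nonneg _)

lemma norm_le_card_mul (v : EuclideanSpace ℝ ι) : ‖v‖ ≤ Fintype.card ι * ‖v.ofLp‖ := by
  refine le_trans ?_ (sum_abs_le v.ofLp)
  rw [EuclideanSpace.norm_eq]
  refine Real.sqrt_le_iff.2 ⟨Finset.sum_nonneg fun i _ => abs_nonneg _, ?_⟩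
  simp only [Real.norm_eq_abs]
  exact Finset.sum_sq_le_sq_sum_of_nonneg fun i _ => abs_nonneg _

end Norms

namespace Model

variable {dγ dβ dδ : ℕ} {𝒲 Φ : Type*} [MeasurableSpace 𝒲] (M : Model dγ dβ dδ 𝒲 Φ)

/-- Expansion of the criterion function in the local parameter `h = √n (θ - θ₀)`. -/
theorem abs_expansion_le {g : Param dγ dβ dδ → ℝ} (hg : HasContLRPartials2 M.Θ M.Θint g)
    {n : ℕ} (hn : 1 ≤ n) {Ω : Matrix (Idx dγ dβ dδ) (Idx dγ dβ dδ) ℝ} (hΩ : Ω.IsSymm)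
    {θ₀ θ : Param dγ dβ dδ} (hθ₀ : θ₀ ∈ M.Θ) (hθ : θ ∈ M.Θ) {e ε : ℝ} (he : ‖θ - θ₀‖ ≤ e)
    (hball : Metric.closedBall (del θ₀) e ⊆ interior M.Θδ)
    (hess : ∀ x ∈ M.Θ, ‖x - θ₀‖ ≤ e → ∀ i j, |(n : ℝ)⁻¹ * lrHess M.Θ g x i j + Ω i j| ≤ ε) :
    |g θ - g θ₀ - (((√n)⁻¹ • lrGrad M.Θ g θ₀).ofLp ⬝ᵥ (√n • (θ - θ₀)).ofLp -
      (1 / 2) * qf Ω (√n • (θ - θ₀)).ofLp)| ≤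
      ε * (Fintype.card (Idx dγ dβ dδ)) ^ 2 * ‖(√n • (θ - θ₀)).ofLp‖ ^ 2 := by
  have hn0 : (0 : ℝ) < n := by exact_mod_cast hn
  have hsq : √(n : ℝ) * √n = n := Real.mul_self_sqrt hn0.le
  have hs0 : 0 < √(n : ℝ) := Real.sqrt_pos.2 hn0
  have hbox : coordBox θ₀ θ ⊆ M.Θint := M.coordBox_subset_Θint (M.mem_Θ_iff.1 hθ₀).1
    (M.mem_Θ_iff.1 hθ).1 ((Metric.closedBall_subset_closedBall he).trans hball)
  -- The bound on the Hessian entries forces `0 ≤ ε` only if there is an entry.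
  have hε : 0 ≤ ε ∨ IsEmpty (Idx dγ dβ dδ) := by
    rcases isEmpty_or_nonempty (Idx dγ dβ dδ) with h | ⟨⟨i⟩⟩
    · exact Or.inr h
    · exact Or.inl ((abs_nonneg _).trans (hess θ hθ he i i))
  have T := abs_taylor_two_le (S := M.Θ) (g := g) (a := θ₀) (b := θ) (A := (n : ℝ) • Ω)
    (c := n * ε) (fun x hx => (hbox hx).1) (fun x hx => hg.1 x (hbox hx))
    (fun x hx => hg.2.1 x (hbox hx)) (by
      rw [Matrix.IsSymm, Matrix.transpose_smul, hΩ.eq]) (by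
      intro x hx i j
      have h1 := hess x (hbox hx).1 ((norm_sub_le_of_mem_coordBox hx).trans he) i j
      have h2 : lrHess M.Θ g x i j + ((n : ℝ) • Ω) i j =
          n * ((n : ℝ)⁻¹ * lrHess M.Θ g x i j + Ω i j) := by
        simp only [Matrix.smul_apply, smul_eq_mul]
        field_simp
      rw [h2, abs_mul, abs_of_pos hn0]
      exact mul_le_mul_of_nonneg_left h1 hn0.le)
  have e1 : ((√n)⁻¹ • lrGrad M.Θ g θ₀).ofLp ⬝ᵥ (√n • (θ - θ₀)).ofLp =
      ∑ i, lrGrad M.Θ g θ₀ i * (θ i - θ₀ i) := by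
    simp only [dotProduct, PiLp.smul_apply, PiLp.sub_apply, smul_eq_mul]
    refine Finset.sum_congr rfl fun i _ => ?_
    field_simp
  have e2 : qf Ω (√n • (θ - θ₀)).ofLp =
      ∑ i, ∑ j, ((n : ℝ) • Ω) i j * (θ i - θ₀ i) * (θ j - θ₀ j) := by
    simp only [qf, dotProduct, Matrix.mulVec, PiLp.smul_apply, PiLp.sub_apply, smul_eq_mul,
      Matrix.smul_apply, Finset.mul_sum]
    refine Finset.sum_congr rfl fun i _ => Finset.sum_congr rfl fun j _ => ?_
    linear_combination (Ω i j * (θ i - θ₀ i) * (θ j - θ₀ j)) * hsq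
  have e3 : g θ - g θ₀ - (∑ i, lrGrad M.Θ g θ₀ i * (θ i - θ₀ i) -
      (1 / 2) * ∑ i, ∑ j, ((n : ℝ) • Ω) i j * (θ i - θ₀ i) * (θ j - θ₀ j)) =
      g θ - g θ₀ - (∑ i, lrGrad M.Θ g θ₀ i * (θ i - θ₀ i)) +
      (1 / 2) * ∑ i, ∑ j, ((n : ℝ) • Ω) i j * (θ i - θ₀ i) * (θ j - θ₀ j) := by ring
  rw [e1, e2, e3]
  refine T.trans ?_
  have h5 : n * (∑ i, |θ i - θ₀ i|) ^ 2 = (∑ i, |(√n • (θ - θ₀)).ofLp i|) ^ 2 := by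
    simp only [PiLp.smul_apply, PiLp.sub_apply, smul_eq_mul, abs_mul, abs_of_pos hs0,
      ← Finset.mul_sum]
    rw [mul_pow, sq (√(n : ℝ)), hsq]
  rcases hε with hε | hε
  · calc n * ε * (∑ i, |θ i - θ₀ i|) ^ 2 = ε * (n * (∑ i, |θ i - θ₀ i|) ^ 2) := by ring
      _ = ε * (∑ i, |(√n • (θ - θ₀)).ofLp i|) ^ 2 := by rw [h5]
      _ ≤ ε * (Fintype.card (Idx dγ dβ dδ) * ‖(√n • (θ - θ₀)).ofLp‖) ^ 2 := by
        refine mul_le_mul_of_nonneg_left ?_ hε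
        exact pow_le_pow_left₀ (Finset.sum_nonneg fun i _ => abs_nonneg _) (sum_abs_le _) 2
      _ = _ := by ring
  · simp [Fintype.card_eq_zero]

/-- The inclusion used for the unrestricted estimator: it is exact at every `n`, because Θ_γ - γ₀
lies in Λ_γ and the upper bounds on β are simply dropped. -/
lemma sqrt_smul_sub_mem_coneSet {θ₀ θ : Param dγ dβ dδ} (hθ₀ : θ₀ ∈ M.ΘH0) (hθ : θ ∈ M.Θ)
    (n : ℕ) : (fun a => (√n • (θ - θ₀)).ofLp (selIdx a)) ∈
      coneSet M.Λγ (fun i => ENNReal.ofReal (√n * bet θ₀ i)) := by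
  have hs : 0 ≤ √(n : ℝ) := Real.sqrt_nonneg _
  refine ⟨fun i => ?_, fun i => ?_⟩
  · have h0 : M.γ₀ i = θ₀ (Sum.inl i) := (congrFun hθ₀.2 i).symm
    have hi := hθ.1 i
    simp only [selIdx, PiLp.smul_apply, PiLp.sub_apply, smul_eq_mul]
    rw [h0]
    constructor
    · intro h
      rw [← h] at hi
      exact mul_nonneg hs (sub_nonneg.2 (EReal.coe_le_coe_iff.1 hi.1))
    · intro h
      rw [← h] at hi
      exact mul_nonpos_of_nonneg_of_nonpos hs (sub_nonpos.2 (EReal.coe_le_coe_iff.1 hi.2))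
  · rw [neg_coe_le_coe_iff]
    right
    have h0 : 0 ≤ bet θ₀ i := (hθ₀.1.2.1 i).1
    have h1 : 0 ≤ bet θ i := (hθ.2.1 i).1
    rw [ENNReal.toReal_ofReal (mul_nonneg hs h0)]
    simp only [selIdx, PiLp.smul_apply, PiLp.sub_apply, smul_eq_mul]
    change -(√n * bet θ₀ i) ≤ √n * (bet θ i - bet θ₀ i)
    nlinarith [mul_nonneg hs h1]

/-- The reverse inclusion, used for the restricted problem. It holds only locally, where the upper
end point of β and the boundary of Θ_δ are out of reach. -/
lemma add_inv_sqrt_smul_mem_ΘH0 {θ₀ : Param dγ dβ dδ} (hθ₀ : θ₀ ∈ M.ΘH0) {n : ℕ} (hn : 1 ≤ n)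
    {h : Param dγ dβ dδ} {e : ℝ} (he : ‖(√n)⁻¹ • h‖ ≤ e)
    (hball : Metric.closedBall (del θ₀) e ⊆ interior M.Θδ)
    (hβ : ∀ i, ((bet θ₀ i + e : ℝ) : EReal) ≤ M.βU)
    (hh : (fun a => h.ofLp (selIdx a)) ∈
      coneSet (zeroCone dγ) (fun i => ENNReal.ofReal (√n * bet θ₀ i))) :
    θ₀ + (√n)⁻¹ • h ∈ M.ΘH0 := by
  have hn0 : (0 : ℝ) < n := by exact_mod_cast hn
  have hs0 : 0 < √(n : ℝ) := Real.sqrt_pos.2 hn0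
  have hγ : gam (θ₀ + (√n)⁻¹ • h) = gam θ₀ := by
    funext i
    have : h (Sum.inl i) = 0 := hh.1 i
    simp [gam, this]
  have hi : ∀ i, |((√n)⁻¹ • h) i| ≤ e := fun i => (PiLp.norm_apply_le _ i).trans he
  refine ⟨⟨?_, fun i => ?_, ?_⟩, hγ.trans hθ₀.2⟩
  · rw [hγ]; exact hθ₀.1.1
  · have h0 : 0 ≤ bet θ₀ i := (hθ₀.1.2.1 i).1
    have eb : bet (θ₀ + (√n)⁻¹ • h) i = bet θ₀ i + ((√n)⁻¹ • h) (Sum.inr (Sum.inl i)) := rfl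
    rw [eb]
    constructor
    · rcases neg_coe_le_coe_iff.1 (hh.2 i) with h1 | h1
      · exact absurd h1 ENNReal.ofReal_ne_top
      · rw [ENNReal.toReal_ofReal (mul_nonneg hs0.le h0)] at h1
        change -(√n * bet θ₀ i) ≤ h (Sum.inr (Sum.inl i)) at h1
        simp only [PiLp.smul_apply, smul_eq_mul]
        have h2 := mul_le_mul_of_nonneg_left h1 (inv_nonneg.2 hs0.le)
        have h3 : (√(n : ℝ))⁻¹ * -(√n * bet θ₀ i) = -bet θ₀ i := by field_simp
        linarith
    · refine le_trans (EReal.coe_le_coe_iff.2 ?_) (hβ i)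
      linarith [le_abs_self (((√n)⁻¹ • h) (Sum.inr (Sum.inl i))), hi (Sum.inr (Sum.inl i))]
  · refine interior_subset (hball ?_)
    rw [Metric.mem_closedBall, dist_eq_norm]
    refine (norm_del_sub_le _ _).trans ?_
    simpa using he

/-- The likelihood ratio statistic is at most `𝓛(√n β₀, √n β₀)`, evaluated at the normalized score,
up to a small multiple of the squared norm of the score. -/
theorem lr_le_Linf {g : Param dγ dβ dδ → ℝ} (hg : HasContLRPartials2 M.Θ M.Θint g)
    {n : ℕ} (hn : 1 ≤ n) {Ω : Matrix (Idx dγ dβ dδ) (Idx dγ dβ dδ) ℝ} (hΩ : Ω.PosDef)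
    {m : ℝ} (hm : 0 < m) (hcoer : ∀ v, m * ‖v‖ ^ 2 ≤ qf Ω v)
    {θ₀ θhat θtil : Param dγ dβ dδ} (hθ₀ : θ₀ ∈ M.ΘH0) (hhat : θhat ∈ M.Θ)
    (hmax : ∀ θ ∈ M.Θ, g θ ≤ g θhat) (hmax0 : ∀ θ ∈ M.ΘH0, g θ ≤ g θtil)
    {e ε D R : ℝ} (hD : D = Fintype.card (Idx dγ dβ dδ)) (hR : R = 4 * D / m)
    {G Z : Param dγ dβ dδ} (hG : G = (√n)⁻¹ • lrGrad M.Θ g θ₀) (hZ : Ω *ᵥ Z.ofLp = G.ofLp)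
    (he : ‖θhat - θ₀‖ ≤ e) (heG : D * (R * ‖G.ofLp‖) ≤ √n * e)
    (hball : Metric.closedBall (del θ₀) e ⊆ interior M.Θδ)
    (hβ : ∀ i, ((bet θ₀ i + e : ℝ) : EReal) ≤ M.βU) (hε0 : 0 ≤ ε) (hεm : ε * D ^ 2 ≤ m / 4)
    (hess : ∀ x ∈ M.Θ, ‖x - θ₀‖ ≤ e → ∀ i j, |(n : ℝ)⁻¹ * lrHess M.Θ g x i j + Ω i j| ≤ ε) :
    2 * (g θhat - g θtil) ≤ M.Linf Ω (fun i => ENNReal.ofReal (√n * bet θ₀ i))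
      (fun i => ENNReal.ofReal (√n * bet θ₀ i)) Z + 4 * (ε * D ^ 2 * (R * ‖G.ofLp‖) ^ 2) := by
  have hn0 : (0 : ℝ) < n := by exact_mod_cast hn
  have hs0 : 0 < √(n : ℝ) := Real.sqrt_pos.2 hn0
  have hD0 : 0 ≤ D := by rw [hD]; positivity
  have hR0 : 0 ≤ R := by rw [hR]; positivity
  set x : Fin dβ → ℝ≥0∞ := fun i => ENNReal.ofReal (√n * bet θ₀ i) with hx
  -- Completing the square around `Z = Ω⁻¹ G`.
  have hsq : ∀ h : Idx dγ dβ dδ → ℝ, G.ofLp ⬝ᵥ h - (1 / 2) * qf Ω h =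
      (1 / 2) * qf Ω Z.ofLp - (1 / 2) * qf Ω (h - Z.ofLp) := by
    intro h
    rw [sub_eq_add_neg h, qf_add hΩ.isSymm, qf_neg, neg_dotProduct,
      dotProduct_mulVec_comm hΩ.isSymm, hZ, dotProduct_comm h]
    ring
  have hDeq : (Fintype.card (Idx dγ dβ dδ) : ℝ) = D := hD.symm
  -- the unrestricted estimator
  set ĥ := (√n • (θhat - θ₀)).ofLp with hĥ
  have X1 := M.abs_expansion_le hg hn hΩ.isSymm hθ₀.1 hhat he hball hess
  rw [hDeq, ← hG, ← hĥ] at X1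
  have X1u := (abs_le.1 X1).2
  -- From `g θhat ≥ g θ₀`: half the coercivity constant, less the error `m / 4`, leaves `m / 4 ·
  -- ‖ĥ‖² ≤ D ‖G‖ ‖ĥ‖`, whence `R = 4 D / m`.
  have hĥn : ‖ĥ‖ ≤ R * ‖G.ofLp‖ := by
    have h0 : 0 ≤ g θhat - g θ₀ := sub_nonneg.2 (hmax _ hθ₀.1)
    have h1 := (abs_le.1 (abs_dotProduct_le G.ofLp ĥ)).2
    rw [hDeq] at h1
    have h2 := hcoer ĥ
    have h3 : ε * D ^ 2 * ‖ĥ‖ ^ 2 ≤ m / 4 * ‖ĥ‖ ^ 2 := by gcongr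
    have h4 : m / 4 * ‖ĥ‖ * ‖ĥ‖ ≤ D * ‖G.ofLp‖ * ‖ĥ‖ := by nlinarith
    by_cases hz : ‖ĥ‖ = 0
    · rw [hz]; positivity
    · have hpos : 0 < ‖ĥ‖ := lt_of_le_of_ne (norm_nonneg _) (Ne.symm hz)
      have h5 := le_of_mul_le_mul_right h4 hpos
      rw [hR, div_mul_eq_mul_div, le_div_iff₀ hm]
      linarith
  have hmem := M.sqrt_smul_sub_mem_coneSet hθ₀ hhat n
  have hlow : infQ (profMat Ω) M.Λγ x (selVec Z) ≤ qf Ω (ĥ - Z.ofLp) :=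
    (infQ_le (fun v => qf_nonneg (posDef_profMat hΩ) v) hmem).trans
      (qf_profMat_le hΩ (ĥ - Z.ofLp))
  -- a restricted parameter value
  obtain ⟨p, hp, hmin⟩ := exists_isMinOn_coneSet (x := x) (u := selVec Z) (posDef_profMat hΩ)
    isClosed_zeroCone zero_mem_zeroCone
  have hpq : qf (profMat Ω) (p - selVec Z) ≤ infQ (profMat Ω) (zeroCone dγ) x (selVec Z) :=
    le_infQ zero_mem_zeroCone hmin
  -- The point `Z + k` has (γ, β)-part `p`, and its δ-part is chosen so that the full quadratic form
  -- attains the profiled minimum.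
  set k := profLift Ω (p - selVec Z) with hk
  have hkq : qf Ω k = qf (profMat Ω) (p - selVec Z) := qf_profLift hΩ _
  set hs : Param dγ dβ dδ := WithLp.toLp 2 (Z.ofLp + k) with hhs
  have hsel : (fun a => hs.ofLp (selIdx a)) = p := by
    funext a
    have := congrFun (profLift_selIdx hΩ (p - selVec Z)) a
    change Z.ofLp (selIdx a) + k (selIdx a) = p a
    rw [hk, this]
    simp [selVec]
  have hZn : m * ‖Z.ofLp‖ ≤ D * ‖G.ofLp‖ ∧ qf Ω Z.ofLp ≤ D * ‖G.ofLp‖ * ‖Z.ofLp‖ := by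
    have h1 : qf Ω Z.ofLp ≤ D * ‖G.ofLp‖ * ‖Z.ofLp‖ := by
      have := (abs_le.1 (abs_dotProduct_le Z.ofLp G.ofLp)).2
      rw [qf, hZ]
      rw [hDeq] at this
      linarith
    refine ⟨?_, h1⟩
    by_cases hz : ‖Z.ofLp‖ = 0
    · rw [hz]; simp; positivity
    · have hpos : 0 < ‖Z.ofLp‖ := lt_of_le_of_ne (norm_nonneg _) (Ne.symm hz)
      refine le_of_mul_le_mul_right ?_ hpos
      have := hcoer Z.ofLp
      nlinarith
  have hkn : m * ‖k‖ ≤ D * ‖G.ofLp‖ := by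
    -- Comparison of the minimizer `p` with the admissible point 0.
    have h1 : qf Ω k ≤ qf Ω Z.ofLp := by
      rw [hkq]
      refine (hmin 0 (zero_mem_coneSet zero_mem_zeroCone)).trans ?_
      rw [zero_sub, qf_neg]
      exact qf_profMat_le hΩ Z.ofLp
    have h2 := hcoer k
    refine le_of_sq_le_sq ?_ (by positivity)
    have h3 : m * (m * ‖k‖ ^ 2) ≤ m * (D * ‖G.ofLp‖ * ‖Z.ofLp‖) :=
      mul_le_mul_of_nonneg_left (h2.trans (h1.trans hZn.2)) hm.le
    have h4 : (D * ‖G.ofLp‖) * (m * ‖Z.ofLp‖) ≤ (D * ‖G.ofLp‖) * (D * ‖G.ofLp‖) :=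
      mul_le_mul_of_nonneg_left hZn.1 (by positivity)
    nlinarith
  have hsn : ‖hs.ofLp‖ ≤ R * ‖G.ofLp‖ := by
    have h1 : ‖hs.ofLp‖ ≤ ‖Z.ofLp‖ + ‖k‖ := norm_add_le _ _
    rw [hR, div_mul_eq_mul_div, le_div_iff₀ hm]
    have : 0 ≤ D * ‖G.ofLp‖ := by positivity
    nlinarith [hZn.1]
  have hse : ‖(√n)⁻¹ • hs‖ ≤ e := by
    rw [norm_smul, norm_inv, Real.norm_eq_abs, abs_of_pos hs0, inv_mul_le_iff₀ hs0]
    refine (norm_le_card_mul hs).trans (le_trans ?_ heG)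
    rw [hDeq]
    gcongr
  have hstar := M.add_inv_sqrt_smul_mem_ΘH0 hθ₀ hn hse hball hβ (by rw [hsel]; exact hp)
  have X2 := M.abs_expansion_le hg hn hΩ.isSymm hθ₀.1 hstar.1 (by simpa using hse) hball hess
  have ehs : √n • (θ₀ + (√n)⁻¹ • hs - θ₀) = hs := by
    rw [add_sub_cancel_left, smul_smul, mul_inv_cancel₀ hs0.ne', one_smul]
  rw [hDeq, ← hG, ehs] at X2
  have X2l := (abs_le.1 X2).1
  have Y1 := hsq ĥ
  have Y2 := hsq hs.ofLp
  have ek : hs.ofLp - Z.ofLp = k := by rw [hhs]; exact add_sub_cancel_left _ _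
  rw [ek] at Y2
  -- Two expansion errors, each doubled in the likelihood ratio, give the factor 4 in the
  -- conclusion.
  have B1 : ε * D ^ 2 * ‖ĥ‖ ^ 2 ≤ ε * D ^ 2 * (R * ‖G.ofLp‖) ^ 2 := by gcongr
  have B2 : ε * D ^ 2 * ‖hs.ofLp‖ ^ 2 ≤ ε * D ^ 2 * (R * ‖G.ofLp‖) ^ 2 := by gcongr
  have hst := hmax0 _ hstar
  rw [Linf_eq]
  linarith

end Model

/-! ### Events of probability tending to one -/

section ProbFilter

variable {𝒳 : Type*} [MeasurableSpace 𝒳] {P : ℕ → Measure 𝒳}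

/-- The filter of the events whose `k`-th section has probability tending to one. -/
def probFilter (P : ℕ → Measure 𝒳) : Filter (ℕ × 𝒳) where
  sets := {S | Tendsto (fun k => P k {w | (k, w) ∉ S}) atTop (𝓝 0)}
  univ_sets := by simp
  sets_of_superset := by
    intro S S' hS hSS'
    exact tendsto_of_tendsto_of_tendsto_of_le_of_le tendsto_const_nhds hS (fun _ => zero_le)
      fun k => measure_mono fun w hw h => hw (hSS' h)
  inter_sets := by
    intro S S' hS hS'
    have h := Tendsto.add (show Tendsto _ _ _ from hS) (show Tendsto _ _ _ from hS')
    rw [add_zero] at h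
    refine tendsto_of_tendsto_of_tendsto_of_le_of_le tendsto_const_nhds h (fun _ => zero_le)
      fun k => (measure_mono fun w hw => ?_).trans (measure_union_le _ _)
    by_contra hcon
    rw [Set.mem_union, not_or] at hcon
    exact hw ⟨not_not.1 hcon.1, not_not.1 hcon.2⟩

lemma eventually_probFilter_iff {p : ℕ × 𝒳 → Prop} : (∀ᶠ q in probFilter P, p q) ↔
    Tendsto (fun k => P k {w | ¬ p (k, w)}) atTop (𝓝 0) := Iff.rfl

lemma eventually_probFilter_of_forall_lt {p : ℕ × 𝒳 → Prop}
    (h : ∀ ε : ℝ≥0∞, 0 < ε → ∀ᶠ k in atTop, P k {w | ¬ p (k, w)} ≤ ε) :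
    ∀ᶠ q in probFilter P, p q :=
  eventually_probFilter_iff.2 (ENNReal.tendsto_nhds_zero.2 h)

lemma tendsto_fst_probFilter : Tendsto Prod.fst (probFilter P) atTop := by
  intro S hS
  refine eventually_probFilter_of_forall_lt fun ε hε => ?_
  filter_upwards [hS] with k hk
  simp [hk]

lemma eventually_probFilter_of_ae {p : ℕ → 𝒳 → Prop} (h : ∀ k, ∀ᵐ w ∂(P k), p k w) :
    ∀ᶠ q in probFilter P, p q.1 q.2 := by
  refine eventually_probFilter_of_forall_lt fun ε hε => Eventually.of_forall fun k => ?_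
  rw [ae_iff.1 (h k)]
  exact zero_le

/-- A sequence that converges to zero in probability is bounded by a null sequence of constants,
with probability tending to one. -/
lemma exists_deterministic_bound {X : ℕ × 𝒳 → ℝ} (hX : Tendsto X (probFilter P) (𝓝 0)) :
    ∃ e : ℕ → ℝ, Tendsto e atTop (𝓝 0) ∧ ∀ᶠ q in probFilter P, X q ≤ e q.1 := by
  -- The infimum of `B k` measures the distance to zero in probability and tends to 0. As it need
  -- not be attained, `1 / (k + 1)` is added to obtain the bound.
  set B : ℕ → Set ℝ := fun k => {ε | 0 < ε ∧ P k {w | ε ≤ X (k, w)} ≤ ENNReal.ofReal ε} with hB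
  have hbdd : ∀ k, BddBelow (B k) := fun k => ⟨0, fun ε hε => hε.1.le⟩
  have hev : ∀ ε : ℝ, 0 < ε → ∀ᶠ k in atTop, ε ∈ B k := by
    intro ε hε
    have h1 : ∀ᶠ q in probFilter P, X q < ε := hX.eventually_lt_const hε
    have h2 := (ENNReal.tendsto_nhds_zero.1 (eventually_probFilter_iff.1 h1)) (ENNReal.ofReal ε)
      (ENNReal.ofReal_pos.2 hε)
    filter_upwards [h2] with k hk
    refine ⟨hε, ?_⟩
    simpa using hk
  have hnonneg : ∀ k, 0 ≤ sInf (B k) := fun k => Real.sInf_nonneg fun ε hε => hε.1.le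
  have hlim : Tendsto (fun k => sInf (B k)) atTop (𝓝 0) := by
    refine tendsto_order.2 ⟨fun c hc => Eventually.of_forall fun k => hc.trans_le (hnonneg k),
      fun c hc => ?_⟩
    filter_upwards [hev (c / 2) (by positivity)] with k hk
    exact (csInf_le (hbdd k) hk).trans_lt (by linarith)
  have hinv : Tendsto (fun k : ℕ => 1 / ((k : ℝ) + 1)) atTop (𝓝 0) :=
    tendsto_one_div_add_atTop_nhds_zero_nat
  have hsum : Tendsto (fun k => sInf (B k) + 1 / ((k : ℝ) + 1)) atTop (𝓝 0) := by
    simpa using hlim.add hinv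
  refine ⟨_, hsum, ?_⟩
  refine eventually_probFilter_of_forall_lt fun ε hε => ?_
  have h3 : Tendsto (fun k => ENNReal.ofReal (sInf (B k) + 1 / ((k : ℝ) + 1))) atTop (𝓝 0) := by
    simpa using (ENNReal.tendsto_ofReal hsum)
  filter_upwards [(ENNReal.tendsto_nhds_zero.1 h3) ε hε, hev 1 one_pos] with k hk hne
  refine le_trans ?_ hk
  have hpos : (0 : ℝ) < 1 / ((k : ℝ) + 1) := by positivity
  obtain ⟨c, hc, hck⟩ := exists_lt_of_csInf_lt ⟨1, hne⟩ (lt_add_of_pos_right (sInf (B k)) hpos)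
  refine le_trans (measure_mono fun w hw => ?_) (hc.2.trans (ENNReal.ofReal_le_ofReal hck.le))
  exact hck.le.trans (not_le.1 hw).le

/-- A tight sequence may be treated as bounded. -/
lemma eventually_probFilter_of_tight {X : ℕ × 𝒳 → ℝ}
    (hX : ∀ ε : ℝ≥0∞, 0 < ε → ∃ R : ℝ, ∀ᶠ k in atTop, P k {w | R ≤ X (k, w)} < ε)
    {p : ℕ × 𝒳 → Prop} (h : ∀ R : ℝ, ∀ᶠ q in probFilter P, X q < R → p q) :
    ∀ᶠ q in probFilter P, p q := by
  refine eventually_probFilter_of_forall_lt fun ε hε => ?_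
  have hε2 : 0 < ε / 2 := ENNReal.half_pos hε.ne'
  obtain ⟨R, hR⟩ := hX (ε / 2) hε2
  filter_upwards [hR, (ENNReal.tendsto_nhds_zero.1 (eventually_probFilter_iff.1 (h R))) (ε / 2) hε2]
    with k h1 h2
  calc P k {w | ¬ p (k, w)} ≤ P k ({w | R ≤ X (k, w)} ∪ {w | ¬ (X (k, w) < R → p (k, w))}) := by
        refine measure_mono fun w hw => ?_
        by_cases hw' : R ≤ X (k, w)
        · exact Or.inl hw'
        · exact Or.inr fun hcon => hw (hcon (not_le.1 hw'))
    _ ≤ ε / 2 + ε / 2 := (measure_union_le _ _).trans (add_le_add h1.le h2)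
    _ = ε := ENNReal.add_halves ε

end ProbFilter

/-! ### Convergence in distribution and moving sets -/

section Portmanteau

variable {𝒳 E E' : Type*} [MeasurableSpace 𝒳] [PseudoEMetricSpace E] [MeasurableSpace E]
  [BorelSpace E] {P : ℕ → Measure 𝒳} [∀ k, IsProbabilityMeasure (P k)]

/-- A portmanteau bound for sets that move with `k`. The closures of the tail unions decrease to a
subset of `C₀`; continuity from above selects one closed set of small limit measure that contains
all later `C k`. -/
theorem eventually_measure_lt_of_tendstoInDistribution {X : ℕ → 𝒳 → E} {μ : Measure E}
    [IsProbabilityMeasure μ] (hX : TendstoInDistribution X atTop id P μ) {C : ℕ → Set E}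
    {C₀ : Set E} (hC : ∀ z ∉ C₀, ∀ᶠ q : ℕ × E in atTop ×ˢ 𝓝 z, q.2 ∉ C q.1) {a : ℝ≥0∞}
    (ha : μ C₀ < a) : ∀ᶠ k in atTop, P k {w | X k w ∈ C k} < a := by
  set F : ℕ → Set E := fun m => closure (⋃ k ≥ m, C k) with hF
  have hanti : Antitone F := by
    intro m m' hmm'
    exact closure_mono (Set.biUnion_subset_biUnion_left fun k hk => le_trans hmm' hk)
  have hinter : ⋂ m, F m ⊆ C₀ := by
    intro z hz
    by_contra hcon
    obtain ⟨U, hU, V, hV, hUV⟩ := Filter.mem_prod_iff.1 (hC z hcon)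
    obtain ⟨m, hm⟩ := mem_atTop_sets.1 hU
    have hzm := Set.mem_iInter.1 hz m
    obtain ⟨z', hz'V, hz'⟩ := mem_closure_iff_nhds.1 hzm V hV
    obtain ⟨k, hk, hz'k⟩ := Set.mem_iUnion₂.1 hz'
    exact hUV (Set.mk_mem_prod (hm k hk) hz'V) hz'k
  have hlim : Tendsto (fun m => μ (F m)) atTop (𝓝 (μ (⋂ m, F m))) :=
    tendsto_measure_iInter_atTop (fun m => isClosed_closure.measurableSet.nullMeasurableSet) hanti
      ⟨0, measure_ne_top _ _⟩
  obtain ⟨m, hm⟩ := (hlim.eventually_lt_const ((measure_mono hinter).trans_lt ha)).exists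
  have hport := ProbabilityMeasure.limsup_measure_closed_le_of_tendsto hX.tendsto
    (isClosed_closure : IsClosed (F m))
  simp only [ProbabilityMeasure.coe_mk, Measure.map_id] at hport
  filter_upwards [eventually_lt_of_limsup_lt (hport.trans_lt hm), eventually_ge_atTop m] with k h1 h2
  rw [Measure.map_apply_of_aemeasurable (hX.forall_aemeasurable k)
    isClosed_closure.measurableSet] at h1
  refine (measure_mono fun w hw => ?_).trans_lt h1
  exact subset_closure (Set.mem_biUnion h2 hw)

lemma exists_measure_norm_ge_lt {E : Type*} [MeasurableSpace E] {μ : Measure E}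
    [IsFiniteMeasure μ] {f : E → ℝ} (hf : Measurable f) {a : ℝ≥0∞} (ha : 0 < a) :
    ∃ R : ℝ, μ {z | R ≤ f z} < a := by
  have hlim : Tendsto (fun m : ℕ => μ {z | (m : ℝ) ≤ f z}) atTop
      (𝓝 (μ (⋂ m : ℕ, {z | (m : ℝ) ≤ f z}))) := by
    refine tendsto_measure_iInter_atTop
      (fun m => (measurableSet_le measurable_const hf).nullMeasurableSet) ?_ ⟨0, measure_ne_top _ _⟩
    intro m m' hmm' z hz
    have hz' : (m' : ℝ) ≤ f z := hz
    exact le_trans (Nat.cast_le.2 hmm') hz'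
  have hempty : (⋂ m : ℕ, {z | (m : ℝ) ≤ f z}) = ∅ := by
    refine Set.eq_empty_of_forall_notMem fun z hz => ?_
    obtain ⟨m, hm⟩ := exists_nat_gt (f z)
    exact absurd (Set.mem_iInter.1 hz m) (not_le.2 hm)
  rw [hempty, measure_empty] at hlim
  obtain ⟨m, hm⟩ := (hlim.eventually_lt_const ha).exists
  exact ⟨m, hm⟩

/-- Continuity from above: a strict bound on the probability leaves room for a positive slack in the
event. -/
lemma exists_pos_measure_lt {E : Type*} [MeasurableSpace E] {μ : Measure E} [IsFiniteMeasure μ]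
    {S : ℝ → Set E} (hm : ∀ ξ, MeasurableSet (S ξ)) (hmono : Monotone S)
    (h : ∀ z ∉ S 0, ∀ᶠ ξ in 𝓝[>] 0, z ∉ S ξ) {a : ℝ≥0∞} (ha : μ (S 0) < a) :
    ∃ ξ > 0, μ (S ξ) < a := by
  have hlim := tendsto_measure_biInter_gt (μ := μ) (s := S) (a := 0)
    (fun r _ => (hm r).nullMeasurableSet) (fun i j _ hij => hmono hij)
    ⟨1, one_pos, measure_ne_top _ _⟩
  have hsub : ⋂ r > 0, S r ⊆ S 0 := by
    intro z hz
    by_contra hcon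
    obtain ⟨ξ, h1, h2⟩ := ((h z hcon).and self_mem_nhdsWithin).exists
    exact h1 (Set.mem_iInter₂.1 hz ξ h2)
  obtain ⟨ξ, h1, h2⟩ := ((hlim.eventually_lt_const ((measure_mono hsub).trans_lt ha)).and
    self_mem_nhdsWithin).exists
  exact ⟨ξ, h2, h1⟩

end Portmanteau

lemma tendsto_matrix_iff {α m n : Type*} {f : Filter α} {A' : α → Matrix m n ℝ}
    {A : Matrix m n ℝ} :
    Tendsto A' f (𝓝 A) ↔ ∀ i j, Tendsto (fun a => A' a i j) f (𝓝 (A i j)) :=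
  tendsto_pi_nhds.trans (forall_congr' fun _ => tendsto_pi_nhds)

/-- Makes neighbourhood filters of matrices countably generated, as the quantile semicontinuity
requires. -/
instance {m n : Type*} [Fintype m] [Fintype n] : FirstCountableTopology (Matrix m n ℝ) :=
  inferInstanceAs (FirstCountableTopology (m → n → ℝ))

lemma quantile_mono {α : Type*} [MeasurableSpace α] {μ : Measure α} [IsProbabilityMeasure μ]
    {X X' : α → ℝ} (hX : Measurable X) (hX' : Measurable X') (hXX' : ∀ a, X a ≤ X' a) {p : ℝ}
    (hp0 : 0 < p) (hp1 : p < 1) : quantile μ X p ≤ quantile μ X' p := by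
  refine le_of_forall_lt fun c hc => ?_
  obtain ⟨c', hcc', hc'⟩ := exists_between hc
  refine hcc'.trans_le (le_quantile hX' hp1 ?_)
  exact (measure_mono fun a ha => (hXX' a).trans ha).trans_lt (measure_lt_of_lt_quantile hX hp0 hc')

/-! ### Correlation matrices and the confidence band for β -/

section Covariance

variable {ι : Type*} [Fintype ι] [DecidableEq ι]

lemma posDef_sandwich {Ω Sig : Matrix ι ι ℝ} (hΩ : Ω.PosDef) (hS : Sig.PosDef) :
    (Ω⁻¹ * Sig * Ω⁻¹).PosDef := by
  have h := (Matrix.IsUnit.posDef_star_left_conjugate_iff (x := Sig) hΩ.inv.isUnit).2 hS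
  rwa [Matrix.star_eq_conjTranspose, hΩ.inv.isHermitian.eq] at h

/-- The correlation matrix of a covariance matrix. -/
noncomputable def corrMat (S : Matrix ι ι ℝ) : Matrix ι ι ℝ :=
  Matrix.diagonal (fun i => (√(S i i))⁻¹) * S * Matrix.diagonal (fun i => (√(S i i))⁻¹)

lemma tendsto_corrMat {S : Matrix ι ι ℝ} (hS : S.PosDef) :
    Tendsto corrMat (𝓝 S) (𝓝 (corrMat S)) := by
  have h1 : Tendsto (fun A : Matrix ι ι ℝ => Matrix.diagonal fun i => (√(A i i))⁻¹) (𝓝 S)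
      (𝓝 (Matrix.diagonal fun i => (√(S i i))⁻¹)) := by
    refine ((continuous_id.matrix_diagonal).tendsto _).comp (tendsto_pi_nhds.2 fun i => ?_)
    have hpos : 0 < S i i := hS.diag_pos
    exact (((continuous_id.matrix_elem i i).tendsto S).sqrt).inv₀ (Real.sqrt_pos.2 hpos).ne'
  exact (h1.mul tendsto_id).mul h1

lemma posDef_corrMat {S : Matrix ι ι ℝ} (hS : S.PosDef) : (corrMat S).PosDef := by
  have hu : IsUnit (Matrix.diagonal fun i => (√(S i i))⁻¹) := by
    rw [Matrix.isUnit_iff_isUnit_det, Matrix.det_diagonal, isUnit_iff_ne_zero, Finset.prod_ne_zero_iff]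
    intro i _
    have hpos : 0 < S i i := hS.diag_pos
    positivity
  have h := (Matrix.IsUnit.posDef_star_left_conjugate_iff (x := S) hu).2 hS
  rwa [Matrix.star_eq_conjTranspose, Matrix.diagonal_conjTranspose, star_trivial] at h

omit [DecidableEq ι] in
lemma iSup_abs_eq_norm (z : EuclideanSpace ℝ ι) : ⨆ i, |z i| = ‖z.ofLp‖ := by
  refine le_antisymm (Real.iSup_le (fun i => norm_le_pi_norm z.ofLp i) (norm_nonneg _)) ?_
  refine (pi_norm_le_iff_of_nonneg (Real.iSup_nonneg fun i => abs_nonneg _)).2 fun i => ?_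
  exact le_ciSup (f := fun i => |z i|) (Set.finite_range _).bddAbove i

/-- Lower semicontinuity of the quantiles of the maximum modulus of a Gaussian vector. -/
lemma eventually_le_quantile_sup {S : Matrix ι ι ℝ} (hS : S.PosDef) {p : ℝ} (hp0 : 0 < p)
    (hp1 : p < 1) {c : ℝ}
    (hc : c < quantile (multivariateGaussian 0 (corrMat S)) (fun z => ⨆ i, |z i|) p) :
    ∀ᶠ A in 𝓝 S ⊓ 𝓟 {A | A.IsSymm},
      c ≤ quantile (multivariateGaussian 0 (corrMat A)) (fun z => ⨆ i, |z i|) p := by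
  have hcont : Continuous fun z : EuclideanSpace ℝ ι => ⨆ i, |z i| := by
    simp only [iSup_abs_eq_norm]; fun_prop
  refine eventually_le_quantile (X' := fun _ z => ⨆ i, |z i|) hp0 hp1
    ((tendsto_corrMat hS).mono_left inf_le_left) ?_ (fun z' z hz => (hcont.tendsto z).comp hz)
    (Eventually.of_forall fun _ => hcont.measurable) hcont.measurable hc
  filter_upwards [(eventually_posDef hS).filter_mono inf_le_left,
    mem_inf_of_right (mem_principal_self _)] with A h1 h2
  exact (posDef_corrMat (h1 h2)).posSemidef

/-- The confidence band of half-width `q √Sᵢᵢ` has the nominal non-coverage. -/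
lemma measure_exists_le_abs_le {S : Matrix ι ι ℝ} (hS : S.PosDef) {η : ℝ} (h0 : 0 < η)
    (h1 : η < 1) : multivariateGaussian 0 S {z | ∃ i, √(S i i) *
      quantile (multivariateGaussian 0 (corrMat S)) (fun z => ⨆ i, |z i|) (1 - η) ≤ |z i|} ≤
      ENNReal.ofReal η := by
  set q := quantile (multivariateGaussian 0 (corrMat S)) (fun z => ⨆ i, |z i|) (1 - η) with hq
  set D : Matrix ι ι ℝ := Matrix.diagonal fun i => (√(S i i))⁻¹ with hD
  have hcont : Continuous fun z : EuclideanSpace ℝ ι => ⨆ i, |z i| := by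
    simp only [iSup_abs_eq_norm]; fun_prop
  have hmap : (multivariateGaussian 0 S).map (Matrix.toEuclideanCLM (𝕜 := ℝ) D) =
      multivariateGaussian 0 (corrMat S) := by
    rw [multivariateGaussian_map hS.posSemidef, hD, Matrix.diagonal_transpose]
    rfl
  have hA : multivariateGaussian 0 S {z | ∃ i, √(S i i) * q < |z i|} ≤ ENNReal.ofReal η := by
    have h2 := measure_quantile_lt_le (μ := multivariateGaussian 0 (corrMat S)) (p := 1 - η)
      hcont.measurable (by linarith) (by linarith)
    rw [← hq, sub_sub_cancel, ← hmap, Measure.map_apply (by fun_prop)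
      (measurableSet_lt measurable_const hcont.measurable)] at h2
    refine (measure_mono ?_).trans h2
    rintro z ⟨i, hi⟩
    have hpos : 0 < √(S i i) := Real.sqrt_pos.2 hS.diag_pos
    have hle : |(Matrix.toEuclideanCLM (𝕜 := ℝ) D z) i| ≤
        ⨆ i, |(Matrix.toEuclideanCLM (𝕜 := ℝ) D z) i| :=
      le_ciSup (f := fun i => |(Matrix.toEuclideanCLM (𝕜 := ℝ) D z) i|)
        (Set.finite_range _).bddAbove i
    refine lt_of_lt_of_le ?_ hle
    have e : (Matrix.toEuclideanCLM (𝕜 := ℝ) D z) i = (√(S i i))⁻¹ * z i := by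
      change (D *ᵥ z.ofLp) i = _
      rw [hD, Matrix.mulVec_diagonal]
    rw [e, abs_mul, abs_of_pos (inv_pos.2 hpos), lt_inv_mul_iff₀ hpos]
    exact hi
  -- The quantile controls the strict inequality; the boundary lies in finitely many null
  -- hyperplanes.
  have hB : multivariateGaussian 0 S (⋃ i, {z | |z i| = √(S i i) * q}) = 0 := by
    refine measure_iUnion_null fun i => ?_
    have hne : (Pi.single i (1 : ℝ) : ι → ℝ) ≠ 0 := by simp
    refine measure_mono_null ?_ (measure_union_null
      (multivariateGaussian_hyperplane hS hne (√(S i i) * q))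
      (multivariateGaussian_hyperplane hS hne (-(√(S i i) * q))))
    intro z hz
    simp only [Set.mem_union, Set.mem_ofPred_eq, single_dotProduct, one_mul]
    rcases abs_choice (z i) with h | h
    · left; rw [← h]; exact hz
    · right
      have : |z i| = √(S i i) * q := hz
      linarith
  calc _ ≤ multivariateGaussian 0 S ({z | ∃ i, √(S i i) * q < |z i|} ∪
        ⋃ i, {z | |z i| = √(S i i) * q}) := by
        refine measure_mono ?_
        rintro z ⟨i, hi⟩
        rcases lt_or_eq_of_le hi with h | h
        · exact Or.inl ⟨i, h⟩
        · exact Or.inr (Set.mem_iUnion.2 ⟨i, h.symm⟩)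
    _ ≤ _ := (measure_union_le _ _).trans (by rw [hB, add_zero]; exact hA)

end Covariance

/-! ### Semicontinuity of the critical value and the size of the limit test -/

namespace Model

variable {dγ dβ dδ : ℕ} {𝒲 Φ : Type*} [MeasurableSpace 𝒲] (M : Model dγ dβ dδ 𝒲 Φ)

lemma eventually_le_cv_of_isCountablyGenerated {Ω Sig : Matrix (Idx dγ dβ dδ) (Idx dγ dβ dδ) ℝ}
    (hΩ : Ω.PosDef) (hS : Sig.PosDef) {x y : Fin dβ → ℝ≥0∞} {p : ℝ} (hp0 : 0 < p) (hp1 : p < 1)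
    {c : ℝ} (hc : c < M.cv Ω Sig p x y) {A : Type*} {f : Filter A} [f.IsCountablyGenerated]
    {Ω' Sig' : A → Matrix (Idx dγ dβ dδ) (Idx dγ dβ dδ) ℝ} {x' y' : A → Fin dβ → ℝ≥0∞}
    (t1 : Tendsto Ω' f (𝓝 Ω)) (t2 : Tendsto Sig' f (𝓝 Sig)) (t3 : Tendsto x' f (𝓝 x))
    (t4 : Tendsto y' f (𝓝 y)) (s1 : ∀ᶠ a in f, (Ω' a).IsSymm) (s2 : ∀ᶠ a in f, (Sig' a).IsSymm) :
    ∀ᶠ a in f, c ≤ M.cv (Ω' a) (Sig' a) p (x' a) (y' a) := by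
  have p1 : ∀ᶠ a in f, (Ω' a).PosDef := by
    filter_upwards [t1.eventually (eventually_posDef hΩ), s1] with a h1 h2
    exact h1 h2
  have p2 : ∀ᶠ a in f, (Sig' a).PosDef := by
    filter_upwards [t2.eventually (eventually_posDef hS), s2] with a h1 h2
    exact h1 h2
  have tinv := (tendsto_matrix_inv hΩ).comp t1
  refine eventually_le_quantile (A' := fun a => (Ω' a)⁻¹ * Sig' a * (Ω' a)⁻¹)
    (X' := fun a => M.Linf (Ω' a) (x' a) (y' a)) hp0 hp1 ((tinv.mul t2).mul tinv) ?_
    (fun z' z hz => M.tendsto_Linf hΩ t1 t3 t4 hz) ?_ (M.continuous_Linf hΩ x y).measurable hc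
  · filter_upwards [p1, p2] with a h1 h2
    exact (posDef_sandwich h1 h2).posSemidef
  · filter_upwards [p1] with a h1
    exact (M.continuous_Linf h1 _ _).measurable

/-- Lower semicontinuity of the critical value. -/
lemma eventually_le_cv {Ω Sig : Matrix (Idx dγ dβ dδ) (Idx dγ dβ dδ) ℝ}
    (hΩ : Ω.PosDef) (hS : Sig.PosDef) {x y : Fin dβ → ℝ≥0∞} {p : ℝ} (hp0 : 0 < p) (hp1 : p < 1)
    {c : ℝ} (hc : c < M.cv Ω Sig p x y) {A : Type*} {f : Filter A}
    {Ω' Sig' : A → Matrix (Idx dγ dβ dδ) (Idx dγ dβ dδ) ℝ} {x' y' : A → Fin dβ → ℝ≥0∞}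
    (t1 : Tendsto Ω' f (𝓝 Ω)) (t2 : Tendsto Sig' f (𝓝 Sig)) (t3 : Tendsto x' f (𝓝 x))
    (t4 : Tendsto y' f (𝓝 y)) (s1 : ∀ᶠ a in f, (Ω' a).IsSymm) (s2 : ∀ᶠ a in f, (Sig' a).IsSymm) :
    ∀ᶠ a in f, c ≤ M.cv (Ω' a) (Sig' a) p (x' a) (y' a) := by
  -- The filter `f` need not be countably generated, so the statement is proved along neighbourhoods
  -- of the limit, within symmetric matrices, and then pulled back to `f`.
  have u1 : Tendsto Ω' f (𝓝 Ω ⊓ 𝓟 {B | B.IsSymm}) := tendsto_inf.2 ⟨t1, tendsto_principal.2 s1⟩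
  have u2 : Tendsto Sig' f (𝓝 Sig ⊓ 𝓟 {B | B.IsSymm}) :=
    tendsto_inf.2 ⟨t2, tendsto_principal.2 s2⟩
  have v1 : Tendsto (Prod.fst : Matrix (Idx dγ dβ dδ) (Idx dγ dβ dδ) ℝ ×
      Matrix (Idx dγ dβ dδ) (Idx dγ dβ dδ) ℝ × (Fin dβ → ℝ≥0∞) × (Fin dβ → ℝ≥0∞) → _)
      ((𝓝 Ω ⊓ 𝓟 {B | B.IsSymm}) ×ˢ (𝓝 Sig ⊓ 𝓟 {B | B.IsSymm}) ×ˢ 𝓝 x ×ˢ 𝓝 y)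
      (𝓝 Ω ⊓ 𝓟 {B | B.IsSymm}) := tendsto_fst
  have v2 := (tendsto_fst (f := 𝓝 Sig ⊓ 𝓟 {B | B.IsSymm}) (g := 𝓝 x ×ˢ 𝓝 y)).comp
    (tendsto_snd (f := 𝓝 Ω ⊓ 𝓟 {B | B.IsSymm}))
  have v3 := (tendsto_fst (f := 𝓝 x) (g := 𝓝 y)).comp
    ((tendsto_snd (f := 𝓝 Sig ⊓ 𝓟 {B | B.IsSymm})).comp
      (tendsto_snd (f := 𝓝 Ω ⊓ 𝓟 {B | B.IsSymm})))
  have v4 := (tendsto_snd (f := 𝓝 x) (g := 𝓝 y)).comp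
    ((tendsto_snd (f := 𝓝 Sig ⊓ 𝓟 {B | B.IsSymm})).comp
      (tendsto_snd (f := 𝓝 Ω ⊓ 𝓟 {B | B.IsSymm})))
  exact (u1.prodMk (u2.prodMk (t3.prodMk t4))).eventually
    (M.eventually_le_cv_of_isCountablyGenerated hΩ hS hp0 hp1 hc (v1.mono_right inf_le_left)
      (v2.mono_right inf_le_left) v3 v4 (tendsto_principal.1 (v1.mono_right inf_le_right))
      (tendsto_principal.1 (v2.mono_right inf_le_right)))

lemma cv_mono {Ω Sig : Matrix (Idx dγ dβ dδ) (Idx dγ dβ dδ) ℝ} (hΩ : Ω.PosDef)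
    {x x' y y' : Fin dβ → ℝ≥0∞} (hx : x' ≤ x) (hy : y ≤ y') {p : ℝ} (hp0 : 0 < p) (hp1 : p < 1) :
    M.cv Ω Sig p x y ≤ M.cv Ω Sig p x' y' :=
  quantile_mono (M.continuous_Linf hΩ x y).measurable (M.continuous_Linf hΩ x' y').measurable
    (M.Linf_mono hΩ hx hy) hp0 hp1

/-- The limit of the rejection probability for fixed half-lines. -/
lemma measure_cv_le_Linf_le (hdγ : 1 ≤ dγ) {Ω Sig : Matrix (Idx dγ dβ dδ) (Idx dγ dβ dδ) ℝ}
    (hΩ : Ω.PosDef) (hS : Sig.PosDef) {x y : Fin dβ → ℝ≥0∞} (hxy : x ≤ y)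
    (hlt : ∀ i, y i = ⊤ ∨ x i < y i) {p : ℝ} (hp0 : 0 < p) (hp1 : p < 1)
    (h : 1 / 2 < p ∨ ∃ i, M.γ₀Interior i) :
    multivariateGaussian 0 (Ω⁻¹ * Sig * Ω⁻¹) {z | M.cv Ω Sig p x y ≤ M.Linf Ω x y z} ≤
      ENNReal.ofReal (1 - p) := by
  have hA := posDef_sandwich hΩ hS
  have hm := (M.continuous_Linf hΩ x y).measurable
  -- Positivity comes first, because 𝓛 is known to have no atoms only at positive levels.
  have hpos : 0 < M.cv Ω Sig p x y :=
    quantile_pos hm hp1 (M.measure_Linf_le_zero_lt hdγ hΩ hA hxy hlt hp0 h)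
  have h1 := measure_quantile_lt_le (μ := multivariateGaussian 0 (Ω⁻¹ * Sig * Ω⁻¹)) hm hp0 hp1
  have h2 := M.measure_Linf_eq hΩ hA hxy hpos
  calc _ ≤ multivariateGaussian 0 (Ω⁻¹ * Sig * Ω⁻¹) ({z | M.cv Ω Sig p x y < M.Linf Ω x y z} ∪
        {z | M.Linf Ω x y z = M.cv Ω Sig p x y}) := by
        refine measure_mono fun z hz => ?_
        rcases lt_or_eq_of_le (show M.cv Ω Sig p x y ≤ M.Linf Ω x y z from hz) with h | h
        · exact Or.inl h
        · exact Or.inr h.symm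
    _ ≤ _ := (measure_union_le _ _).trans (by rw [h2, add_zero]; exact h1)

end Model

/-! ### Tight sequences -/

section Tight

variable {𝒳 E : Type*} [MeasurableSpace 𝒳] [PseudoEMetricSpace E] [MeasurableSpace E]
  [BorelSpace E] {P : ℕ → Measure 𝒳} [∀ k, IsProbabilityMeasure (P k)]

lemma exists_eventually_measure_le_lt {X : ℕ → 𝒳 → E} {μ : Measure E}
    [IsProbabilityMeasure μ] (hX : TendstoInDistribution X atTop id P μ) {f : E → ℝ}
    (hf : Continuous f) {ε : ℝ≥0∞} (hε : 0 < ε) :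
    ∃ R : ℝ, ∀ᶠ k in atTop, P k {w | R ≤ f (X k w)} < ε := by
  obtain ⟨R, hR⟩ := exists_measure_norm_ge_lt (μ := μ) hf.measurable hε
  refine ⟨R, eventually_measure_lt_of_tendstoInDistribution hX (C := fun _ => {z | R ≤ f z}) ?_ hR⟩
  intro z hz
  have hopen : IsOpen {z | R ≤ f z}ᶜ := (isClosed_le continuous_const hf).isOpen_compl
  exact tendsto_snd.eventually (hopen.mem_nhds hz)

omit [∀ k, IsProbabilityMeasure (P k)] in
lemma tendsto_div_of_tight {X : ℕ × 𝒳 → ℝ} (h0 : ∀ q, 0 ≤ X q)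
    (hX : ∀ ε : ℝ≥0∞, 0 < ε → ∃ R : ℝ, ∀ᶠ k in atTop, P k {w | R ≤ X (k, w)} < ε)
    {c : ℕ → ℝ} (hc : Tendsto c atTop atTop) :
    Tendsto (fun q => X q / c q.1) (probFilter P) (𝓝 0) := by
  refine Metric.tendsto_nhds.2 fun ε hε => eventually_probFilter_of_tight hX fun R => ?_
  filter_upwards [(hc.comp tendsto_fst_probFilter).eventually_gt_atTop 0,
    (hc.comp tendsto_fst_probFilter).eventually_gt_atTop (R / ε)] with q h1 h2 hq
  have h1' : 0 < c q.1 := h1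
  have h2' : R / ε < c q.1 := h2
  rw [Real.dist_eq, sub_zero, abs_of_nonneg (div_nonneg (h0 q) h1'.le), div_lt_iff₀ h1']
  rw [div_lt_iff₀ hε] at h2'
  linarith

end Tight

/-! ### Asymptotics along a drifting sequence -/

namespace Model

variable {dγ dβ dδ : ℕ} {𝒲 Φ : Type*} [MeasurableSpace 𝒲] {M : Model dγ dβ dδ 𝒲 Φ}

variable (M) in
/-- The laws of the data along a sequence of true parameters. -/
abbrev law (ψ : ℕ → Param dγ dβ dδ × Φ) : ℕ → Measure (ℕ → 𝒲) :=
  fun k => (M.P (ψ k) : Measure (ℕ → 𝒲))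

variable (M) in
/-- The normalized score at the true parameter. -/
noncomputable abbrev scoreAt (n : ℕ → ℕ) (ψ : ℕ → Param dγ dβ dδ × Φ) (k : ℕ) (w : ℕ → 𝒲) :
    Param dγ dβ dδ :=
  (√(n k))⁻¹ • lrGrad M.Θ (M.f (n k) (sample (n k) w)) (ψ k).1

/-- The value of `√n β` at the true parameter. -/
noncomputable abbrev localBeta (n : ℕ → ℕ) (ψ : ℕ → Param dγ dβ dδ × Φ) (k : ℕ)
    (i : Fin dβ) : ℝ≥0∞ :=
  ENNReal.ofReal (√(n k) * bet (ψ k).1 i)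

lemma IsLittleOp.tendsto {ψ : ℕ → Param dγ dβ dδ × Φ} {X : ℕ → (ℕ → 𝒲) → ℝ}
    (h : M.IsLittleOp ψ X) :
    Tendsto (fun q : ℕ × (ℕ → 𝒲) => X q.1 q.2) (probFilter (M.law ψ)) (𝓝 0) := by
  refine Metric.tendsto_nhds.2 fun ε hε => eventually_probFilter_iff.2 ?_
  simpa only [Real.dist_eq, sub_zero, not_lt] using h ε hε

lemma IsLittleOp.tendsto_of_sub {ψ : ℕ → Param dγ dβ dδ × Φ} {X : ℕ → (ℕ → 𝒲) → ℝ} {c : ℝ}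
    (h : M.IsLittleOp ψ (fun k w => X k w - c)) :
    Tendsto (fun q : ℕ × (ℕ → 𝒲) => X q.1 q.2) (probFilter (M.law ψ)) (𝓝 c) := by
  simpa using h.tendsto.add_const c

/-- The closure of the true values of δ is compact in an open set, hence has a neighbourhood of
uniform radius there. -/
lemma TrueInterior.exists_radius (h : M.TrueInterior) : ∃ r : ℝ, 0 < r ∧ ∀ ψ ∈ M.ΨH0,
    Metric.closedBall (del ψ.1) r ⊆ interior M.Θδ ∧ ∀ i, ((bet ψ.1 i + r : ℝ) : EReal) ≤ M.βU := by
  obtain ⟨h1, ε, hε, h2⟩ := h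
  have hK : IsCompact (closure ((fun ψ : Param dγ dβ dδ × Φ => del ψ.1) '' M.ΨH0)) :=
    M.isCompact_Θδ.of_isClosed_subset isClosed_closure (h1.trans interior_subset)
  obtain ⟨r, hr, hsub⟩ := hK.exists_cthickening_subset_open isOpen_interior h1
  refine ⟨min r ε, lt_min hr hε, fun ψ hψ => ⟨?_, fun i => ?_⟩⟩
  · have hmem : del ψ.1 ∈ closure ((fun ψ : Param dγ dβ dδ × Φ => del ψ.1) '' M.ΨH0) :=
      subset_closure (Set.mem_image_of_mem (fun ψ : Param dγ dβ dδ × Φ => del ψ.1) hψ)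
    have hball := (Metric.closedBall_subset_cthickening hmem r).trans hsub
    exact (Metric.closedBall_subset_closedBall (min_le_left _ _)).trans hball
  · refine le_trans ?_ (h2 ψ hψ i)
    exact_mod_cast add_le_add_right (min_le_right r ε) _

section Drifting

variable [TopologicalSpace Φ] {T : M.Estimators} {κ : ℝ} {n : ℕ → ℕ}
  {ψ : ℕ → Param dγ dβ dδ × Φ} {Ω₀ Sig₀ : Matrix (Idx dγ dβ dδ) (Idx dγ dβ dδ) ℝ}

omit [TopologicalSpace Φ] in
lemma Assumptions.posDef_Ω₀ (hA : Assumptions T κ n ψ Ω₀ Sig₀) : Ω₀.PosDef := hA.Ω₀_mem.1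

omit [TopologicalSpace Φ] in
lemma Assumptions.posDef_Sig₀ (hA : Assumptions T κ n ψ Ω₀ Sig₀) : Sig₀.PosDef := hA.Sig₀_mem.1

omit [TopologicalSpace Φ] in
lemma Assumptions.posDef_blockBeta (hA : Assumptions T κ n ψ Ω₀ Sig₀) :
    (blockBeta (Ω₀⁻¹ * Sig₀ * Ω₀⁻¹)).PosDef :=
  (posDef_sandwich hA.posDef_Ω₀ hA.posDef_Sig₀).submatrix
    (Sum.inr_injective.comp Sum.inl_injective)

omit [TopologicalSpace Φ] in
lemma Assumptions.tight_score (hA : Assumptions T κ n ψ Ω₀ Sig₀) {ε : ℝ≥0∞} (hε : 0 < ε) :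
    ∃ R : ℝ, ∀ᶠ k in atTop, M.law ψ k {w | R ≤ ‖(M.scoreAt n ψ k w).ofLp‖} < ε :=
  exists_eventually_measure_le_lt (E := Param dγ dβ dδ) hA.score
    (f := fun z : Param dγ dβ dδ => ‖z.ofLp‖) (by fun_prop) hε

lemma IsDrifting.tendsto_sqrt (hd : M.IsDrifting n ψ) :
    Tendsto (fun k => √((n k : ℕ) : ℝ)) atTop atTop :=
  Real.tendsto_sqrt_atTop.comp (tendsto_natCast_atTop_atTop.comp hd.strictMono.tendsto_atTop)

lemma IsDrifting.exists_tendsto_localBeta (hd : M.IsDrifting n ψ) :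
    ∃ b : Fin dβ → ℝ≥0∞, Tendsto (localBeta n ψ) atTop (𝓝 b) := by
  obtain ⟨b, hb⟩ := hd.tendsto_b
  exact ⟨b, tendsto_pi_nhds.2 hb⟩

/-- The estimator stays, with probability tending to one, in balls that shrink to the true
parameter and contain all points at the scale of the score. -/
lemma Assumptions.exists_rate (hA : Assumptions T κ n ψ Ω₀ Sig₀) (hd : M.IsDrifting n ψ) {C : ℝ}
    (hC : 0 ≤ C) : ∃ e : ℕ → ℝ, Tendsto e atTop (𝓝 0) ∧ ∀ᶠ q in probFilter (M.law ψ),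
      ‖T.θhat (n q.1) (sample (n q.1) q.2) - (ψ q.1).1‖ ≤ e q.1 ∧
      C * ‖(M.scoreAt n ψ q.1 q.2).ofLp‖ ≤ √(n q.1) * e q.1 := by
  have h1 := hA.consistent_hat.tendsto
  have h2 := (tendsto_div_of_tight (P := M.law ψ)
    (X := fun q => ‖(M.scoreAt n ψ q.1 q.2).ofLp‖) (fun _ => norm_nonneg _)
    (fun ε hε => hA.tight_score hε) hd.tendsto_sqrt).const_mul C
  have h3 := h1.add h2
  -- The estimation error and the scaled score are both o_p(1). One deterministic radius for their
  -- sum serves both, as Hessian equicontinuity is assumed for deterministic radii only.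
  rw [mul_zero, add_zero] at h3
  obtain ⟨e, he, hev⟩ := exists_deterministic_bound h3
  refine ⟨e, he, ?_⟩
  filter_upwards [hev] with q hq
  have hs : 0 < √((n q.1 : ℕ) : ℝ) :=
    Real.sqrt_pos.2 (by exact_mod_cast hd.pos q.1)
  have hnn : 0 ≤ C * (‖(M.scoreAt n ψ q.1 q.2).ofLp‖ / √(n q.1)) := by positivity
  refine ⟨?_, ?_⟩
  · linarith [norm_nonneg (T.θhat (n q.1) (sample (n q.1) q.2) - (ψ q.1).1)]
  · have h3 : C * (‖(M.scoreAt n ψ q.1 q.2).ofLp‖ / √(n q.1)) ≤ e q.1 := by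
      linarith [norm_nonneg (T.θhat (n q.1) (sample (n q.1) q.2) - (ψ q.1).1)]
    rw [← mul_div_assoc, div_le_iff₀ hs] at h3
    linarith

omit [TopologicalSpace Φ] in
lemma Assumptions.eventually_hess (hA : Assumptions T κ n ψ Ω₀ Sig₀) {e : ℕ → ℝ}
    (he : Tendsto e atTop (𝓝 0)) {ε : ℝ} (hε : 0 < ε) : ∀ᶠ q in probFilter (M.law ψ),
      ∀ θ ∈ M.Θ, ‖θ - (ψ q.1).1‖ ≤ e q.1 → ∀ i j,
        |((n q.1 : ℕ) : ℝ)⁻¹ * lrHess M.Θ (M.f (n q.1) (sample (n q.1) q.2)) θ i j + Ω₀ i j| ≤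
          ε := by
  have h1 : ∀ᶠ q in probFilter (M.law ψ), ¬ ∃ θ ∈ M.Θ, ‖θ - (ψ q.1).1‖ ≤ e q.1 ∧ ∃ i j,
      ε / 2 ≤ |((n q.1 : ℕ) : ℝ)⁻¹ * lrHess M.Θ (M.f (n q.1) (sample (n q.1) q.2)) θ i j -
        ((n q.1 : ℕ) : ℝ)⁻¹ * lrHess M.Θ (M.f (n q.1) (sample (n q.1) q.2)) (ψ q.1).1 i j| := by
    refine eventually_probFilter_iff.2 ?_
    simp only [not_not]
    exact hA.equicontinuous e he (ε / 2) (half_pos hε)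
  have h2 : ∀ᶠ q in probFilter (M.law ψ), ∀ i j,
      |((n q.1 : ℕ) : ℝ)⁻¹ * lrHess M.Θ (M.f (n q.1) (sample (n q.1) q.2)) (ψ q.1).1 i j -
        (-Ω₀) i j| < ε / 2 := by
    refine eventually_all.2 fun i => eventually_all.2 fun j => ?_
    have h3 := Metric.tendsto_nhds.1 (hA.hessian i j).tendsto (ε / 2) (half_pos hε)
    simpa only [Real.dist_eq, sub_zero] using h3
  filter_upwards [h1, h2] with q hq1 hq2 θ hθ hle i j
  have h3 := hq2 i j
  have h4 : _ < ε / 2 := not_le.1 fun h => hq1 ⟨θ, hθ, hle, i, j, h⟩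
  rw [Matrix.neg_apply] at h3
  rw [abs_le]
  rw [abs_lt] at h3 h4
  constructor <;> linarith

lemma IsDrifting.eventually_closedBall_subset (hd : M.IsDrifting n ψ) (hint : M.TrueInterior) {e : ℕ → ℝ}
    (he : Tendsto e atTop (𝓝 0)) : ∀ᶠ k in atTop,
      Metric.closedBall (del (ψ k).1) (e k) ⊆ interior M.Θδ ∧
      ∀ i, ((bet (ψ k).1 i + e k : ℝ) : EReal) ≤ M.βU := by
  obtain ⟨r, hr, hsub⟩ := hint.exists_radius
  filter_upwards [he.eventually_lt_const hr] with k hk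
  refine ⟨(Metric.closedBall_subset_closedBall hk.le).trans (hsub _ (hd.mem k)).1, fun i => ?_⟩
  refine le_trans ?_ ((hsub _ (hd.mem k)).2 i)
  exact_mod_cast add_le_add_right hk.le _

lemma IsDrifting.eventually_argmax (hd : M.IsDrifting n ψ) : ∀ᶠ q in probFilter (M.law ψ),
    (T.θhat (n q.1) (sample (n q.1) q.2) ∈ M.Θ ∧ ∀ θ ∈ M.Θ,
      M.f (n q.1) (sample (n q.1) q.2) θ ≤
        M.f (n q.1) (sample (n q.1) q.2) (T.θhat (n q.1) (sample (n q.1) q.2))) ∧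
    ∀ θ ∈ M.ΘH0, M.f (n q.1) (sample (n q.1) q.2) θ ≤
        M.f (n q.1) (sample (n q.1) q.2) (T.θtil (n q.1) (sample (n q.1) q.2)) := by
  refine (eventually_probFilter_of_ae fun k =>
    T.argmax_θhat (ψ k) (hd.mem k) (n k) (hd.pos k)).and ?_
  filter_upwards [eventually_probFilter_of_ae fun k =>
    T.argmax_θtil (ψ k) (hd.mem k) (n k) (hd.pos k)] with q hq
  exact hq.2

/-- The quadratic approximation of the likelihood ratio statistic. -/
theorem Assumptions.eventually_LR_le (hA : Assumptions T κ n ψ Ω₀ Sig₀) (hd : M.IsDrifting n ψ)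
    (hint : M.TrueInterior) {τ : ℝ} (hτ : 0 < τ) : ∀ᶠ q in probFilter (M.law ψ),
      T.LR (n q.1) (sample (n q.1) q.2) ≤ M.Linf Ω₀ (localBeta n ψ q.1) (localBeta n ψ q.1)
        (Matrix.toEuclideanCLM (𝕜 := ℝ) Ω₀⁻¹ (M.scoreAt n ψ q.1 q.2)) + τ := by
  have hΩ := hA.posDef_Ω₀
  obtain ⟨m, hm, hcoer⟩ := exists_coercive hΩ
  set D : ℝ := ((Fintype.card (Idx dγ dβ dδ) : ℕ) : ℝ) with hD
  have hD0 : 0 ≤ D := by positivity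
  set R : ℝ := 4 * D / m with hR
  have hR0 : 0 ≤ R := by positivity
  obtain ⟨e, he, hrate⟩ := hA.exists_rate hd (mul_nonneg hD0 hR0)
  refine eventually_probFilter_of_tight (X := fun q => ‖(M.scoreAt n ψ q.1 q.2).ofLp‖)
    (fun ε hε => hA.tight_score hε) fun B => ?_
  -- Tightness fixes the bound `B` on the score before the Hessian accuracy `ε` is chosen.
  have hε : ∃ ε > 0, ε * D ^ 2 ≤ m / 4 ∧ 4 * (ε * D ^ 2 * (R * B) ^ 2) ≤ τ := by
    have h1 : Tendsto (fun ε : ℝ => ε * D ^ 2) (𝓝[>] 0) (𝓝 0) :=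
      (Continuous.tendsto' (by fun_prop) _ _ (by simp)).mono_left nhdsWithin_le_nhds
    have h2 : Tendsto (fun ε : ℝ => 4 * (ε * D ^ 2 * (R * B) ^ 2)) (𝓝[>] 0) (𝓝 0) :=
      (Continuous.tendsto' (by fun_prop) _ _ (by simp)).mono_left nhdsWithin_le_nhds
    obtain ⟨ε, ⟨h3, h4⟩, h5⟩ := (((h1.eventually_le_const (show 0 < m / 4 by positivity)).and
      (h2.eventually_le_const hτ)).and self_mem_nhdsWithin).exists
    exact ⟨ε, h5, h3, h4⟩
  obtain ⟨ε, hε0, hεm, hετ⟩ := hε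
  filter_upwards [hrate, hA.eventually_hess he hε0, hd.eventually_argmax (T := T),
    eventually_probFilter_of_ae hA.smooth,
    tendsto_fst_probFilter.eventually (hd.eventually_closedBall_subset hint he)]
    with q hq1 hq2 hq3 hq4 hq5 hB
  have hθ₀ : (ψ q.1).1 ∈ M.ΘH0 := ⟨(hd.mem q.1).1.1, (hd.mem q.1).2⟩
  have hZ : Ω₀ *ᵥ (Matrix.toEuclideanCLM (𝕜 := ℝ) Ω₀⁻¹ (M.scoreAt n ψ q.1 q.2)).ofLp =
      (M.scoreAt n ψ q.1 q.2).ofLp := by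
    change Ω₀ *ᵥ (Ω₀⁻¹ *ᵥ (M.scoreAt n ψ q.1 q.2).ofLp) = _
    rw [Matrix.mulVec_mulVec, Matrix.mul_nonsing_inv _ ((Matrix.isUnit_iff_isUnit_det _).1
      hΩ.isUnit), Matrix.one_mulVec]
  have hmain := M.lr_le_Linf hq4 (hd.pos q.1) hΩ hm hcoer hθ₀ hq3.1.1 hq3.1.2 hq3.2 hD hR rfl hZ
    hq1.1 (by rw [← mul_assoc]; exact hq1.2) hq5.1 hq5.2 hε0.le hεm hq2
  refine hmain.trans (add_le_add_right (le_trans ?_ hετ) _)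
  have hBle : ‖(M.scoreAt n ψ q.1 q.2).ofLp‖ ≤ B := hB.le
  gcongr

lemma Assumptions.tendsto_Omhat (hA : Assumptions T κ n ψ Ω₀ Sig₀) (hd : M.IsDrifting n ψ) :
    Tendsto (fun q => T.Omhat (n q.1) (sample (n q.1) q.2)) (probFilter (M.law ψ)) (𝓝 Ω₀) := by
  obtain ⟨e, he, hrate⟩ := hA.exists_rate hd le_rfl
  refine tendsto_matrix_iff.2 fun i j => Metric.tendsto_nhds.2 fun ε hε => ?_
  filter_upwards [hrate, hA.eventually_hess he (half_pos hε), hd.eventually_argmax (T := T)]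
    with q hq1 hq2 hq3
  have h1 := hq2 _ hq3.1.1 hq1.1 i j
  rw [Real.dist_eq, ← abs_neg]
  refine lt_of_eq_of_lt ?_ (h1.trans_lt (half_lt_self hε))
  congr 1
  simp only [Estimators.Omhat, Matrix.neg_apply, Matrix.smul_apply, smul_eq_mul]
  ring

/-- Together with convergence to Ω₀, this makes the estimate positive definite with probability
tending to one. -/
lemma Assumptions.eventually_isSymm_Omhat (hA : Assumptions T κ n ψ Ω₀ Sig₀)
    (hd : M.IsDrifting n ψ) (hint : M.TrueInterior) : ∀ᶠ q in probFilter (M.law ψ),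
      (T.Omhat (n q.1) (sample (n q.1) q.2)).IsSymm := by
  obtain ⟨e, he, hrate⟩ := hA.exists_rate hd le_rfl
  filter_upwards [hrate, hd.eventually_argmax (T := T), eventually_probFilter_of_ae hA.smooth,
    tendsto_fst_probFilter.eventually (hd.eventually_closedBall_subset hint he)] with q hq1 hq2 hq3 hq4
  have hmem : T.θhat (n q.1) (sample (n q.1) q.2) ∈ M.Θint := by
    refine ⟨hq2.1.1, hq4.1 ?_⟩
    rw [mem_closedBall_iff_norm]
    exact (norm_del_sub_le _ _).trans hq1.1
  exact ((M.isSymm_lrHess hq3 hmem).smul _).neg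

omit [TopologicalSpace Φ] in
lemma Assumptions.tendsto_Sighat (hA : Assumptions T κ n ψ Ω₀ Sig₀) :
    Tendsto (fun q => T.Sighat (n q.1) (sample (n q.1) q.2)) (probFilter (M.law ψ)) (𝓝 Sig₀) :=
  tendsto_matrix_iff.2 fun i j => (hA.covariance i j).tendsto_of_sub

omit [TopologicalSpace Φ] in
lemma Assumptions.tendsto_Sigβchk (hA : Assumptions T κ n ψ Ω₀ Sig₀) :
    Tendsto (fun q => T.Sigβchk (n q.1) (sample (n q.1) q.2)) (probFilter (M.law ψ))
      (𝓝 (blockBeta (Ω₀⁻¹ * Sig₀ * Ω₀⁻¹))) :=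
  tendsto_matrix_iff.2 fun i j => (hA.covariance_β i j).tendsto_of_sub

omit [TopologicalSpace Φ] in
lemma Assumptions.eventually_le_qchk (hA : Assumptions T κ n ψ Ω₀ Sig₀) {η : ℝ} (h0 : 0 < η)
    (h1 : η < 1) {c : ℝ} (hc : c < quantile (multivariateGaussian 0
      (corrMat (blockBeta (Ω₀⁻¹ * Sig₀ * Ω₀⁻¹)))) (fun z => ⨆ i, |z i|) (1 - η)) :
    ∀ᶠ q in probFilter (M.law ψ), c ≤ T.qchk η (n q.1) (sample (n q.1) q.2) :=
  (tendsto_inf.2 ⟨hA.tendsto_Sigβchk, tendsto_principal.2 (Eventually.of_forall fun q =>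
    T.isSymm_Sigβchk (n q.1) (sample (n q.1) q.2))⟩).eventually
    (eventually_le_quantile_sup hA.posDef_blockBeta (by linarith) (by linarith) hc)

omit [TopologicalSpace Φ] in
/-- Where the confidence band covers `β` with a margin, the data-dependent bounds are on the
conservative side. -/
lemma localBeta_band {k : ℕ} {s ζ : ℝ} {i : Fin dβ} {b h : ℝ} (hζ : 0 ≤ ζ)
    (hβ : 0 ≤ bet (ψ k).1 i) (hY : |√(n k) * (b - bet (ψ k).1 i)| < s) (hs : s + ζ ≤ h) :
    ENNReal.ofReal (√(n k) * b - h) ≤ localBeta n ψ k i ∧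
      localBeta n ψ k i + ENNReal.ofReal ζ ≤ ENNReal.ofReal (√(n k) * b + h) := by
  rw [mul_sub, abs_lt] at hY
  constructor
  · exact ENNReal.ofReal_le_ofReal (by linarith)
  · rw [localBeta, ← ENNReal.ofReal_add (by positivity) hζ]
    exact ENNReal.ofReal_le_ofReal (by linarith)

/-- The critical value is asymptotically at least that of the limit experiment, off the event
that the confidence band fails to cover `β`. -/
theorem Assumptions.eventually_le_CV (hA : Assumptions T κ n ψ Ω₀ Sig₀) (hd : M.IsDrifting n ψ)
    (hint : M.TrueInterior) {α η : ℝ} (h0 : 0 < η) (hηα : η < α) (hα : α < 1)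
    {b : Fin dβ → ℝ≥0∞} (hb : Tendsto (localBeta n ψ) atTop (𝓝 b)) {r ξ ζ : ℝ}
    (hr : r = quantile (multivariateGaussian 0
      (corrMat (blockBeta (Ω₀⁻¹ * Sig₀ * Ω₀⁻¹)))) (fun z => ⨆ i, |z i|) (1 - η))
    (hξ : 0 < ξ) (hζ : 0 < ζ)
    (hζξ : ∀ i, ζ < √(blockBeta (Ω₀⁻¹ * Sig₀ * Ω₀⁻¹) i i) * (ξ / 2)) {c : ℝ}
    (hc : c < M.cv Ω₀ Sig₀ (1 - α + η) b (b + fun _ => ENNReal.ofReal ζ)) :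
    ∀ᶠ q in probFilter (M.law ψ),
      (∀ i, |√(n q.1) * (T.βchk (n q.1) (sample (n q.1) q.2) i - bet (ψ q.1).1 i)| <
        √(blockBeta (Ω₀⁻¹ * Sig₀ * Ω₀⁻¹) i i) * (r - ξ)) →
      c ≤ T.CV α η (n q.1) (sample (n q.1) q.2) := by
  have hp0 : 0 < 1 - α + η := by linarith
  have hp1 : 1 - α + η < 1 := by linarith
  have hΩt := hA.tendsto_Omhat hd
  have hsymm := hA.eventually_isSymm_Omhat hd hint
  have hbF : Tendsto (fun q : ℕ × (ℕ → 𝒲) => localBeta n ψ q.1) (probFilter (M.law ψ)) (𝓝 b) :=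
    hb.comp tendsto_fst_probFilter
  have hcv := M.eventually_le_cv hA.posDef_Ω₀ hA.posDef_Sig₀ hp0 hp1 hc hΩt hA.tendsto_Sighat hbF
    (hbF.add_const _) hsymm (Eventually.of_forall fun q => T.isSymm_Sighat _ _)
  -- Half of the slack `ξ` absorbs the estimation of the quantile `r`; the other half leaves room
  -- for `ζ` and the error in the standard deviations.
  have hq := hA.eventually_le_qchk h0 (hηα.trans hα) (c := r - ξ / 2) (by rw [← hr]; linarith)
  have hwidth : ∀ᶠ q in probFilter (M.law ψ), ∀ i,
      √(blockBeta (Ω₀⁻¹ * Sig₀ * Ω₀⁻¹) i i) * (r - ξ) + ζ <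
        (r - ξ / 2) * √(T.Sigβchk (n q.1) (sample (n q.1) q.2) i i) := by
    refine eventually_all.2 fun i => ?_
    have h1 := ((tendsto_matrix_iff.1 hA.tendsto_Sigβchk i i).sqrt).const_mul (r - ξ / 2)
    refine h1.eventually_const_lt ?_
    linarith [hζξ i]
  filter_upwards [hcv, hq, hwidth, hsymm, hΩt.eventually (eventually_posDef hA.posDef_Ω₀)]
    with q hq1 hq2 hq3 hq4 hq5 hY
  have hband := fun i => localBeta_band (n := n) (ψ := ψ) hζ.le ((hd.mem q.1).1.1.2.1 i).1 (hY i)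
    ((hq3 i).le.trans (mul_le_mul_of_nonneg_right hq2 (Real.sqrt_nonneg _)))
  exact hq1.trans (M.cv_mono (hq5 hq4) (fun i => (hband i).1) (fun i => (hband i).2) hp0 hp1)

-- A band narrower by the factor `r - ξ` in place of `r` still has non-coverage near `η`; the width
-- given up is what pays for the margin `ζ`.
omit [TopologicalSpace Φ] in
lemma Assumptions.exists_band (hA : Assumptions T κ n ψ Ω₀ Sig₀) {η : ℝ} (h0 : 0 < η)
    (h1 : η < 1) {r : ℝ} (hr : r = quantile (multivariateGaussian 0
      (corrMat (blockBeta (Ω₀⁻¹ * Sig₀ * Ω₀⁻¹)))) (fun z => ⨆ i, |z i|) (1 - η))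
    {a : ℝ≥0∞} (ha : ENNReal.ofReal η < a) : ∃ ξ > 0, ∀ᶠ k in atTop, M.law ψ k {w | ∃ i,
      √(blockBeta (Ω₀⁻¹ * Sig₀ * Ω₀⁻¹) i i) * (r - ξ) ≤
        |√(n k) * (T.βchk (n k) (sample (n k) w) i - bet (ψ k).1 i)|} < a := by
  set S := blockBeta (Ω₀⁻¹ * Sig₀ * Ω₀⁻¹) with hS
  have hclosed : ∀ ξ : ℝ, IsClosed {z : EuclideanSpace ℝ (Fin dβ) |
      ∃ i, √(S i i) * (r - ξ) ≤ |z i|} := by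
    intro ξ
    have : {z : EuclideanSpace ℝ (Fin dβ) | ∃ i, √(S i i) * (r - ξ) ≤ |z i|} =
        ⋃ i, {z | √(S i i) * (r - ξ) ≤ |z i|} := by
      ext z; simp
    rw [this]
    exact isClosed_iUnion_of_finite fun i => isClosed_le continuous_const (by fun_prop)
  suffices hex : ∃ ξ > 0, multivariateGaussian 0 S
      {z | ∃ i, √(S i i) * (r - ξ) ≤ |z i|} < a by
    obtain ⟨ξ, hξ, hlt⟩ := hex
    refine ⟨ξ, hξ, ?_⟩
    exact eventually_measure_lt_of_tendstoInDistribution hA.normal_β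
      (C := fun _ => {z : EuclideanSpace ℝ (Fin dβ) | ∃ i, √(S i i) * (r - ξ) ≤ |z i|})
      (fun z hz => tendsto_snd.eventually ((hclosed ξ).isOpen_compl.mem_nhds hz)) hlt
  refine exists_pos_measure_lt (μ := multivariateGaussian 0 S)
    (S := fun ξ => {z : EuclideanSpace ℝ (Fin dβ) | ∃ i, √(S i i) * (r - ξ) ≤ |z i|})
    (fun ξ => (hclosed ξ).measurableSet) ?_ ?_ ?_
  · rintro ξ ξ' hξξ' z ⟨i, hi⟩
    exact ⟨i, le_trans (by gcongr) hi⟩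
  · intro z hz
    have h2 : ∀ᶠ ξ in 𝓝[>] (0 : ℝ), ∀ i, |z i| < √(S i i) * (r - ξ) := by
      refine eventually_all.2 fun i => ?_
      have h3 : Tendsto (fun ξ : ℝ => √(S i i) * (r - ξ)) (𝓝[>] 0) (𝓝 (√(S i i) * (r - 0))) :=
        (Continuous.tendsto (by fun_prop) _).mono_left nhdsWithin_le_nhds
      exact h3.eventually_const_lt (not_le.1 fun h => hz ⟨i, h⟩)
    filter_upwards [h2] with ξ hξ
    rintro ⟨i, hi⟩
    exact absurd (hξ i) (not_lt.2 hi)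
  · refine lt_of_le_of_lt ?_ ha
    have h2 := measure_exists_le_abs_le hA.posDef_blockBeta h0 h1
    rw [← hr] at h2
    simpa only [sub_zero] using h2

-- The slack `τ` absorbs the o_p(1) errors of the statistic and the critical value. The event moves
-- with `localBeta`, so the moving-set portmanteau bound is used, and `ζ > 0` supplies the
-- strictness behind the positive quantile.
omit [TopologicalSpace Φ] in
lemma Assumptions.exists_margin (hA : Assumptions T κ n ψ Ω₀ Sig₀) (hdγ : 1 ≤ dγ) {p : ℝ}
    (hp0 : 0 < p) (hp1 : p < 1) (h : 1 / 2 < p ∨ ∃ i, M.γ₀Interior i)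
    {b : Fin dβ → ℝ≥0∞} (hb : Tendsto (localBeta n ψ) atTop (𝓝 b)) {ζ : ℝ} (hζ : 0 < ζ)
    {a : ℝ≥0∞} (ha : ENNReal.ofReal (1 - p) < a) : ∃ τ > 0, ∀ᶠ k in atTop, M.law ψ k {w |
      M.cv Ω₀ Sig₀ p b (b + fun _ => ENNReal.ofReal ζ) - τ ≤
        M.Linf Ω₀ (localBeta n ψ k) (localBeta n ψ k + fun _ => ENNReal.ofReal ζ)
          (Matrix.toEuclideanCLM (𝕜 := ℝ) Ω₀⁻¹ (M.scoreAt n ψ k w))} < a := by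
  have hΩ := hA.posDef_Ω₀
  set y := b + fun _ => ENNReal.ofReal ζ with hy
  set c := M.cv Ω₀ Sig₀ p b y with hc
  have hby : b ≤ y := fun i => le_self_add
  have hlt : ∀ i, y i = ⊤ ∨ b i < y i := by
    intro i
    by_cases hi : b i = ⊤
    · left; simp [hy, hi]
    · right; exact ENNReal.lt_add_right hi (ENNReal.ofReal_pos.2 hζ).ne'
  have hcont := M.continuous_Linf hΩ b y
  suffices hex : ∃ τ > 0, multivariateGaussian 0 (Ω₀⁻¹ * Sig₀ * Ω₀⁻¹)
      {z | c - τ ≤ M.Linf Ω₀ b y z} < a by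
    obtain ⟨τ, hτ, hτa⟩ := hex
    refine ⟨τ, hτ, ?_⟩
    refine eventually_measure_lt_of_tendstoInDistribution hA.score
      (C := fun k => {g | c - τ ≤ M.Linf Ω₀ (localBeta n ψ k)
        (localBeta n ψ k + fun _ => ENNReal.ofReal ζ) (Matrix.toEuclideanCLM (𝕜 := ℝ) Ω₀⁻¹ g)})
      (C₀ := {g | c - τ ≤ M.Linf Ω₀ b y (Matrix.toEuclideanCLM (𝕜 := ℝ) Ω₀⁻¹ g)}) ?_ ?_
    · intro z hz
      have hbF : Tendsto (fun q : ℕ × Param dγ dβ dδ => localBeta n ψ q.1) (atTop ×ˢ 𝓝 z) (𝓝 b) :=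
        hb.comp tendsto_fst
      have hzF : Tendsto (fun q : ℕ × Param dγ dβ dδ => Matrix.toEuclideanCLM (𝕜 := ℝ) Ω₀⁻¹ q.2)
          (atTop ×ˢ 𝓝 z) (𝓝 (Matrix.toEuclideanCLM (𝕜 := ℝ) Ω₀⁻¹ z)) :=
        ((Matrix.toEuclideanCLM (𝕜 := ℝ) Ω₀⁻¹).continuous.tendsto z).comp tendsto_snd
      have ht := M.tendsto_Linf hΩ tendsto_const_nhds hbF
        (hbF.add_const (fun _ => ENNReal.ofReal ζ)) hzF
      filter_upwards [ht.eventually_lt_const (not_le.1 hz)] with q hq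
      exact not_le.2 hq
    · have hmap := multivariateGaussian_map hA.posDef_Sig₀.posSemidef Ω₀⁻¹
      rw [hΩ.inv.isSymm.eq] at hmap
      rw [← hmap, Measure.map_apply (by fun_prop)
        (measurableSet_le measurable_const hcont.measurable)] at hτa
      exact hτa
  refine exists_pos_measure_lt (μ := multivariateGaussian 0 (Ω₀⁻¹ * Sig₀ * Ω₀⁻¹))
    (S := fun τ => {z | c - τ ≤ M.Linf Ω₀ b y z})
    (fun τ => measurableSet_le measurable_const hcont.measurable) ?_ ?_ ?_
  · intro τ τ' hττ' z hz
    have hz' : c - τ ≤ M.Linf Ω₀ b y z := hz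
    change c - τ' ≤ _
    linarith
  · intro z hz
    have h3 : Tendsto (fun τ : ℝ => c - τ) (𝓝[>] 0) (𝓝 (c - 0)) :=
      (Continuous.tendsto (by fun_prop) _).mono_left nhdsWithin_le_nhds
    filter_upwards [h3.eventually_const_lt (not_le.1 hz)] with τ hτ
    exact not_le.2 hτ
  · refine lt_of_le_of_lt ?_ ha
    simpa only [sub_zero] using M.measure_cv_le_Linf_le hdγ hΩ hA.posDef_Sig₀ hby hlt hp0 hp1 h

/-- The asymptotic rejection probability along a drifting sequence is at most `α`. -/
theorem Assumptions.eventually_measure_reject_lt (hA : Assumptions T κ n ψ Ω₀ Sig₀)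
    (hd : M.IsDrifting n ψ) (hdγ : 1 ≤ dγ) (hint : M.TrueInterior) {α η : ℝ} (h0 : 0 < η)
    (hηα : η < α) (hα : α < 1) (h : α - η < 1 / 2 ∨ ∃ i, M.γ₀Interior i) {a : ℝ≥0∞}
    (ha : ENNReal.ofReal α < a) : ∀ᶠ k in atTop, M.law ψ k {w |
      T.CV α η (n k) (sample (n k) w) ≤ T.LR (n k) (sample (n k) w)} < a := by
  -- The excess `ε` is split in three: failure of the asymptotic bounds, non-coverage by the band,
  -- and exceedance of the limit quantile.
  obtain ⟨ε, hε, hεa⟩ := ENNReal.lt_iff_exists_add_pos_lt.1 ha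
  have hε3 : (0 : ℝ≥0∞) < ((ε / 3 : NNReal) : ℝ≥0∞) := by
    rw [ENNReal.coe_pos]; positivity
  have hp0 : 0 < 1 - α + η := by linarith
  have hp1 : 1 - α + η < 1 := by linarith
  obtain ⟨b, hb⟩ := hd.exists_tendsto_localBeta
  obtain ⟨ξ, hξ, hband⟩ := hA.exists_band h0 (hηα.trans hα) rfl
    (ENNReal.lt_add_right ENNReal.ofReal_ne_top hε3.ne' : ENNReal.ofReal η < _)
  have hζ : ∃ ζ > 0, ∀ i, ζ < √(blockBeta (Ω₀⁻¹ * Sig₀ * Ω₀⁻¹) i i) * (ξ / 2) := by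
    have h1 : ∀ᶠ ζ in 𝓝[>] (0 : ℝ), ∀ i,
        ζ < √(blockBeta (Ω₀⁻¹ * Sig₀ * Ω₀⁻¹) i i) * (ξ / 2) := by
      refine eventually_all.2 fun i => nhdsWithin_le_nhds (eventually_lt_nhds ?_)
      have hpos : 0 < √(blockBeta (Ω₀⁻¹ * Sig₀ * Ω₀⁻¹) i i) :=
        Real.sqrt_pos.2 hA.posDef_blockBeta.diag_pos
      positivity
    obtain ⟨ζ, h2, h3⟩ := (h1.and self_mem_nhdsWithin).exists
    exact ⟨ζ, h3, h2⟩
  obtain ⟨ζ, hζ, hζξ⟩ := hζ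
  obtain ⟨τ, hτ, hmargin⟩ := hA.exists_margin hdγ hp0 hp1
    (h.imp_left fun h => by linarith) hb hζ
    (ENNReal.lt_add_right ENNReal.ofReal_ne_top hε3.ne' : ENNReal.ofReal (1 - (1 - α + η)) < _)
  set c := M.cv Ω₀ Sig₀ (1 - α + η) b (b + fun _ => ENNReal.ofReal ζ) with hc
  have hgood := (hA.eventually_LR_le hd hint (half_pos hτ)).and
    (hA.eventually_le_CV hd hint h0 hηα hα hb rfl hξ hζ hζξ (sub_lt_self c (half_pos hτ)))
  filter_upwards [hband, hmargin,
    (eventually_probFilter_iff.1 hgood).eventually_lt_const hε3] with k h1 h2 h3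
  have hsum : ENNReal.ofReal η + ENNReal.ofReal (1 - (1 - α + η)) = ENNReal.ofReal α := by
    rw [← ENNReal.ofReal_add h0.le (by linarith)]
    congr 1; ring
  refine lt_of_le_of_lt (measure_mono ?_ |>.trans ((measure_union_le _ _).trans (add_le_add
    (measure_union_le _ _) le_rfl))) (((ENNReal.add_lt_add (ENNReal.add_lt_add h3 h1) h2)).trans_le
      (le_trans (le_of_eq ?_) hεa.le))
  · intro w hw
    have hw' : T.CV α η (n k) (sample (n k) w) ≤ T.LR (n k) (sample (n k) w) := hw
    by_contra hcon
    rw [Set.mem_union, Set.mem_union, not_or, not_or] at hcon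
    obtain ⟨⟨hc1, hc2⟩, hc3⟩ := hcon
    obtain ⟨hg1, hg2⟩ := not_not.1 hc1
    have hg3 := hg2 fun i => not_le.1 fun hi => hc2 ⟨i, hi⟩
    -- Outside the three events rejection is impossible: it would give c - τ/2 ≤ CV ≤ LR ≤ 𝓛 + τ/2,
    -- and enlarging the second argument by `ζ` only raises 𝓛.
    have hmono := M.Linf_mono hA.posDef_Ω₀ (le_refl (localBeta n ψ k))
      (show localBeta n ψ k ≤ localBeta n ψ k + fun _ => ENNReal.ofReal ζ from
        fun i => by rw [Pi.add_apply]; exact le_self_add)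
      (Matrix.toEuclideanCLM (𝕜 := ℝ) Ω₀⁻¹ (M.scoreAt n ψ k w))
    refine hc3 ?_
    change c - τ ≤ _
    change T.LR (n k) (sample (n k) w) ≤ M.Linf Ω₀ (localBeta n ψ k) (localBeta n ψ k)
        (Matrix.toEuclideanCLM (𝕜 := ℝ) Ω₀⁻¹ (M.scoreAt n ψ k w)) + τ / 2 at hg1
    linarith
  · have h4 : (ε : ℝ≥0∞) = ((ε / 3 : NNReal) : ℝ≥0∞) + ((ε / 3 : NNReal) : ℝ≥0∞) +
        ((ε / 3 : NNReal) : ℝ≥0∞) := by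
      rw [← ENNReal.coe_add, ← ENNReal.coe_add, add_thirds]
    rw [h4, ← hsum]
    ring

end Drifting

/-- Compactness: every sequence of null parameters has a drifting subsequence. -/
lemma exists_isDrifting_comp [MetricSpace Φ] [CompactSpace Φ] {n : ℕ → ℕ}
    (hn : StrictMono n) (hn1 : ∀ k, 1 ≤ n k) {ψ : ℕ → Param dγ dβ dδ × Φ}
    (hψ : ∀ k, ψ k ∈ M.ΨH0) :
    ∃ u : ℕ → ℕ, StrictMono u ∧ M.IsDrifting (n ∘ u) (ψ ∘ u) := by
  -- Taking β and √nβ in the compact space [0,∞]^dβ dispenses with any boundedness.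
  have hK : IsCompact ((Set.univ : Set (Fin dβ → ℝ≥0∞)) ×ˢ (Set.univ : Set (Fin dβ → ℝ≥0∞)) ×ˢ
      M.Θδ ×ˢ (Set.univ : Set Φ)) :=
    isCompact_univ.prod (isCompact_univ.prod (M.isCompact_Θδ.prod isCompact_univ))
  obtain ⟨l, -, u, hu, hlim⟩ := hK.tendsto_subseq (x := fun k =>
    ((fun i => ENNReal.ofReal (bet (ψ k).1 i), localBeta n ψ k, del (ψ k).1, (ψ k).2) :
      (Fin dβ → ℝ≥0∞) × (Fin dβ → ℝ≥0∞) × EuclideanSpace ℝ (Fin dδ) × Φ))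
    fun k => ⟨trivial, trivial, (hψ k).1.1.2.2, trivial⟩
  obtain ⟨h1, h2⟩ := Prod.tendsto_iff _ _ |>.1 hlim
  obtain ⟨h2, h3⟩ := Prod.tendsto_iff _ _ |>.1 h2
  obtain ⟨h3, h4⟩ := Prod.tendsto_iff _ _ |>.1 h3
  exact ⟨u, hu, ⟨hn.comp hu, fun k => hn1 _, fun k => hψ _, ⟨l.1, tendsto_pi_nhds.1 h1⟩,
    ⟨_, h3⟩, ⟨_, h4⟩, ⟨l.2.1, tendsto_pi_nhds.1 h2⟩⟩⟩

end Model

end LRSize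

/-! ### Reduction of uniform size control to drifting sequences -/

theorem theorem1 {dγ dβ dδ : ℕ} (hdγ : 1 ≤ dγ)
    {𝒲 Φ : Type*} [MeasurableSpace 𝒲] [MetricSpace Φ] [CompactSpace Φ]
    (M : LRSize.Model dγ dβ dδ 𝒲 Φ)
    (hγ₀ : M.γ₀ ∈ M.Θγ) (hint : M.TrueInterior)
    (T : M.Estimators) (κ : ℝ) (hκ : 0 < κ)
    (hass : ∀ (n : ℕ → ℕ) (ψ : ℕ → LRSize.Param dγ dβ dδ × Φ), M.IsDrifting n ψ →
      ∃ Ω₀ Sig₀ : Matrix (LRSize.Idx dγ dβ dδ) (LRSize.Idx dγ dβ dδ) ℝ,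
        LRSize.Model.Assumptions T κ n ψ Ω₀ Sig₀)
    (α η : ℝ) (hα : α ∈ Set.Ioo (0 : ℝ) 1) (hη : η ∈ Set.Ioo (0 : ℝ) α)
    (hαη : α - η < 1 / 2 ∨ ∃ i, M.γ₀Interior i) :
    Filter.limsup
      (fun n : ℕ => ⨆ ψ ∈ M.ΨH0,
        (M.P ψ : MeasureTheory.Measure (ℕ → 𝒲))
          {w | T.CV α η n (LRSize.Model.sample n w) ≤ T.LR n (LRSize.Model.sample n w)})
      Filter.atTop ≤ ENNReal.ofReal α := by
  by_contra hcon
  obtain ⟨a, ha, hlt⟩ := exists_between (not_le.1 hcon)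
  -- The supremum need not be attained; the gap between α and the limsup leaves room for a
  -- near-maximizing parameter at infinitely many sample sizes.
  have hfreq : ∃ᶠ n in Filter.atTop, 1 ≤ n ∧ ∃ ψ ∈ M.ΨH0,
      a < (M.P ψ : MeasureTheory.Measure (ℕ → 𝒲))
        {w | T.CV α η n (LRSize.Model.sample n w) ≤ T.LR n (LRSize.Model.sample n w)} := by
    refine ((Filter.frequently_lt_of_lt_limsup (by isBoundedDefault) hlt).and_eventually
      (Filter.eventually_ge_atTop 1)).mono ?_
    rintro n ⟨h1, h2⟩
    obtain ⟨ψ, h3⟩ := lt_iSup_iff.1 h1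
    obtain ⟨h4, h5⟩ := lt_iSup_iff.1 h3
    exact ⟨h2, ψ, h4, h5⟩
  obtain ⟨n, hn, hnP⟩ := Filter.extraction_of_frequently_atTop hfreq
  choose hn1 ψ hψ hψa using hnP
  obtain ⟨u, hu, hd⟩ := LRSize.Model.exists_isDrifting_comp hn hn1 hψ
  obtain ⟨Ω₀, Sig₀, hA⟩ := hass _ _ hd
  obtain ⟨k, hk⟩ := (hA.eventually_measure_reject_lt hd hdγ hint hη.1 hη.2 hα.2 hαη ha).exists
  exact absurd hk (not_lt.2 (hψa (u k)).le)
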